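/- Let $p$ be a prime, $F$ a finite extension of $\mathbf{Q}_p$ with residue field $k_F$ of cardinality $q$ and uniformizer $\pi$, and let $k$ be an algebraically closed field containing $k_F$. Put $L=F\otimes_{W(k_F)}W(k)$, a field, and let $\sigma=\mathrm{id}\otimes\sigma_0$, where $\sigma_0$ is the automorphism of $W(k)$ induced by $x\mapsto x^q$ on $k$. An isocrystal relative to $(F,k)$ is a finite-dimensional $L$-vector space $D$ with a bijective $\sigma$-linear endomorphism $\varphi$; a sub-isocrystal is an $L$-subspace $D'$ on which $\varphi$ restricts to a bijection $\varphi'$. The Newton vector $\nu(D,\varphi)=(\nu_1\ge\dots\ge\nu_d)\in\mathbf{Q}^d$, $d=\dim_L D$, is the sequence of slopes in decreasing order: the multiplicity of $\alpha=r/s$ (lowest terms, $s>0$) is the dimension of the $L$-span of $\{v\in D:\varphi^s(v)=\pi^r v\}$. A filtration $\mathcal F^\bullet$ of $D$ is a decreasing, exhaustive, separated filtration by $L$-subspaces indexed by $\mathbf{Z}$; it is of type $\mu=(\mu_1\ge\dots\ge\mu_d)\in\mathbf{Z}^d$ if $\dim_L(\mathcal F^i/\mathcal F^{i+1})=\#\{j:\mu_j=i\}$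 for all $i\in\mathbf{Z}$, and every filtration has a unique type $\mu(\mathcal F^\bullet)$. Write $|\lambda|=\sum_j\lambda_j$. The filtration is (weakly) admissible if $|\mu(\mathcal F^\bullet)|=|\nu(D,\varphi)|$ and if for every sub-isocrystal $(D',\varphi')$, with the induced filtration $\mathcal F'^\bullet=\mathcal F^\bullet\cap D'$, one has $|\mu(\mathcal F'^\bullet)|\le|\nu(D',\varphi')|$. **Theorem.** Let $(D,\varphi)$ be an isocrystal of dimension $d$ relative to $(F,k)$ and let $\mu=(\mu_1\ge\dots\ge\mu_d)\in\mathbf{Z}^d$. There is a (weakly) admissible filtration of type $\mu$ on $D$ if and only if $\mu\ge\nu(D,\varphi)$, that is, $\mu_1+\dots+\mu_r\ge\nu_1+\dots+\nu_r$ for $1\le r\le d-1$ and $\mu_1+\dots+\mu_d=\nu_1+\dots+\nu_d$. -/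

import Mathlib

open scoped TensorProduct
noncomputable section
namespace FIsoc
set_option linter.unusedSectionVars false

section Field
variable (p : ℕ) [Fact p.Prime] (F : Type*) [Field F] [Algebra ℚ_[p] F] [FiniteDimensional ℚ_[p] F]

/-- The ring of integers `O_F` of a finite extension `F` of `ℚ_p`: the closed unit ball of the
unique absolute value of `F` that extends the `p`-adic one. -/
def integerRing : ValuationSubring F where
  carrier := {x | spectralNorm ℚ_[p] F x ≤ 1}
  mul_mem' {a b} ha hb := by
    have := spectralAlgNorm_mul (K := ℚ_[p]) a b
    simp only [spectralAlgNorm_def] at this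
    simp only [Set.mem_ofPred_eq] at *
    rw [this]
    exact mul_le_one₀ ha (spectralNorm_nonneg _) hb
  one_mem' := by simp [spectralNorm_one]
  zero_mem' := by simp [spectralNorm_zero]
  add_mem' {a b} ha hb := (isNonarchimedean_spectralNorm (K := ℚ_[p]) a b).trans (max_le ha hb)
  neg_mem' {a} ha := by
    simpa [spectralNorm_neg (Algebra.IsAlgebraic.isAlgebraic a)] using ha
  mem_or_inv_mem' a := by
    by_cases h0 : a = 0
    · left; simp [h0, spectralNorm_zero]
    have := spectralAlgNorm_mul (K := ℚ_[p]) a a⁻¹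
    rw [mul_inv_cancel₀ h0] at this
    simp only [spectralAlgNorm_def, spectralNorm_one] at this
    by_contra! h
    simp only [Set.mem_ofPred_eq, not_le] at h
    nlinarith [h.1, h.2]

variable {p F} in
theorem mem_integerRing {x : F} : x ∈ integerRing p F ↔ spectralNorm ℚ_[p] F x ≤ 1 := Iff.rfl

/-- The residue field `k_F`. -/
abbrev ResField := IsLocalRing.ResidueField (integerRing p F)

variable {p F} in
theorem norm_mul' (a b : F) : spectralNorm ℚ_[p] F (a * b) =
    spectralNorm ℚ_[p] F a * spectralNorm ℚ_[p] F b := by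
  simpa only [spectralAlgNorm_def] using spectralAlgNorm_mul (K := ℚ_[p]) a b

theorem norm_natCast_p : spectralNorm ℚ_[p] F (p : F) = (p : ℝ)⁻¹ := by
  have := spectralNorm_extends (K := ℚ_[p]) (L := F) (p : ℚ_[p])
  simpa using this

theorem p_ne_zero : (p : F) ≠ 0 := by
  have : CharZero F := charZero_of_injective_algebraMap (algebraMap ℚ_[p] F).injective
  exact_mod_cast (Fact.out : p.Prime).ne_zero

variable {p F} in
theorem mem_span_pow_iff (n : ℕ) (x : integerRing p F) :
    x ∈ Ideal.span {(p : integerRing p F)} ^ n ↔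
      spectralNorm ℚ_[p] F (x : F) ≤ ((p : ℝ)⁻¹) ^ n := by
  have hp : (0 : ℝ) < p := by exact_mod_cast (Fact.out : p.Prime).pos
  have hn : ∀ n : ℕ, spectralNorm ℚ_[p] F ((p : F) ^ n) = ((p : ℝ)⁻¹) ^ n := by
    intro n
    induction n with
    | zero => simp [spectralNorm_one]
    | succ n ih => rw [pow_succ, norm_mul', ih, norm_natCast_p, pow_succ]
  rw [Ideal.span_singleton_pow, Ideal.mem_span_singleton]
  constructor
  · rintro ⟨y, rfl⟩
    have : ((((p : integerRing p F) ^ n * y : integerRing p F)) : F) = (p : F) ^ n * y := by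
      push_cast; rfl
    rw [this, norm_mul', hn]
    exact mul_le_of_le_one_right (by positivity) y.2
  · intro h
    refine ⟨⟨x / (p : F) ^ n, ?_⟩, ?_⟩
    · rw [mem_integerRing]
      have h1 : spectralNorm ℚ_[p] F ((p : F) ^ n * (x / (p : F) ^ n)) ≤ ((p : ℝ)⁻¹) ^ n := by
        rwa [mul_div_cancel₀ _ (pow_ne_zero _ (p_ne_zero p F))]
      rw [norm_mul', hn] at h1
      exact le_of_mul_le_mul_left (by simpa using h1) (by positivity)
    · ext
      push_cast
      exact (mul_div_cancel₀ _ (pow_ne_zero _ (p_ne_zero p F))).symm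

instance fact_not_isUnit_p : Fact (¬ IsUnit (p : integerRing p F)) := ⟨by
  intro h
  have h1 : (1 : integerRing p F) ∈ Ideal.span {(p : integerRing p F)} ^ 1 := by
    rw [pow_one, Ideal.span_singleton_eq_top.mpr h]; trivial
  rw [mem_span_pow_iff] at h1
  have hp : (1 : ℝ) < p := by exact_mod_cast (Fact.out : p.Prime).one_lt
  simp only [OneMemClass.coe_one, spectralNorm_one, pow_one] at h1
  exact absurd h1 (not_le.mpr (inv_lt_one_of_one_lt₀ hp))⟩

instance isAdicComplete_integerRing :
    IsAdicComplete (Ideal.span {(p : integerRing p F)}) (integerRing p F) where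
  haus' x hx := by
    have hp : (1 : ℝ) < p := by exact_mod_cast (Fact.out : p.Prime).one_lt
    have h : ∀ n : ℕ, spectralNorm ℚ_[p] F (x : F) ≤ ((p : ℝ)⁻¹) ^ n := by
      intro n
      have := hx n
      rw [SModEq.zero, smul_eq_mul, Ideal.mul_top, mem_span_pow_iff] at this
      exact this
    have h0 : spectralNorm ℚ_[p] F (x : F) ≤ 0 :=
      ge_of_tendsto' (tendsto_pow_atTop_nhds_zero_of_lt_one (by positivity)
        (inv_lt_one_of_one_lt₀ hp)) h
    ext
    exact eq_zero_of_map_spectralNorm_eq_zero (le_antisymm h0 (spectralNorm_nonneg _))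
      (Algebra.IsAlgebraic.isAlgebraic (x : F))
  prec' f hf := by
    have hp : (1 : ℝ) < p := by exact_mod_cast (Fact.out : p.Prime).one_lt
    let := spectralNorm.normedField ℚ_[p] F
    have : CompleteSpace F := spectralNorm.completeSpace ℚ_[p] F
    have hf' : ∀ {m n : ℕ}, m ≤ n → ‖(f m : F) - f n‖ ≤ ((p : ℝ)⁻¹) ^ m := by
      intro m n h
      have := hf h
      rw [SModEq.sub_mem, smul_eq_mul, Ideal.mul_top, mem_span_pow_iff] at this
      exact this
    have hC : CauchySeq (fun n => (f n : F)) := by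
      refine cauchySeq_of_le_geometric (p : ℝ)⁻¹ 1 (inv_lt_one_of_one_lt₀ hp) fun n => ?_
      rw [dist_eq_norm, one_mul]
      exact hf' n.le_succ
    obtain ⟨l, hl⟩ := cauchySeq_tendsto_of_complete hC
    have hlm : ∀ m, ‖(f m : F) - l‖ ≤ ((p : ℝ)⁻¹) ^ m := fun m =>
      le_of_tendsto ((tendsto_const_nhds.sub hl).norm)
        (Filter.eventually_atTop.mpr ⟨m, fun n hn => hf' hn⟩)
    have hlO : l ∈ integerRing p F := by
      have h0 : (f 0 : F) - l ∈ integerRing p F := by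
        rw [mem_integerRing]; exact (hlm 0).trans_eq (pow_zero _)
      simpa using sub_mem (f 0).2 h0
    refine ⟨⟨l, hlO⟩, fun n => ?_⟩
    rw [SModEq.sub_mem, smul_eq_mul, Ideal.mul_top, mem_span_pow_iff]
    exact hlm n

instance finite_modP : Finite (integerRing p F ⧸ Ideal.span {(p : integerRing p F)}) := by
  let := spectralNorm.nontriviallyNormedField ℚ_[p] F
  let : NormedSpace ℚ_[p] F := spectralNorm.normedSpace ℚ_[p] F
  have : ProperSpace F := FiniteDimensional.proper ℚ_[p] F
  have hp : (1 : ℝ) < p := by exact_mod_cast (Fact.out : p.Prime).one_lt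
  obtain ⟨t, htO, htf, ht⟩ := (isCompact_closedBall (0 : F) 1).finite_cover_balls
    (e := (p : ℝ)⁻¹) (by positivity)
  have hO : ∀ x : F, x ∈ Metric.closedBall (0 : F) 1 ↔ x ∈ integerRing p F := by
    intro x; rw [mem_closedBall_zero_iff]; rfl
  have := htf.to_subtype
  refine Finite.of_surjective (fun x : t => Ideal.Quotient.mk
    (Ideal.span {(p : integerRing p F)}) ⟨x.1, (hO _).1 (htO x.2)⟩) fun y => ?_
  obtain ⟨y, rfl⟩ := Ideal.Quotient.mk_surjective y
  obtain ⟨x, hx, hxy⟩ := Set.mem_iUnion₂.1 (ht ((hO _).2 y.2))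
  refine ⟨⟨x, hx⟩, ?_⟩
  rw [Ideal.Quotient.eq, ← pow_one (Ideal.span _), mem_span_pow_iff, pow_one]
  have := (mem_ball_iff_norm'.1 hxy).le
  exact this

theorem span_p_le : Ideal.span {(p : integerRing p F)} ≤ IsLocalRing.maximalIdeal _ := by
  rw [Ideal.span_singleton_le_iff_mem]
  exact (fact_not_isUnit_p p F).out

instance finite_resField : Finite (ResField p F) :=
  Finite.of_surjective _ (Ideal.Quotient.factor_surjective (span_p_le p F))

instance charP_resField : CharP (ResField p F) p := by
  refine (CharP.charP_iff_prime_eq_zero Fact.out).2 ?_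
  have : (p : ResField p F) = IsLocalRing.residue _ (p : integerRing p F) := by simp
  rw [this, IsLocalRing.residue_eq_zero_iff]
  exact (fact_not_isUnit_p p F).out

theorem exists_frobenius_exponent : ∃ M : ℕ,
    (∀ x ∈ IsLocalRing.maximalIdeal (integerRing p F),
      x ^ p ^ M ∈ Ideal.span {(p : integerRing p F)}) ∧
    ∀ a : ResField p F, a ^ p ^ M = a := by
  have hN : IsNilpotent (nilradical (integerRing p F ⧸ Ideal.span {(p : integerRing p F)})) :=
    IsNoetherianRing.isNilpotent_nilradical _
  obtain ⟨n, hn⟩ := hN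
  let : Fintype (ResField p F) := Fintype.ofFinite _
  obtain ⟨f, -, hf⟩ := FiniteField.card (ResField p F) p
  have hp : 1 < p := (Fact.out : p.Prime).one_lt
  refine ⟨f * n, fun x hx => ?_, fun a => ?_⟩
  · have hlt : spectralNorm ℚ_[p] F (x : F) < 1 := by
      refine lt_of_le_of_ne x.2 fun h1 => ?_
      have hx0 : (x : F) ≠ 0 := by
        intro h0
        rw [h0, spectralNorm_zero] at h1
        exact zero_ne_one h1
      have hinv : (x : F)⁻¹ ∈ integerRing p F := by
        rw [mem_integerRing]
        have := norm_mul' (p := p) (x : F) (x : F)⁻¹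
        rw [mul_inv_cancel₀ hx0, h1, one_mul, spectralNorm_one] at this
        exact this.ge
      exact hx (IsUnit.of_mul_eq_one ⟨_, hinv⟩ (by ext; exact mul_inv_cancel₀ hx0))
    have hpow : ∀ m : ℕ, spectralNorm ℚ_[p] F ((x : F) ^ m) = spectralNorm ℚ_[p] F (x : F) ^ m := by
      intro m
      induction m with
      | zero => simp [spectralNorm_one]
      | succ m ih => rw [pow_succ, norm_mul', ih, pow_succ]
    have hnil : Ideal.Quotient.mk (Ideal.span {(p : integerRing p F)}) x ∈ nilradical _ := by
      obtain ⟨m, hm⟩ := exists_pow_lt_of_lt_one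
        (show (0 : ℝ) < (p : ℝ)⁻¹ by positivity) hlt
      refine ⟨m, ?_⟩
      rw [← map_pow]
      refine Ideal.Quotient.eq_zero_iff_mem.2 ?_
      rw [← pow_one (Ideal.span _), mem_span_pow_iff, pow_one]
      push_cast
      rw [hpow]
      exact hm.le
    have h1 := Ideal.pow_mem_pow hnil n
    rw [hn] at h1
    rw [← Ideal.Quotient.eq_zero_iff_mem, map_pow]
    have hle : n ≤ p ^ (f * n : ℕ) :=
      (Nat.le_mul_of_pos_left n f.pos).trans (Nat.lt_pow_self hp).le
    exact pow_eq_zero_of_le hle h1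
  · rw [pow_mul, ← hf]
    exact FiniteField.pow_card_pow n a

/-- A multiple `M` of `[k_F : 𝔽_p]` such that the `p ^ M`-power map kills the maximal ideal of
`O_F / p`. -/
def frobExp : ℕ := (exists_frobenius_exponent p F).choose

/-- The ring homomorphism `k_F → O_F / p` that splits the reduction map: it sends the class of `x`
to the class of `x ^ (p ^ M)`. -/
def resFieldToModP : ResField p F →+* ModP (integerRing p F) p :=
  Ideal.Quotient.lift (IsLocalRing.maximalIdeal (integerRing p F))
    ((iterateFrobenius (ModP (integerRing p F) p) p (frobExp p F)).comp
      (Ideal.Quotient.mk (Ideal.span {(p : integerRing p F)}))) (fun x hx => by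
        rw [RingHom.comp_apply, iterateFrobenius_def, ← map_pow]
        exact Ideal.Quotient.eq_zero_iff_mem.2
          ((exists_frobenius_exponent p F).choose_spec.1 x hx))

theorem factor_resFieldToModP (a : ResField p F) :
    Ideal.Quotient.factor (span_p_le p F) (resFieldToModP p F a) = a := by
  obtain ⟨x, rfl⟩ := IsLocalRing.residue_surjective a
  have h := (exists_frobenius_exponent p F).choose_spec.2 (IsLocalRing.residue _ x)
  rw [← map_pow] at h
  exact h

instance perfectRing_resField : PerfectRing (ResField p F) p :=
  PerfectRing.ofFiniteOfIsReduced p _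

/-- The lift of `k_F → O_F / p` to the inverse limit perfection of `O_F / p`; it exists as `k_F` is
perfect. -/
def resFieldToPreTilt : ResField p F →+* PreTilt (integerRing p F) p :=
  Perfection.lift p (ResField p F) (ModP (integerRing p F) p) (resFieldToModP p F)

theorem coeff_zero_resFieldToPreTilt (a : ResField p F) :
    PreTilt.coeff 0 (resFieldToPreTilt p F a) = resFieldToModP p F a :=
  RingHom.congr_fun ((Perfection.lift p (ResField p F) (ModP (integerRing p F) p)).symm_apply_apply
    (resFieldToModP p F)) a

/-- The canonical ring homomorphism `W(k_F) → O_F`, that is, the unique one that induces the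
identity on residue fields. -/
def wittToInteger : WittVector p (ResField p F) →+* integerRing p F :=
  (WittVector.fontaineTheta (integerRing p F) p).comp (WittVector.map (resFieldToPreTilt p F))

/-- The canonical homomorphism `W(k_F) → O_F` induces the identity on residue fields. -/
theorem residue_wittToInteger (w : WittVector p (ResField p F)) :
    IsLocalRing.residue _ (wittToInteger p F w) = w.coeff 0 := by
  have h : Ideal.Quotient.mk (Ideal.span {(p : integerRing p F)}) (wittToInteger p F w) =
      resFieldToModP p F (w.coeff 0) := by
    rw [wittToInteger, RingHom.comp_apply, WittVector.mk_fontaineTheta, WittVector.map_coeff,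
      coeff_zero_resFieldToPreTilt]
  have h2 := congrArg (Ideal.Quotient.factor (span_p_le p F)) h
  rw [factor_resFieldToModP, Ideal.Quotient.factor_mk] at h2
  exact h2

/-- `F` as a `W(k_F)`-algebra, via the canonical `W(k_F) → O_F ⊆ F`. -/
instance algebraWittField : Algebra (WittVector p (ResField p F)) F :=
  ((integerRing p F).subtype.comp (wittToInteger p F)).toAlgebra

variable (k : Type*) [Field k] [Algebra (ResField p F) k]

/-- `W(k)` as a `W(k_F)`-algebra, by functoriality. -/
instance algebraWittWitt : Algebra (WittVector p (ResField p F)) (WittVector p k) :=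
  (WittVector.map (algebraMap (ResField p F) k)).toAlgebra

/-- The ring `L = F ⊗_{W(k_F)} W(k)`. For a perfect field `k` that contains `k_F` it is a field, a
finite totally ramified extension of `Frac W(k)`; so modules over it are vector spaces and
`Module.finrank` is the dimension. -/
abbrev L : Type _ := F ⊗[WittVector p (ResField p F)] WittVector p k

/-- The endomorphism `σ₀` of `W(k)` induced by `x ↦ x ^ q` on `k`, where `q = #k_F`; it is linear
over `W(k_F)`. -/
def sigma0 : WittVector p k →ₐ[WittVector p (ResField p F)] WittVector p k :=
  letI : Fintype (ResField p F) := Fintype.ofFinite _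
  { WittVector.map (FiniteField.frobeniusAlgHom (ResField p F) k).toRingHom with
    commutes' := fun w => by
      ext n
      change (FiniteField.frobeniusAlgHom (ResField p F) k) (algebraMap _ k (w.coeff n)) = _
      rw [AlgHom.commutes]; rfl }

theorem sigma0_coeff (w : WittVector p k) (n : ℕ) :
    (sigma0 p F k w).coeff n = w.coeff n ^ Nat.card (ResField p F) := by
  let : Fintype (ResField p F) := Fintype.ofFinite _
  rw [Nat.card_eq_fintype_card]
  rfl

/-- The endomorphism `σ = id ⊗ σ₀` of `L`. -/
def sigma : L p F k →+* L p F k :=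
  (Algebra.TensorProduct.map (AlgHom.id (WittVector p (ResField p F)) F) (sigma0 p F k)).toRingHom

theorem sigma_tmul (x : F) (w : WittVector p k) :
    sigma p F k (x ⊗ₜ w) = x ⊗ₜ sigma0 p F k w := rfl

end Field

section Iso
variable (p : ℕ) [Fact p.Prime] (F : Type*) [Field F] [Algebra ℚ_[p] F] [FiniteDimensional ℚ_[p] F]
  (k : Type*) [Field k] [Algebra (ResField p F) k] (D : Type*) [AddCommGroup D] [Module (L p F k) D]

/-- The structure of an isocrystal relative to `(F, k)` on the `L`-vector space `D`: a bijective
`σ`-linear endomorphism. (That `D` is finite dimensional is a separate hypothesis.) -/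
structure Isocrystal where
  φ : D →ₛₗ[sigma p F k] D
  bijective : Function.Bijective φ

variable {p F k D}

/-- A sub-isocrystal: an `L`-subspace on which `φ` restricts to a bijection. -/
structure SubIsocrystal (E : Isocrystal p F k D) where
  carrier : Submodule (L p F k) D
  bijOn : Set.BijOn E.φ carrier carrier

/-- The isocrystal `(D', φ')` that is given by a sub-isocrystal, with `φ'` the restriction of `φ`. -/
def SubIsocrystal.toIsocrystal {E : Isocrystal p F k D} (E' : SubIsocrystal E) :
    Isocrystal p F k E'.carrier where
  φ :=
    { toFun := fun x => ⟨E.φ x, E'.bijOn.mapsTo x.2⟩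
      map_add' := fun x y => Subtype.ext (map_add E.φ (x : D) y)
      map_smul' := fun c x => Subtype.ext (map_smulₛₗ E.φ c (x : D)) }
  bijective := E'.bijOn.bijective

/-- The part of slope `α = r / s` (in lowest terms, `s > 0`) of an isocrystal over an algebraically
closed field `k`: the `L`-span of the `v` with `φ ^ s v = π ^ r v`. For algebraically closed `k` it
does not depend on the uniformizer `π` of `F`, and `D` is the direct sum of these parts. -/
def Isocrystal.slopePart (E : Isocrystal p F k D) (π : integerRing p F) (α : ℚ) :
    Submodule (L p F k) D :=
  Submodule.span (L p F k) {v | E.φ^[α.den] v = algebraMap F (L p F k) ((π : F) ^ α.num) • v}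

/-- The vector of length `d` whose entries are the `a` with `m a ≠ 0`, each repeated `m a` times, in
decreasing order. (Used where `m` has finite support and total mass `d`.) -/
def sortedVector {α : Type*} [LinearOrder α] [Zero α] (d : ℕ) (m : α → ℕ) : Fin d → α :=
  fun j => ((∑ᶠ a, Multiset.replicate (m a) a).sort (· ≥ ·)).getD j 0

/-- The Newton vector `ν(D, φ)`, for algebraically closed `k`: the slopes in decreasing order, each
repeated as often as the dimension of its slope part. -/
def Isocrystal.newtonVector (E : Isocrystal p F k D) (π : integerRing p F) :
    Fin (Module.finrank (L p F k) D) → ℚ :=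
  sortedVector _ fun α => Module.finrank (L p F k) (E.slopePart π α)

variable (p F k D) in
/-- Decreasing, exhaustive and separated filtrations of `D` by `L`-subspaces, indexed by `ℤ`. -/
structure Filtration where
  fil : ℤ → Submodule (L p F k) D
  antitone : Antitone fil
  exhaustive : ⋃ i, (fil i : Set D) = Set.univ
  separated : ⋂ i, (fil i : Set D) = {0}

/-- The dimension of the graded piece `gr_i = Fil^i / Fil^(i+1)`. -/
def Filtration.grDim (Fil : Filtration p F k D) (i : ℤ) : ℕ :=
  Module.finrank (L p F k) (Fil.fil i ⧸ (Fil.fil (i + 1)).submoduleOf (Fil.fil i))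

/-- The induced filtration on a subspace `D'`: `Fil^i ∩ D'`. -/
def Filtration.induced (Fil : Filtration p F k D) (D' : Submodule (L p F k) D) :
    Filtration p F k D' where
  fil i := (Fil.fil i).submoduleOf D'
  antitone i j h x hx := Fil.antitone h hx
  exhaustive := by
    ext x
    simpa [Submodule.submoduleOf] using
      Set.mem_iUnion.1 (Fil.exhaustive.ge (Set.mem_univ (x : D)))
  separated := by
    ext x
    have := Set.ext_iff.1 Fil.separated x
    simpa [Submodule.submoduleOf] using this

/-- The type of a filtration: its jumps in decreasing order, with multiplicities. -/
def Filtration.typeVector (Fil : Filtration p F k D) : Fin (Module.finrank (L p F k) D) → ℤ :=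
  sortedVector _ Fil.grDim

/-- The filtration is of type `μ`: `dim gr_i = #{j | μ_j = i}` for all `i`. -/
def Filtration.IsOfType (Fil : Filtration p F k D) {d : ℕ} (μ : Fin d → ℤ) : Prop :=
  ∀ i : ℤ, Fil.grDim i = Nat.card {j : Fin d // μ j = i}

/-- (Weakly) admissible filtrations: `|μ(Fil)| = |ν(D, φ)|`, and `|μ(Fil')| ≤ |ν(D', φ')|` for the
induced filtration `Fil'` on every sub-isocrystal `(D', φ')`. -/
structure IsAdmissible (E : Isocrystal p F k D) (π : integerRing p F)
    (Fil : Filtration p F k D) : Prop where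
  total : ∑ j, (Fil.typeVector j : ℚ) = ∑ j, E.newtonVector π j
  sub : ∀ E' : SubIsocrystal E, ∑ j, ((Fil.induced E'.carrier).typeVector j : ℚ) ≤
    ∑ j, E'.toIsocrystal.newtonVector π j

end Iso

/-- The dominance order `a ≤ b`: partial sums of `a` are at most those of `b`, with equal totals. -/
def DominatedBy {d : ℕ} (a b : Fin d → ℚ) : Prop :=
  (∀ r < d, ∑ j with j.val < r, a j ≤ ∑ j with j.val < r, b j) ∧ ∑ j, a j = ∑ j, b j

end FIsoc

end

/-! ### Rings with a Frobenius lift, and successive approximation -/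

noncomputable section
namespace FIsoc
set_option linter.unusedSectionVars false

/-! Two facts carry the proof: sub-isocrystals are defined over a small subfield of `L`, and `L` is
so large over that subfield that some flag is in general position with respect to all of them at
once.

Dieudonné–Manin (`FrobRing.span_isSlopeVector_eq_top`): `D` is spanned by slope vectors, those with
`φ^s v = π^r v`. A slope vector exists because a cyclic relation reduces `φ w = π^(r/s) w` to one
semilinear equation, which becomes an additive polynomial over the algebraically closed `k` and is
lifted by successive approximation. Slope vectors lift from the quotient by their span because
`π^(-r) φ^s - 1` is surjective on that span. In a basis of slope vectors, a slope vector of slope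
`α` has nonzero coordinates only at basis vectors of slope `α`, and these are fixed by a power
`σ^N`. Every sub-isocrystal is spanned by its own slope vectors, so with `N` a common multiple of
the denominators all sub-isocrystals are rational over the field `L^(σ^N)` (`exists_isRational`),
and `|ν(D')|` is the sum of the slopes in an adapted basis.

Genericity: lifts of roots of unity give arbitrarily many elements of `L` independent over
`L^(σ^N)`. A vector with such coordinates lies in no proper rational subspace, and iteration gives a
flag that meets every rational subspace in the least possible dimension (`exists_generic_sequence`).

For any filtration of type `μ` and any subspace `W` of dimension `w`, the bound `dim (Fil^i ∩ W) ≥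
dim Fil^i + w - d` shows that `|μ(Fil ∩ W)|` is at least the sum of the last `w` entries of `μ`,
with equality in general position (`IsOfType.sum_tail_le`, `IsOfType.sum_tail_eq`).

Necessity: apply the bound to the sums of slope parts with slopes below a threshold; these `W` have
`|ν(W)|` equal to the sum of the last `w` entries of `ν`, and concerning dominance only the breaks
of `ν` matter. Sufficiency: take a filtration of type `μ` from a generic flag. Then `|μ(Fil ∩ W)|`
is the sum of the last `w` entries of `μ`, which by dominance is at most that of `ν`, and this is
the least sum of any `w` slopes, hence at most `|ν(W)|`.

The ring `L` is accessed only through `FrobRing`; `frobRing_L` verifies its axioms for `F ⊗ W(k)`.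
-/

/-- A ring `L = O[1/π]` with `O` a `π`-adically complete subring of residue field `k`, and an
automorphism `σ` of `L` that fixes `π` and lifts the `q`-power map of `k`. -/
structure FrobRing {L k : Type*} [CommRing L] [Field k] (O : Subring L) (res : O →+* k)
    (π : L) (σ : L →+* L) (q : ℕ) : Prop where
  isUnit : IsUnit π
  pi_mem : π ∈ O
  denom : ∀ x : L, ∃ n : ℕ, π ^ n * x ∈ O
  res_surj : Function.Surjective res
  res_eq_zero : ∀ x : O, res x = 0 ↔ ∃ y ∈ O, (x : L) = π * y
  haus : ∀ x : L, (∀ n : ℕ, ∃ y ∈ O, x = π ^ n * y) → x = 0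
  complete : ∀ f : ℕ → L, (∀ n, f n ∈ O) →
    ∃ x ∈ O, ∀ n, ∃ y ∈ O, x = ∑ m ∈ Finset.range n, π ^ m * f m + π ^ n * y
  sigma_mem : ∀ x ∈ O, σ x ∈ O
  sigma_bij : Function.Bijective σ
  sigma_pi : σ π = π
  res_sigma : ∀ x : O, res ⟨σ x, sigma_mem x x.2⟩ = res x ^ q
  one_lt : 1 < q
  cast_eq_zero : (q : k) = 0

/-- An additive operator that commutes with `T` on a `T`-adically complete group is surjective if it
is so modulo `T`. -/
theorem surjective_of_surjective_mod {A : Type*} [AddCommGroup A] (T B : AddMonoid.End A)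
    (comm : Commute B T) (haus : ∀ a, (∀ n : ℕ, ∃ b, a = (T ^ n) b) → a = 0)
    (complete : ∀ f : ℕ → A, ∃ x, ∀ n, ∃ b, x = ∑ m ∈ Finset.range n, (T ^ m) (f m) + (T ^ n) b)
    (h : ∀ a, ∃ x b, a = B x + T b) : Function.Surjective B := by
  intro a
  choose x b hxb using h
  have hc : ∀ (n : ℕ) z, B ((T ^ n) z) = (T ^ n) (B z) := fun n z =>
    DFunLike.congr_fun (comm.pow_right n).eq z
  let s : ℕ → A := fun n => b^[n] a
  -- The `s n` are the successive remainders: after `n` corrections the error is `T^n (s n)`.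
  have hs : ∀ n, a = B (∑ m ∈ Finset.range n, (T ^ m) (x (s m))) + (T ^ n) (s n) := by
    intro n
    induction n with
    | zero => simp [s]
    | succ n ih =>
      rw [Finset.sum_range_succ, map_add, hc]
      conv_lhs => rw [ih, hxb (s n), map_add]
      have : s (n + 1) = b (s n) := Function.iterate_succ_apply' _ _ _
      rw [this, pow_succ, add_assoc]
      rfl
  obtain ⟨z, hz⟩ := complete fun m => x (s m)
  refine ⟨z, sub_eq_zero.1 (haus _ fun n => ?_)⟩
  obtain ⟨c, hc'⟩ := hz n
  refine ⟨B c - s n, ?_⟩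
  conv_lhs => rw [hs n, hc', map_add, hc]
  rw [map_sub]
  abel

/-- This serves when completeness is known only for a power of `T`: solvability modulo `T` is pushed
to solvability modulo that power, after which `surjective_of_surjective_mod` applies to the power.
-/
theorem exists_eq_add_pow_of_surjective_mod {A : Type*} [AddCommGroup A] (T B : AddMonoid.End A)
    (comm : Commute B T) (h : ∀ a, ∃ x b, a = B x + T b) (n : ℕ) (a : A) :
    ∃ x b, a = B x + (T ^ n) b := by
  induction n generalizing a with
  | zero => exact ⟨0, a, by simp⟩
  | succ n ih =>
    obtain ⟨x, b, hx⟩ := ih a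
    obtain ⟨y, c, hy⟩ := h b
    refine ⟨x + (T ^ n) y, c, ?_⟩
    have : B ((T ^ n) y) = (T ^ n) (B y) := DFunLike.congr_fun (comm.pow_right n).eq y
    rw [hx, hy, map_add, map_add, this, pow_succ, add_assoc]
    rfl

/-! ### The valuation of `L` -/

namespace FrobRing

section CommRing
variable {L k : Type*} [CommRing L] [Field k] {O : Subring L} {res : O →+* k}
    {π : L} {σ : L →+* L} {q : ℕ}

/-- If `y` lifts the inverse of the residue of `x`, then `x y = 1 - π z`, which is inverted by the
geometric series. -/
theorem exists_mul_eq_one (H : FrobRing O res π σ q) (x : O) (hx : res x ≠ 0) :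
    ∃ y ∈ O, (x : L) * y = 1 := by
  obtain ⟨y, hy⟩ := H.res_surj (res x)⁻¹
  obtain ⟨z, hz, hxy⟩ := (H.res_eq_zero (1 - x * y)).1 (by simp [hy, hx])
  push_cast at hxy
  obtain ⟨t, ht, htn⟩ := H.complete (fun m => z ^ m) (fun m => pow_mem hz m)
  have h1 : (1 - π * z) * t - 1 = 0 := by
    refine H.haus _ fun n => ?_
    obtain ⟨w, hw, hn⟩ := htn n
    refine ⟨(1 - π * z) * w - z ^ n, sub_mem (mul_mem (sub_mem (one_mem _)
      (mul_mem H.pi_mem hz)) hw) (pow_mem hz n), ?_⟩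
    have hg := mul_neg_geom_sum (π * z) n
    simp only [mul_pow] at hg
    rw [hn, mul_add, hg]
    ring
  refine ⟨y * t, mul_mem y.2 ht, ?_⟩
  have : (x : L) * y = 1 - π * z := by rw [← hxy]; ring
  rw [← mul_assoc, this]
  linear_combination h1

/-- After clearing denominators, separatedness bounds the powers of `π` that divide a nonzero
element; dividing by the largest one leaves a nonzero residue. The powers are natural because `L` is
not yet known to be a field. -/
theorem exists_eq_pow_mul (H : FrobRing O res π σ q) {x : L} (hx : x ≠ 0) :
    ∃ (m n : ℕ) (u : O), res u ≠ 0 ∧ π ^ m * x = π ^ n * u := by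
  classical
  obtain ⟨m, hm⟩ := H.denom x
  have hne : π ^ m * x ≠ 0 := fun h => hx ((H.isUnit.pow m).mul_right_eq_zero.1 h)
  have hex : ∃ n : ℕ, ¬ ∃ y ∈ O, π ^ m * x = π ^ n * y := by
    by_contra! h
    exact hne (H.haus _ h)
  obtain ⟨n, hn⟩ : ∃ n, Nat.find hex = n + 1 := by
    refine Nat.exists_eq_succ_of_ne_zero fun h0 => ?_
    have := Nat.find_spec hex
    rw [h0] at this
    exact this ⟨_, hm, by simp⟩
  obtain ⟨u, hu, hxu⟩ := not_not.1 (Nat.find_min hex (m := n) (by omega))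
  refine ⟨m, n, ⟨u, hu⟩, fun h0 => ?_, hxu⟩
  obtain ⟨y, hy, huy⟩ := (H.res_eq_zero _).1 h0
  have := Nat.find_spec hex
  rw [hn] at this
  exact this ⟨y, hy, by rw [hxu, pow_succ, mul_assoc]; congr 1⟩

theorem isField (H : FrobRing O res π σ q) : IsField L where
  exists_pair_ne := by
    refine ⟨0, 1, fun h => ?_⟩
    have : (1 : O) = 0 := Subtype.ext h.symm
    exact one_ne_zero (α := k) (by rw [← map_one res, this, map_zero])
  mul_comm := mul_comm
  mul_inv_cancel {x} hx := by
    obtain ⟨m, n, u, hu, h⟩ := H.exists_eq_pow_mul hx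
    obtain ⟨y, -, hy⟩ := H.exists_mul_eq_one u hu
    obtain ⟨z, hz⟩ := (H.isUnit.pow n).exists_right_inv
    refine ⟨π ^ m * y * z, ?_⟩
    linear_combination (y * z) * h + π ^ n * z * hy + hz

end CommRing

section Field
variable {L k : Type*} [Field L] [Field k] {O : Subring L} {res : O →+* k}
    {π : L} {σ : L →+* L} {q : ℕ}

theorem pi_ne_zero (H : FrobRing O res π σ q) : π ≠ 0 := H.isUnit.ne_zero

theorem exists_eq_zpow_mul (H : FrobRing O res π σ q) {x : L} (hx : x ≠ 0) :
    ∃ (m : ℤ) (u : O), res u ≠ 0 ∧ x = π ^ m * u := by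
  obtain ⟨m, n, u, hu, h⟩ := H.exists_eq_pow_mul hx
  refine ⟨n - m, u, hu, ?_⟩
  have := H.pi_ne_zero
  rw [zpow_sub₀ this, zpow_natCast, zpow_natCast]
  field_simp
  linear_combination h

theorem sigma_zpow (H : FrobRing O res π σ q) (m : ℤ) : σ (π ^ m) = π ^ m := by
  rw [map_zpow₀, H.sigma_pi]

theorem sigma_iterate_zpow (H : FrobRing O res π σ q) (n : ℕ) (m : ℤ) :
    σ^[n] (π ^ m) = π ^ m :=
  Function.iterate_fixed (H.sigma_zpow m) n

theorem sigma_iterate_mem (H : FrobRing O res π σ q) (n : ℕ) {x : L} (hx : x ∈ O) :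
    σ^[n] x ∈ O := by
  induction n with
  | zero => exact hx
  | succ n ih => rw [Function.iterate_succ_apply']; exact H.sigma_mem _ ih

theorem res_sigma_iterate (H : FrobRing O res π σ q) (n : ℕ) (x : O) :
    res ⟨σ^[n] x, H.sigma_iterate_mem n x.2⟩ = res x ^ q ^ n := by
  induction n with
  | zero => simp
  | succ n ih =>
    have := H.res_sigma ⟨σ^[n] x, H.sigma_iterate_mem n x.2⟩
    rw [ih] at this
    simp only [Function.iterate_succ_apply', this, pow_succ, pow_mul]

theorem mem_of_zpow_mul_mem (H : FrobRing O res π σ q) (m : ℤ) (hm : 0 ≤ m) : π ^ m ∈ O := by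
  lift m to ℕ using hm
  rw [zpow_natCast]
  exact pow_mem H.pi_mem m

theorem zpow_eq_of_unit (H : FrobRing O res π σ q) {m n : ℤ} {u v : O} (hu : res u ≠ 0)
    (hv : res v ≠ 0) (h : π ^ m * (u : L) = π ^ n * v) : m = n := by
  have key : ∀ {m n : ℤ} {u v : O}, res u ≠ 0 → π ^ m * (u : L) = π ^ n * v → n ≤ m := by
    intro m n u v hu h
    by_contra! hlt
    refine hu ((H.res_eq_zero u).2 ⟨π ^ (n - m - 1) * v, mul_mem
      (H.mem_of_zpow_mul_mem _ (by omega)) v.2, ?_⟩)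
    have h0 := H.pi_ne_zero
    have h1 : π ^ n = π ^ m * (π * π ^ (n - m - 1)) := by
      rw [← zpow_one_add₀ h0, ← zpow_add₀ h0]; congr 1; ring
    rw [h1, mul_assoc] at h
    rw [mul_left_cancel₀ (zpow_ne_zero m h0) h, mul_assoc]
  exact le_antisymm (key hv h.symm) (key hu h)

theorem res_unit_sigma (H : FrobRing O res π σ q) (n : ℕ) {u : O} (hu : res u ≠ 0) :
    res ⟨σ^[n] u, H.sigma_iterate_mem n u.2⟩ ≠ 0 := by
  rw [H.res_sigma_iterate]; exact pow_ne_zero _ hu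

/-- `σ` preserves the valuation, since it fixes `π` and raises residues of units to the power `q`.
This makes `O` stable under the inverse of `σ`. -/
theorem mem_of_sigma_mem (H : FrobRing O res π σ q) {x : L} (hx : σ x ∈ O) : x ∈ O := by
  by_cases h0 : x = 0
  · rw [h0]; exact zero_mem _
  obtain ⟨m, u, hu, rfl⟩ := H.exists_eq_zpow_mul h0
  rcases le_or_gt 0 m with hm | hm
  · exact mul_mem (H.mem_of_zpow_mul_mem m hm) u.2
  exfalso
  rw [map_mul, H.sigma_zpow] at hx
  have h1 := H.res_sigma u
  refine pow_ne_zero q hu (h1 ▸ (H.res_eq_zero _).2 ⟨π ^ (-m - 1) * (π ^ m * σ u),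
    mul_mem (H.mem_of_zpow_mul_mem _ (by omega)) hx, ?_⟩)
  have h0 := H.pi_ne_zero
  rw [← mul_assoc, ← mul_assoc, ← zpow_one_add₀ h0, ← zpow_add₀ h0]
  have : 1 + (-m - 1) + m = 0 := by ring
  rw [this, zpow_zero, one_mul]

/-- If `x ≠ 0` satisfies `π ^ a * σ ^ N x = π ^ b * x`, then `a = b`. -/
theorem zpow_eq_of_sigma_iterate (H : FrobRing O res π σ q) {x : L} (hx : x ≠ 0) {N : ℕ} {a b : ℤ}
    (h : π ^ a * σ^[N] x = π ^ b * x) : a = b := by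
  obtain ⟨m, u, hu, rfl⟩ := H.exists_eq_zpow_mul hx
  have h0 := H.pi_ne_zero
  rw [iterate_map_mul, H.sigma_iterate_zpow, ← mul_assoc, ← mul_assoc, ← zpow_add₀ h0,
    ← zpow_add₀ h0] at h
  have := H.zpow_eq_of_unit (u := ⟨_, H.sigma_iterate_mem N u.2⟩) (H.res_unit_sigma N hu) hu h
  omega

end Field
end FrobRing

/-! ### Additive polynomials and Frobenius-semilinear equations in one variable -/

open Polynomial in
-- All exponents `q^(j+1)` exceed `1`, so the coefficient of `X` is `-1` and the polynomial is not
-- constant, whatever the `β j` are.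
theorem exists_frobPoly_eq {k : Type*} [Field k] [IsAlgClosed k] {q : ℕ} (hq : 1 < q) (n : ℕ)
    (β : ℕ → k) (c : k) : ∃ x : k, ∑ j ∈ Finset.range n, β j * x ^ q ^ (j + 1) - x = c := by
  let P : k[X] := ∑ j ∈ Finset.range n, C (β j) * X ^ q ^ (j + 1) - X - C c
  have h1 : P.coeff 1 = -1 := by
    have : ∀ j, (1 : ℕ) ≠ q ^ (j + 1) := fun j => (Nat.one_lt_pow (by omega) hq).ne
    simp [P, coeff_X_pow, this]
  have hd : P.degree ≠ 0 := fun h => by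
    rw [eq_C_of_degree_eq_zero h, coeff_C] at h1
    simp at h1
  obtain ⟨x, hx⟩ := IsAlgClosed.exists_root P hd
  refine ⟨x, ?_⟩
  have : P.eval x = 0 := hx
  simp only [P, eval_sub, eval_finsetSum, eval_mul, eval_C, eval_pow, eval_X] at this
  linear_combination this

open Polynomial in
-- To avoid the root `0`, the equation is divided by `x`: the quotient has constant term `-1`, and
-- `β i ≠ 0` makes it nonconstant.
theorem exists_frobPoly_eq_zero {k : Type*} [Field k] [IsAlgClosed k] {q : ℕ} (hq : 1 < q) (n : ℕ)
    (β : ℕ → k) {i : ℕ} (hi : i < n) (hβ : β i ≠ 0) :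
    ∃ x : k, x ≠ 0 ∧ ∑ j ∈ Finset.range n, β j * x ^ q ^ (j + 1) - x = 0 := by
  let P : k[X] := ∑ j ∈ Finset.range n, C (β j) * X ^ (q ^ (j + 1) - 1) - 1
  have hpos : ∀ j, 1 < q ^ (j + 1) := fun j => Nat.one_lt_pow (by omega) hq
  have h1 : P.coeff (q ^ (i + 1) - 1) = β i := by
    have hne : q ^ (i + 1) - 1 ≠ 0 := by have := hpos i; omega
    have : ∀ j, q ^ (i + 1) - 1 = q ^ (j + 1) - 1 ↔ i = j := fun j => by
      have h1 := hpos i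
      have h2 := hpos j
      constructor
      · intro h
        have := Nat.pow_right_injective hq (show q ^ (i + 1) = q ^ (j + 1) by omega)
        omega
      · rintro rfl; rfl
    simp [P, coeff_X_pow, coeff_one, this, hne, hi]
  have hd : P.degree ≠ 0 := fun h => by
    rw [eq_C_of_degree_eq_zero h, coeff_C, if_neg (by have := hpos i; omega)] at h1
    exact hβ h1.symm
  obtain ⟨x, hx⟩ := IsAlgClosed.exists_root P hd
  have hx' : P.eval x = 0 := hx
  simp only [P, eval_sub, eval_finsetSum, eval_mul, eval_C, eval_pow, eval_X, eval_one] at hx'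
  refine ⟨x, ?_, ?_⟩
  · rintro rfl
    have : ∀ j, q ^ (j + 1) - 1 ≠ 0 := fun j => by have := hpos j; omega
    simp [this] at hx'
  · have : ∑ j ∈ Finset.range n, β j * x ^ q ^ (j + 1) =
        (∑ j ∈ Finset.range n, β j * x ^ (q ^ (j + 1) - 1)) * x := by
      rw [Finset.sum_mul]
      refine Finset.sum_congr rfl fun j _ => ?_
      rw [mul_assoc, ← pow_succ, Nat.sub_add_cancel (hpos j).le]
    rw [this]
    linear_combination x * hx'

namespace FrobRing
section
variable {L k : Type*} [Field L] [Field k] {O : Subring L} {res : O →+* k}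
    {π : L} {σ : L →+* L} {q : ℕ}

/-- Multiplication by `x` as an additive endomorphism. -/
def mulEnd {R : Type*} [CommRing R] (x : R) : AddMonoid.End R := AddMonoidHom.mulLeft x

theorem mulEnd_pow_apply {R : Type*} [CommRing R] (x y : R) (n : ℕ) :
    (mulEnd x ^ n) y = x ^ n * y := by
  induction n with
  | zero => simp
  | succ n ih =>
    rw [pow_succ', pow_succ', mul_assoc, ← ih]
    rfl

/-- Successive approximation for the operator of multiplication by `π` on `O`. -/
theorem surjective_of_res (H : FrobRing O res π σ q) (B : AddMonoid.End O)
    (comm : ∀ x : O, B (⟨π, H.pi_mem⟩ * x) = ⟨π, H.pi_mem⟩ * B x)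
    (h : ∀ a : O, ∃ x : O, res (B x) = res a) : Function.Surjective B := by
  refine surjective_of_surjective_mod (mulEnd (⟨π, H.pi_mem⟩ : O)) B
    (AddMonoidHom.ext comm) (fun a ha => ?_) (fun f => ?_) (fun a => ?_)
  · refine Subtype.ext (H.haus _ fun n => ?_)
    obtain ⟨b, hb⟩ := ha n
    rw [mulEnd_pow_apply] at hb
    exact ⟨b, b.2, by rw [hb]; simp⟩
  · obtain ⟨x, hx, hn⟩ := H.complete (fun m => f m) (fun m => (f m).2)
    refine ⟨⟨x, hx⟩, fun n => ?_⟩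
    obtain ⟨y, hy, hxy⟩ := hn n
    refine ⟨⟨y, hy⟩, Subtype.ext ?_⟩
    simp only [mulEnd_pow_apply]
    push_cast
    exact hxy
  · obtain ⟨x, hx⟩ := h a
    obtain ⟨y, hy, hxy⟩ := (H.res_eq_zero (a - B x)).1 (by rw [map_sub, hx, sub_self])
    refine ⟨x, ⟨y, hy⟩, Subtype.ext ?_⟩
    push_cast at hxy
    change (a : L) = B x + π * y
    rw [← hxy]; ring

/-- The operator `x ↦ u * σ ^ N x - x` on `O`. -/
def frobOp (H : FrobRing O res π σ q) (u : O) (N : ℕ) : AddMonoid.End O where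
  toFun x := u * ⟨σ^[N] x, H.sigma_iterate_mem N x.2⟩ - x
  map_zero' := Subtype.ext (by simp)
  map_add' x y := Subtype.ext (by push_cast; rw [iterate_map_add]; ring)

theorem coe_frobOp (H : FrobRing O res π σ q) (u : O) (N : ℕ) (x : O) :
    (H.frobOp u N x : L) = u * σ^[N] x - x := rfl

theorem res_frobOp (H : FrobRing O res π σ q) (u : O) (N : ℕ) (x : O) :
    res (H.frobOp u N x) = res u * res x ^ q ^ N - res x := by
  rw [← H.res_sigma_iterate, ← map_mul, ← map_sub]; rfl

theorem frobOp_surjective [IsAlgClosed k] (H : FrobRing O res π σ q) (u : O) {N : ℕ} (hN : 0 < N) :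
    Function.Surjective (H.frobOp u N) := by
  refine H.surjective_of_res _ (fun x => Subtype.ext ?_) fun a => ?_
  · change u * σ^[N] (π * x) - π * x = π * (u * σ^[N] x - x)
    rw [iterate_map_mul, Function.iterate_fixed H.sigma_pi]; ring
  -- Exponents in `exists_frobPoly_eq` are `q^(j+1)`, so the single term `x^(q^N)` sits at `j = N -
  -- 1`.
  · obtain ⟨c, hc⟩ := exists_frobPoly_eq H.one_lt N
      (fun j => if j = N - 1 then res u else 0) (res a)
    obtain ⟨x, rfl⟩ := H.res_surj c
    refine ⟨x, ?_⟩
    rw [res_frobOp, ← hc]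
    simp only [ite_mul, zero_mul, Finset.sum_ite_eq', Finset.mem_range,
      show N - 1 < N by omega, if_true, Nat.sub_add_cancel hN]

/-- A fixed point of `σ ^ N` with a given residue class. -/
theorem exists_fixed [IsAlgClosed k] (H : FrobRing O res π σ q) {N : ℕ} (hN : 0 < N) (ζ : k)
    (hζ : ζ ^ q ^ N = ζ) : ∃ t : O, σ^[N] t = t ∧ res t = ζ := by
  obtain ⟨x, rfl⟩ := H.res_surj ζ
  obtain ⟨b, hb, hxb⟩ := (H.res_eq_zero (H.frobOp 1 N x)).1 (by
    rw [res_frobOp, map_one, one_mul, hζ, sub_self])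
  -- The error `σ^N x - x` equals `π b`; with `σ^N y - y = b`, the element `x - π y` is fixed and
  -- has the residue of `x`.
  obtain ⟨y, hy⟩ := H.frobOp_surjective 1 hN ⟨b, hb⟩
  have hy' := congrArg (Subtype.val) hy
  rw [coe_frobOp] at hxb hy'
  refine ⟨x - ⟨π, H.pi_mem⟩ * y, ?_, ?_⟩
  · push_cast
    rw [iterate_map_sub, iterate_map_mul, Function.iterate_fixed H.sigma_pi]
    simp only [OneMemClass.coe_one, one_mul] at hxb hy'
    linear_combination hxb - π * hy'
  · have : res (⟨π, H.pi_mem⟩ * y) = 0 := (H.res_eq_zero _).2 ⟨y, y.2, rfl⟩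
    rw [map_sub, this, sub_zero]

/-- For `a ≥ 0` the operator preserves `O` and is a `frobOp`. For `a < 0` the substitution `x =
π^(-a) σ^(-N) z` turns it into `z - π^(-a) σ^(-N) z`, which is the identity modulo `π`. -/
theorem exists_zpow_mul_sigma_sub [IsAlgClosed k] (H : FrobRing O res π σ q) {N : ℕ} (hN : 0 < N)
    (a : ℤ) (y : L) : ∃ x, π ^ a * σ^[N] x - x = y := by
  have h0 := H.pi_ne_zero
  obtain ⟨m, hm⟩ := H.denom y
  rcases le_or_gt 0 a with ha | ha
  · obtain ⟨x, hx⟩ := H.frobOp_surjective ⟨π ^ a, H.mem_of_zpow_mul_mem a ha⟩ hN ⟨_, hm⟩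
    have hx' := congrArg Subtype.val hx
    rw [coe_frobOp] at hx'
    refine ⟨(π ^ m)⁻¹ * x, ?_⟩
    have hi : σ^[N] (π ^ m)⁻¹ = (π ^ m)⁻¹ := by
      have := H.sigma_iterate_zpow N (-m)
      simpa using this
    rw [iterate_map_mul, hi]
    field_simp
    linear_combination hx'
  · let e : L ≃+* L := RingEquiv.ofBijective σ H.sigma_bij
    have hes : ∀ x, σ (e.symm x) = x := fun x => e.apply_symm_apply x
    have hesN : ∀ (n : ℕ) x, σ^[n] (e.symm^[n] x) = x :=
      fun n => (show Function.LeftInverse σ e.symm from hes).iterate n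
    have hmem : ∀ (n : ℕ) x, x ∈ O → e.symm^[n] x ∈ O := by
      intro n x hx
      induction n with
      | zero => exact hx
      | succ n ih =>
        rw [Function.iterate_succ_apply']
        exact H.mem_of_sigma_mem (by rw [hes]; exact ih)
    have hpi : ∀ n : ℕ, e.symm^[n] π = π := fun n =>
      Function.iterate_fixed (e.symm_apply_eq.2 H.sigma_pi.symm) n
    let B : AddMonoid.End O :=
      { toFun := fun x : O => x - (⟨π ^ (-a), H.mem_of_zpow_mul_mem (-a) (by omega)⟩ : O) *
          ⟨e.symm^[N] x, hmem N x x.2⟩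
        map_zero' := Subtype.ext (by simp)
        map_add' := fun x y => Subtype.ext (by push_cast; rw [iterate_map_add]; ring) }
    have hB : ∀ x : O, (B x : L) = x - π ^ (-a) * e.symm^[N] x := fun x => rfl
    have hs : Function.Surjective B := by
      refine H.surjective_of_res B (fun x => Subtype.ext ?_) fun a' => ⟨a', ?_⟩
      · push_cast
        rw [hB, hB]
        push_cast
        rw [iterate_map_mul, hpi]; ring
      · rw [← sub_eq_zero, ← map_sub, H.res_eq_zero]
        refine ⟨-(π ^ (-a - 1) * e.symm^[N] a'), neg_mem (mul_mem
          (H.mem_of_zpow_mul_mem _ (by omega)) (hmem N a' a'.2)), ?_⟩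
        push_cast
        rw [hB]
        have : π ^ (-a) = π * π ^ (-a - 1) := by
          rw [← zpow_one_add₀ h0]; congr 1; ring
        rw [this]; ring
    obtain ⟨z, hz⟩ := hs ⟨_, hm⟩
    have hz' := congrArg Subtype.val hz
    rw [hB] at hz'
    refine ⟨(π ^ m)⁻¹ * (π ^ (-a) * e.symm^[N] z), ?_⟩
    have hi : σ^[N] (π ^ m)⁻¹ = (π ^ m)⁻¹ := by
      have := H.sigma_iterate_zpow N (-m)
      simpa using this
    rw [iterate_map_mul, iterate_map_mul, hi, hesN, H.sigma_iterate_zpow]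
    have : π ^ a * π ^ (-a) = 1 := by rw [← zpow_add₀ h0]; simp
    field_simp
    linear_combination hz' + z * this

/-! ### Adjoining a root of the uniformizer: quasi-periodic functions -/

/-- The `O`-lattice of `s`-quasi-periodic functions, which models `O[π ^ (1 / s)]`. -/
def quasiPeriodic (O : Subring L) (π : L) (s : ℕ) : AddSubgroup (ℤ → L) where
  carrier := {y | (∀ i, y (i - s) = π * y i) ∧ ∀ i : ℤ, i < s → y i ∈ O}
  zero_mem' := ⟨fun i => by simp, fun i _ => zero_mem _⟩
  add_mem' {x y} hx hy := ⟨fun i => by simp [hx.1, hy.1, mul_add],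
    fun i hi => add_mem (hx.2 i hi) (hy.2 i hi)⟩
  neg_mem' {x} hx := ⟨fun i => by simp [hx.1], fun i hi => neg_mem (hx.2 i hi)⟩

/-- Stated for functions with values in any vector space: it is applied to coordinates in `L` and
later to families of vectors in `D`. -/
theorem apply_sub_mul {V : Type*} [AddCommGroup V] [Module L V] {π : L} (h0 : π ≠ 0)
    {s : ℕ} {y : ℤ → V} (h : ∀ i : ℤ, y (i - s) = π • y i)
    (i r : ℤ) : y (i - s * r) = π ^ r • y i := by
  induction r using Int.induction_on generalizing i with
  | zero => simp
  | succ r ih =>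
    have := h (i - s * r)
    rw [ih] at this
    rw [show i - s * ((r : ℤ) + 1) = i - s * r - s by ring, this, ← mul_smul,
      ← zpow_one_add₀ h0, add_comm 1]
  | pred r ih =>
    have := h (i - s * (-(r : ℤ) - 1))
    rw [show i - (s : ℤ) * (-(r : ℤ) - 1) - s = i - s * (-r) by ring, ih] at this
    have e1 : -(r : ℤ) - 1 = -1 + -r := by ring
    rw [e1] at this ⊢
    rw [zpow_add₀ h0, mul_smul, this, ← mul_smul, zpow_neg_one, inv_mul_cancel₀ h0, one_smul]

theorem mem_quasiPeriodic_of_window (H : FrobRing O res π σ q) {s : ℕ} (hs : 0 < s) {y : ℤ → L}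
    (h : ∀ i : ℤ, y (i - s) = π * y i) (hO : ∀ i : ℤ, 0 ≤ i → i < s → y i ∈ O) :
    y ∈ quasiPeriodic O π s := by
  refine ⟨h, fun i hi => ?_⟩
  have hs' : (0 : ℤ) < s := by exact_mod_cast hs
  have h1 := apply_sub_mul H.pi_ne_zero h (i % s) (-(i / s))
  rw [smul_eq_mul] at h1
  have h2 : i % s - s * (-(i / s)) = i := by have := Int.emod_add_mul_ediv i s; linarith
  rw [h2] at h1
  rw [h1]
  refine mul_mem (H.mem_of_zpow_mul_mem _ ?_) (hO _ (Int.emod_nonneg _ hs'.ne')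
    (Int.emod_lt_of_pos _ hs'))
  have : i / s < 1 := Int.ediv_lt_of_lt_mul hs' (by simpa using hi)
  omega

/-- Multiplication by `π ^ (1 / s)`. -/
def shift (O : Subring L) (π : L) (s : ℕ) : AddMonoid.End (quasiPeriodic O π s) where
  toFun y := ⟨fun i => y.1 (i - 1), fun i => by
    rw [← y.2.1]; ring_nf, fun i hi => y.2.2 _ (by omega)⟩
  map_zero' := rfl
  map_add' _ _ := rfl

theorem shift_pow_apply (s n : ℕ) (y : quasiPeriodic O π s) (i : ℤ) :
    ((shift O π s ^ n) y).1 i = y.1 (i - n) := by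
  induction n generalizing i with
  | zero => simp
  | succ n ih =>
    rw [pow_succ']
    change ((shift O π s ^ n) y).1 (i - 1) = _
    rw [ih]; push_cast; ring_nf

/-- With `ϖ^s = π`, a function `y` stands for the sum of the `y i ϖ^i` over `0 ≤ i < s`. The shift
is then multiplication by `ϖ`, and its `s`-th power is multiplication by `π`, for which completeness
of `O` can be used coordinatewise. -/
theorem shift_pow_mul_apply (H : FrobRing O res π σ q) (s n : ℕ) (y : quasiPeriodic O π s)
    (i : ℤ) : (((shift O π s ^ s) ^ n) y).1 i = π ^ n * y.1 i := by
  have := apply_sub_mul H.pi_ne_zero y.2.1 i n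
  rw [smul_eq_mul] at this
  rw [zpow_natCast] at this
  rw [← pow_mul, shift_pow_apply, ← this]; push_cast; rfl

theorem quasiPeriodic_haus (H : FrobRing O res π σ q) {s : ℕ} (hs : 0 < s)
    (a : quasiPeriodic O π s) (ha : ∀ n : ℕ, ∃ b, a = ((shift O π s ^ s) ^ n) b) : a = 0 := by
  have hw : ∀ i : ℤ, i < s → a.1 i = 0 := fun i hi => H.haus _ fun n => by
    obtain ⟨b, hb⟩ := ha n
    exact ⟨b.1 i, b.2.2 i hi, by rw [← H.shift_pow_mul_apply, ← hb]⟩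
  have hs' : (0 : ℤ) < s := by exact_mod_cast hs
  refine Subtype.ext (funext fun i => ?_)
  have h1 := apply_sub_mul H.pi_ne_zero a.2.1 (i % s) (-(i / s))
  rw [smul_eq_mul] at h1
  have h2 : i % s - s * (-(i / s)) = i := by have := Int.emod_add_mul_ediv i s; linarith
  rw [h2, hw _ (Int.emod_lt_of_pos _ hs'), mul_zero] at h1
  exact h1

theorem quasiPeriodic_complete (H : FrobRing O res π σ q) {s : ℕ} (hs : 0 < s)
    (f : ℕ → quasiPeriodic O π s) : ∃ x, ∀ n : ℕ, ∃ b,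
      x = ∑ m ∈ Finset.range n, ((shift O π s ^ s) ^ m) (f m) + ((shift O π s ^ s) ^ n) b := by
  have h0 := H.pi_ne_zero
  have hs' : (0 : ℤ) < s := by exact_mod_cast hs
  have hc : ∀ i : ℤ, ∃ x ∈ O, 0 ≤ i → i < s → ∀ n, ∃ y ∈ O,
      x = ∑ m ∈ Finset.range n, π ^ m * (f m).1 i + π ^ n * y := by
    intro i
    by_cases hi : i < s
    · obtain ⟨x, hx, h⟩ := H.complete (fun m => (f m).1 i) fun m => (f m).2.2 i hi
      exact ⟨x, hx, fun _ _ => h⟩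
    · exact ⟨0, zero_mem _, fun _ h => absurd h hi⟩
  choose x0 hx0 hx using hc
  let x : ℤ → L := fun i => π ^ (-(i / s)) * x0 (i % s)
  have hxper : ∀ i : ℤ, x (i - s) = π * x i := by
    intro i
    have h1 : (i - s) / s = i / s - 1 := by
      have := Int.add_mul_ediv_right i (-1) hs'.ne'
      rw [show i + -1 * (s : ℤ) = i - s by ring] at this
      omega
    simp only [x, h1, Int.sub_emod_right]
    rw [← mul_assoc, ← zpow_one_add₀ h0]; congr 2; ring
  have hxw : ∀ i : ℤ, 0 ≤ i → i < s → x i = x0 i := fun i h1 h2 => by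
    simp [x, Int.ediv_eq_zero_of_lt h1 h2, Int.emod_eq_of_lt h1 h2]
  refine ⟨⟨x, H.mem_quasiPeriodic_of_window hs hxper fun i h1 h2 => hxw i h1 h2 ▸ hx0 i⟩,
    fun n => ?_⟩
  let b : ℤ → L := fun i => (π ^ n)⁻¹ * (x i - ∑ m ∈ Finset.range n, π ^ m * (f m).1 i)
  have hb : b ∈ quasiPeriodic O π s := by
    refine H.mem_quasiPeriodic_of_window hs (fun i => ?_) fun i h1 h2 => ?_
    · simp only [b, hxper, (f _).2.1, mul_sub, Finset.mul_sum]
      congr 1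
      · ring
      · exact Finset.sum_congr rfl fun m _ => by ring
    · obtain ⟨y, hy, h⟩ := hx i h1 h2 n
      have : b i = y := by
        simp only [b, hxw i h1 h2]
        rw [h, add_sub_cancel_left, inv_mul_cancel_left₀ (pow_ne_zero n h0)]
      rw [this]; exact hy
  refine ⟨⟨b, hb⟩, Subtype.ext (funext fun i => ?_)⟩
  simp only [AddSubgroup.coe_add, AddSubgroup.val_finsetSum, Pi.add_apply, Finset.sum_apply,
    H.shift_pow_mul_apply]
  simp only [b]
  rw [mul_inv_cancel_left₀ (pow_ne_zero n h0)]
  ring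

/-- With `ϖ` the shift, the equation reads `y = ∑ u_j σ^(j+1) (ϖ^(e_j) y)`. Modulo `ϖ` only the
terms with `e_j = 0` survive, and the condition at `j₀` gives the additive polynomial a nonzero
root. The operator `B` commutes with `ϖ` and is surjective, so a lift of this root can be corrected
by a multiple of `ϖ` to lie in the kernel of `B`. -/
theorem exists_quasiPeriodic_solution [IsAlgClosed k] (H : FrobRing O res π σ q) {s : ℕ}
    (hs : 0 < s) (n : ℕ) (u : ℕ → O) (e : ℕ → ℕ) {j₀ : ℕ} (hj : j₀ < n) (he : e j₀ = 0)
    (hu : res (u j₀) ≠ 0) : ∃ y : ℤ → L, (∀ i : ℤ, y (i - s) = π * y i) ∧ y 0 ≠ 0 ∧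
      ∀ i, y i = ∑ j ∈ Finset.range n, u j * σ^[j + 1] (y (i - e j)) := by
  have hs' : (0 : ℤ) < s := by exact_mod_cast hs
  have h0 := H.pi_ne_zero
  let B : AddMonoid.End (quasiPeriodic O π s) :=
    { toFun := fun y => ⟨fun i => ∑ j ∈ Finset.range n, (u j : L) * σ^[j + 1] (y.1 (i - e j)) - y.1 i,
        fun i => by
          have : ∀ j, y.1 (i - s - e j) = π * y.1 (i - e j) := fun j => by
            rw [← y.2.1]; ring_nf
          simp only [this, iterate_map_mul, Function.iterate_fixed H.sigma_pi, y.2.1, mul_sub,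
            Finset.mul_sum]
          congr 1
          exact Finset.sum_congr rfl fun j _ => by ring,
        fun i hi => sub_mem (sum_mem fun j _ => mul_mem (u j).2
          (H.sigma_iterate_mem _ (y.2.2 _ (by omega)))) (y.2.2 i hi)⟩
      map_zero' := Subtype.ext (funext fun i => by simp)
      map_add' := fun x y => Subtype.ext (funext fun i => by
        simp only [AddSubgroup.coe_add, Pi.add_apply, iterate_map_add, mul_add,
          Finset.sum_add_distrib]
        ring) }
  have hB : ∀ y i, (B y).1 i =
      ∑ j ∈ Finset.range n, (u j : L) * σ^[j + 1] (y.1 (i - e j)) - y.1 i := fun _ _ => rfl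
  have hcomm : Commute B (shift O π s) := by
    refine AddMonoidHom.ext fun y => Subtype.ext (funext fun i => ?_)
    change ∑ j ∈ Finset.range n, (u j : L) * σ^[j + 1] (y.1 (i - e j - 1)) - y.1 (i - 1) =
      ∑ j ∈ Finset.range n, (u j : L) * σ^[j + 1] (y.1 (i - 1 - e j)) - y.1 (i - 1)
    simp only [sub_right_comm]
  -- Reduction modulo `ϖ`: the kernel of `ρ` is the image of the shift (`hker`).
  let ρ : quasiPeriodic O π s → k := fun y => res ⟨y.1 0, y.2.2 0 hs'⟩
  let β : ℕ → k := fun j => if e j = 0 then res (u j) else 0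
  have hρB : ∀ y, ρ (B y) = ∑ j ∈ Finset.range n, β j * ρ y ^ q ^ (j + 1) - ρ y := by
    intro y
    have hz : ∀ j, y.1 (0 - e j) ∈ O := fun j => y.2.2 _ (by omega)
    have h1 : (⟨(B y).1 0, (B y).2.2 0 hs'⟩ : O) = ∑ j ∈ Finset.range n, u j *
        ⟨σ^[j + 1] (y.1 (0 - e j)), H.sigma_iterate_mem _ (hz j)⟩ - ⟨y.1 0, y.2.2 0 hs'⟩ :=
      Subtype.ext (by push_cast; exact hB y 0)
    simp only [ρ]
    rw [h1, map_sub, map_sum]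
    congr 1
    refine Finset.sum_congr rfl fun j _ => ?_
    rw [map_mul, H.res_sigma_iterate (j + 1) ⟨_, hz j⟩]
    by_cases h : e j = 0
    · simp [β, h]
    · have : res ⟨y.1 (0 - e j), hz j⟩ = 0 := by
        refine (H.res_eq_zero _).2 ⟨y.1 (s - e j), y.2.2 _ (by omega), ?_⟩
        rw [← y.2.1]; ring_nf
      rw [this]
      simp [β, h, (zero_lt_one.trans H.one_lt).ne']
  have hker : ∀ y, ρ y = 0 → ∃ z, y = shift O π s z := by
    intro y hy
    obtain ⟨o, ho, hyo⟩ := (H.res_eq_zero _).1 hy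
    refine ⟨⟨fun i => y.1 (i + 1), fun i => ?_, fun i hi => ?_⟩, ?_⟩
    · rw [← y.2.1]; ring_nf
    · rcases eq_or_ne (i + 1) s with h | h
      · have := y.2.1 s
        rw [sub_self] at this
        change y.1 (i + 1) ∈ O
        rw [h, mul_left_cancel₀ h0 (this.symm.trans hyo)]
        exact ho
      · exact y.2.2 _ (by omega)
    · refine Subtype.ext (funext fun i => ?_)
      change y.1 i = y.1 (i - 1 + 1)
      rw [sub_add_cancel]
  have hρs : ∀ x y, ρ (x - y) = ρ x - ρ y := fun x y => by
    simp only [ρ, ← map_sub]; rfl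
  have hρsurj : ∀ c, ∃ y, ρ y = c := by
    intro c
    obtain ⟨x, rfl⟩ := H.res_surj c
    let y : ℤ → L := fun i => if (s : ℤ) ∣ i then π ^ (-(i / s)) * x else 0
    refine ⟨⟨y, H.mem_quasiPeriodic_of_window hs (fun i => ?_) fun i h1 h2 => ?_⟩, ?_⟩
    · simp only [y, dvd_sub_self_right]
      split_ifs
      · have h1 : (i - s) / s = i / s - 1 := by
          have := Int.add_mul_ediv_right i (-1) hs'.ne'
          rw [show i + -1 * (s : ℤ) = i - s by ring] at this
          omega
        rw [h1, ← mul_assoc, ← zpow_one_add₀ h0]; congr 2; ring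
      · simp
    · simp only [y, Int.ediv_eq_zero_of_lt h1 h2]
      split_ifs
      · simp
      · exact zero_mem _
    · simp [ρ, y]
  have hsurj : Function.Surjective B := by
    -- Solvability modulo `ϖ` is raised to solvability modulo `ϖ^s = π`, the operator for which the
    -- lattice is complete.
    refine surjective_of_surjective_mod (shift O π s ^ s) B (hcomm.pow_right s)
      (H.quasiPeriodic_haus hs) (H.quasiPeriodic_complete hs)
      (exists_eq_add_pow_of_surjective_mod _ _ hcomm (fun a => ?_) s)
    obtain ⟨c, hc⟩ := exists_frobPoly_eq H.one_lt n β (ρ a)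
    obtain ⟨x, rfl⟩ := hρsurj c
    obtain ⟨b, hb⟩ := hker (a - B x) (by rw [hρs, hρB, hc, sub_self])
    exact ⟨x, b, by rw [← hb]; abel⟩
  obtain ⟨c, hc0, hc⟩ := exists_frobPoly_eq_zero H.one_lt n β hj (by simpa [β, he] using hu)
  obtain ⟨x, rfl⟩ := hρsurj c
  obtain ⟨b, hb⟩ := hker (B x) (by rw [hρB, hc])
  obtain ⟨z, hz⟩ := hsurj b
  have hfin : B (x - shift O π s z) = 0 := by
    have : B (shift O π s z) = shift O π s (B z) := DFunLike.congr_fun hcomm.eq z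
    rw [map_sub, this, hz, hb, sub_self]
  refine ⟨(x - shift O π s z).1, (x - shift O π s z).2.1, fun h => hc0 ?_, fun i => ?_⟩
  · have h1 : ρ (shift O π s z) = 0 := by
      refine (H.res_eq_zero _).2 ⟨z.1 (s - 1), z.2.2 _ (by omega), ?_⟩
      rw [← z.2.1]
      change z.1 (0 - 1) = _
      ring_nf
    have h2 : ρ (x - shift O π s z) = 0 := by
      simp only [ρ, h]; exact map_zero res
    rw [hρs, h1, sub_zero] at h2
    exact h2
  · have := hB (x - shift O π s z) i
    rw [hfin] at this
    exact (sub_eq_zero.1 this.symm).symm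
end
end FrobRing

/-! ### Slope vectors and the Dieudonné–Manin theorem -/

section
variable {L D : Type*} [Field L] [AddCommGroup D] [Module L D] {σ : L →+* L} {π : L}
  {φ : D →ₛₗ[σ] D}

/-- The vector `v` satisfies `φ ^ s v = π ^ r v`, where `α = r / s` in lowest terms. -/
def IsSlopeVector (φ : D →ₛₗ[σ] D) (π : L) (α : ℚ) (v : D) : Prop :=
  φ^[α.den] v = π ^ α.num • v

theorem iterate_smul (φ : D →ₛₗ[σ] D) (n : ℕ) (c : L) (v : D) :
    φ^[n] (c • v) = σ^[n] c • φ^[n] v := by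
  induction n generalizing c v with
  | zero => rfl
  | succ n ih => rw [Function.iterate_succ_apply, map_smulₛₗ, ih]; rfl

theorem iterate_sum {ι : Type*} (φ : D →ₛₗ[σ] D) (n : ℕ) (s : Finset ι) (f : ι → D) :
    φ^[n] (∑ i ∈ s, f i) = ∑ i ∈ s, φ^[n] (f i) := by
  induction n generalizing f with
  | zero => rfl
  | succ n ih => rw [Function.iterate_succ_apply, map_sum, ih]; rfl

theorem IsSlopeVector.map {α : ℚ} {v : D} (hπ : σ π = π) (h : IsSlopeVector φ π α v) :
    IsSlopeVector φ π α (φ v) := by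
  unfold IsSlopeVector at *
  rw [← Function.iterate_succ_apply, Function.iterate_succ_apply', h, map_smulₛₗ, map_zpow₀, hπ]

theorem IsSlopeVector.iterate {α : ℚ} {v : D} (hπ : σ π = π) (h0 : π ≠ 0)
    (h : IsSlopeVector φ π α v) (c : ℕ) : φ^[α.den * c] v = π ^ (α.num * c) • v := by
  induction c with
  | zero => simp
  | succ c ih =>
    have hfix : σ^[α.den] (π ^ (α.num * c)) = π ^ (α.num * c) :=
      Function.iterate_fixed (by rw [map_zpow₀, hπ]) _
    rw [mul_add_one, add_comm, Function.iterate_add_apply, ih, iterate_smul, hfix, h, ← mul_smul,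
      ← zpow_add₀ h0]
    push_cast
    rw [mul_add_one]

theorem IsSlopeVector.iterate_of_dvd {α : ℚ} {v : D} (hπ : σ π = π) (h0 : π ≠ 0)
    (h : IsSlopeVector φ π α v) {N : ℕ} (hN : α.den ∣ N) :
    φ^[N] v = π ^ (α.num * (N / α.den : ℕ)) • v := by
  have := h.iterate hπ h0 (N / α.den)
  rwa [Nat.mul_div_cancel' hN] at this

theorem eq_of_num_mul_eq {α β : ℚ} {N : ℕ} (hN : N ≠ 0) (h1 : α.den ∣ N) (h2 : β.den ∣ N)
    (h : α.num * (N / α.den : ℕ) = β.num * (N / β.den : ℕ)) : α = β := by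
  have key : ∀ {γ : ℚ}, γ.den ∣ N → ((γ.num * (N / γ.den : ℕ) : ℤ) : ℚ) = γ * N := by
    intro γ hγ
    have hd : (γ.den : ℚ) ≠ 0 := by exact_mod_cast γ.den_nz
    rw [Int.cast_mul, Int.cast_natCast, Nat.cast_div hγ hd]
    conv_rhs => rw [← Rat.num_div_den γ]
    ring
  have : α * N = β * N := by rw [← key h1, ← key h2, h]
  exact mul_right_cancel₀ (by exact_mod_cast hN) this

/-- The first linear relation between the iterates of a vector. -/
theorem exists_cyclic_relation [FiniteDimensional L D] (φ : D →ₛₗ[σ] D) {v : D} (hv : v ≠ 0) :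
    ∃ (m : ℕ) (a : ℕ → L), LinearIndependent L (fun i : Fin (m + 1) => φ^[i] v) ∧
      φ^[m + 1] v = ∑ l ∈ Finset.range (m + 1), a l • φ^[l] v := by
  classical
  have hex : ∃ n, ¬ LinearIndependent L (fun i : Fin n => φ^[i] v) := by
    refine ⟨Module.finrank L D + 1, fun h => ?_⟩
    have := h.fintype_card_le_finrank
    simp at this
  obtain ⟨m, hm⟩ : ∃ m, Nat.find hex = m + 2 := by
    have h0 : Nat.find hex ≠ 0 := fun h => by
      have := Nat.find_spec hex
      rw [h] at this
      exact this (linearIndependent_empty_type)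
    have h1 : Nat.find hex ≠ 1 := fun h => by
      have := Nat.find_spec hex
      rw [h] at this
      exact this ((linearIndependent_unique_iff (ι := Fin 1)).2 (by simpa using hv))
    exact ⟨Nat.find hex - 2, by omega⟩
  have h1 : LinearIndependent L (fun i : Fin (m + 1) => φ^[i] v) :=
    not_not.1 (Nat.find_min hex (by omega))
  have h2 := Nat.find_spec hex
  rw [hm] at h2
  have h3 : φ^[m + 1] v ∈ Submodule.span L (Set.range fun i : Fin (m + 1) => φ^[i] v) := by
    by_contra h
    refine h2 ?_
    rw [linearIndependent_finSucc']
    exact ⟨h1, h⟩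
  obtain ⟨c, hc⟩ := (Submodule.mem_span_range_iff_exists_fun L).1 h3
  refine ⟨m, fun l => if h : l < m + 1 then c ⟨l, h⟩ else 0, h1, ?_⟩
  rw [← hc, Finset.sum_range]
  exact Finset.sum_congr rfl fun i _ => by dsimp only; rw [dif_pos i.2]

end

namespace FrobRing
variable {L k D : Type*} [Field L] [Field k] {O : Subring L} {res : O →+* k}
    {π : L} {σ : L →+* L} {q : ℕ} [AddCommGroup D] [Module L D] {φ : D →ₛₗ[σ] D}

theorem exists_unit_part (H : FrobRing O res π σ q) (x : L) :
    ∃ (m : ℤ) (u : O), (x ≠ 0 → res u ≠ 0) ∧ x = π ^ m * u := by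
  by_cases h : x = 0
  · exact ⟨0, 0, fun h' => absurd h h', by simp [h]⟩
  · obtain ⟨m, u, hu, hx⟩ := H.exists_eq_zpow_mul h
    exact ⟨m, u, fun _ => hu, hx⟩

/-- Existence of a nonzero solution of `y = ∑ j, c j * λ ^ (j + 1) * σ ^ (j + 1) y` for suitable
`λ = π ^ (-r / s)`. -/
theorem exists_slope_equation_solution [IsAlgClosed k] (H : FrobRing O res π σ q) (n : ℕ)
    (c : ℕ → L) (hc : ∃ j < n, c j ≠ 0) : ∃ (α : ℚ) (y : ℤ → L),
      (∀ i : ℤ, y (i - α.den) = π * y i) ∧ y 0 ≠ 0 ∧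
      ∀ i, y i = ∑ j ∈ Finset.range n, c j * σ^[j + 1] (y (i + α.num * (j + 1))) := by
  classical
  choose v u hu hcu using fun j => H.exists_unit_part (c j)
  obtain ⟨j₁, hj₁⟩ := hc
  -- The slope is the minimum of `v_j / (j + 1)`, the slope of an edge of the Newton polygon of the
  -- equation. With it all exponents `α.den * v_j - α.num * (j + 1)` are nonnegative, and the one at
  -- `j₀` is zero.
  obtain ⟨j₀, hj₀, hmin⟩ := Finset.exists_min_image ((Finset.range n).filter fun j => c j ≠ 0)
    (fun j => (v j : ℚ) / (j + 1)) ⟨j₁, by simpa using hj₁⟩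
  simp only [Finset.mem_filter, Finset.mem_range] at hj₀ hmin
  let α : ℚ := (v j₀ : ℚ) / (j₀ + 1)
  have hα : α * α.den = α.num := Rat.mul_den_eq_num α
  have hden : (0 : ℚ) < α.den := by exact_mod_cast α.den_pos
  have he : ∀ j < n, c j ≠ 0 → 0 ≤ α.den * v j - α.num * (j + 1) := by
    intro j hj hcj
    have h1 := hmin j ⟨hj, hcj⟩
    rw [le_div_iff₀ (by positivity)] at h1
    have h2 : (α.num : ℚ) * (j + 1) ≤ α.den * v j := by
      rw [← hα]
      calc α * α.den * (j + 1) = α.den * (α * (j + 1)) := by ring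
        _ ≤ _ := mul_le_mul_of_nonneg_left h1 hden.le
    have h3 : α.num * (j + 1) ≤ α.den * v j := by exact_mod_cast h2
    linarith
  have he0 : α.den * v j₀ - α.num * (j₀ + 1) = 0 := by
    have h2 : (α.num : ℚ) * (j₀ + 1) = α.den * v j₀ := by
      rw [← hα]
      have : α * (j₀ + 1) = v j₀ := div_mul_cancel₀ _ (by positivity)
      rw [← this]; ring
    have h3 : α.num * (j₀ + 1) = α.den * v j₀ := by exact_mod_cast h2
    linarith
  obtain ⟨y, hy, hy0, hyi⟩ := H.exists_quasiPeriodic_solution α.den_pos n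
    (fun j => if c j = 0 then 0 else u j)
    (fun j => (α.den * v j - α.num * (j + 1)).toNat) hj₀.1 (by simp [he0])
    (by simpa [hj₀.2] using hu j₀ hj₀.2)
  refine ⟨α, y, hy, hy0, fun i => (hyi i).trans (Finset.sum_congr rfl fun j hj => ?_)⟩
  by_cases hcj : c j = 0
  · simp [hcj]
  have h1 := he j (Finset.mem_range.1 hj) hcj
  have h2 := apply_sub_mul H.pi_ne_zero hy (i + α.num * (j + 1)) (v j)
  rw [smul_eq_mul] at h2
  rw [if_neg hcj, Int.toNat_of_nonneg h1,
    show i - (α.den * v j - α.num * (j + 1)) = i + α.num * (j + 1) - α.den * v j by ring, h2,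
    iterate_map_mul, H.sigma_iterate_zpow]
  conv_rhs => rw [hcu j]
  ring

/-- In the cyclic space generated by `v`, an eigenvector `w = ∑ X_l φ^l v` with eigenvalue `ϖ^r`,
where `ϖ^s = π`, is sought. Eliminating `X_0, …, X_(m-1)` leaves one equation for `X_m`. Instead of
extending scalars to `L[ϖ]`, the eigenvector is a quasi-periodic family `w : ℤ → D` with `φ (w i) =
w (i - r)`; its member `w 0` lies in `D` and satisfies `φ^s (w 0) = w (-r s) = π^r w 0`. -/
theorem exists_isSlopeVector [IsAlgClosed k] [FiniteDimensional L D] [Nontrivial D]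
    (H : FrobRing O res π σ q) (hφ : Function.Injective φ) :
    ∃ (α : ℚ) (w : D), w ≠ 0 ∧ IsSlopeVector φ π α w := by
  obtain ⟨v, hv⟩ := exists_ne (0 : D)
  obtain ⟨m, a, hli, hrel⟩ := exists_cyclic_relation φ hv
  have ha : ∃ l < m + 1, a l ≠ 0 := by
    by_contra! h
    rw [Finset.sum_eq_zero fun l hl => by rw [h l (Finset.mem_range.1 hl), zero_smul]] at hrel
    exact hv (hφ.iterate (m + 1) (hrel.trans (iterate_map_zero φ _).symm))
  have hinj : ∀ n, Function.Injective σ^[n] := fun n => σ.injective.iterate n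
  obtain ⟨α, y, hyper, hy0, hy⟩ := H.exists_slope_equation_solution (m + 1)
    (fun j => σ^[j] (a (m - j))) (by
      obtain ⟨l, hl, hal⟩ := ha
      refine ⟨m - l, by omega, fun h => hal ?_⟩
      rw [show m - (m - l) = l by omega] at h
      exact hinj _ (h.trans (iterate_map_zero σ _).symm))
  -- Comparing coefficients of `φ^l v` in `φ (w i) = w (i - α.num)` gives the recursions `hX0` and
  -- `hXs`; this is their closed form. The requirement `X m = y` is the equation that `y` solves.
  let X : ℕ → ℤ → L := fun l i => ∑ j ∈ Finset.range (l + 1),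
    σ^[j] (a (l - j)) * σ^[j + 1] (y (i + α.num * (j + 1)))
  have hX0 : ∀ i, X 0 i = a 0 * σ (y (i + α.num)) := fun i => by simp [X]
  have hXm : ∀ i, X m i = y i := fun i => (hy i).symm
  have hXs : ∀ l i, X (l + 1) i = σ (X l (i + α.num)) + a (l + 1) * σ (y (i + α.num)) := by
    intro l i
    simp only [X]
    rw [Finset.sum_range_succ', map_sum]
    congr 1
    · refine Finset.sum_congr rfl fun j _ => ?_
      rw [map_mul, Nat.add_sub_add_right, ← Function.iterate_succ_apply' σ,
        ← Function.iterate_succ_apply' σ]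
      congr 3
      push_cast
      ring
    · simp
  have hXper : ∀ l (i : ℤ), X l (i - α.den) = π * X l i := by
    intro l i
    simp only [X, Finset.mul_sum]
    refine Finset.sum_congr rfl fun j _ => ?_
    rw [show i - α.den + α.num * (j + 1) = i + α.num * (j + 1) - α.den by ring, hyper,
      iterate_map_mul, Function.iterate_fixed H.sigma_pi]
    ring
  let w : ℤ → D := fun i => ∑ l ∈ Finset.range (m + 1), X l i • φ^[l] v
  have hφw : ∀ i, φ (w i) = w (i - α.num) := by
    intro i
    simp only [w, map_sum, map_smulₛₗ, ← Function.iterate_succ_apply' φ]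
    rw [Finset.sum_range_succ, hrel, hXm, Finset.smul_sum, Finset.sum_range_succ',
      Finset.sum_range_succ' _ m]
    simp only [hX0, hXs, sub_add_cancel, add_smul, Finset.sum_add_distrib, smul_smul]
    simp only [mul_comm (σ (y i))]
    abel
  have hwper : ∀ i : ℤ, w (i - α.den) = π • w i := fun i => by
    simp only [w, hXper, Finset.smul_sum, smul_smul]
  refine ⟨α, w 0, fun h => ?_, ?_⟩
  · rw [linearIndependent_iff'] at hli
    have := hli Finset.univ (fun l => X l 0) (by
      rw [← h]
      simp only [w]
      rw [Finset.sum_range]) (Fin.last m) (Finset.mem_univ _)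
    exact hy0 (by rw [← hXm]; simpa using this)
  · have hit : ∀ n : ℕ, φ^[n] (w 0) = w (0 - α.num * n) := by
      intro n
      induction n with
      | zero => simp
      | succ n ih =>
        rw [Function.iterate_succ_apply', ih, hφw]
        congr 1
        push_cast
        ring
    have := apply_sub_mul H.pi_ne_zero hwper 0 α.num
    rw [IsSlopeVector, hit, ← this, mul_comm]

/-- Put `T = π^(-α.num) φ^(α.den)`. The power `T^(β.den)` preserves the line of `v`, where
`T^(β.den) - 1` is a scalar operator that `exists_zpow_mul_sigma_sub` inverts on the right. If it
sends `y v` to `x v`, the sum of `T^i (y v)` over `i < β.den` telescopes to a solution for `T - 1`.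
-/
theorem exists_sub_eq_smul [IsAlgClosed k] (H : FrobRing O res π σ q) (M : Submodule L D)
    (hM : ∀ m ∈ M, φ m ∈ M) {α β : ℚ} {v : D} (hv : v ∈ M) (h : IsSlopeVector φ π β v) (x : L) :
    ∃ m ∈ M, π ^ (-α.num) • φ^[α.den] m - m = x • v := by
  have h0 := H.pi_ne_zero
  let N := α.den * β.den
  have hN : 0 < N := Nat.mul_pos α.den_pos β.den_pos
  obtain ⟨y, hy⟩ := H.exists_zpow_mul_sigma_sub hN (-α.num * β.den + β.num * α.den) x
  have hMit : ∀ n, ∀ m ∈ M, φ^[n] m ∈ M := fun n m hm => by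
    induction n with
    | zero => exact hm
    | succ n ih => rw [Function.iterate_succ_apply']; exact hM _ ih
  let z : ℕ → D := fun i => π ^ (-α.num * i) • φ^[α.den * i] (y • v)
  have hz : ∀ i, π ^ (-α.num) • φ^[α.den] (z i) = z (i + 1) := by
    intro i
    simp only [z]
    rw [iterate_smul, H.sigma_iterate_zpow, ← Function.iterate_add_apply, ← mul_smul,
      ← zpow_add₀ h0]
    congr 2
    · push_cast; ring
    · rw [mul_add_one, add_comm]
  refine ⟨∑ i ∈ Finset.range β.den, z i, sum_mem fun i _ => M.smul_mem _
    (hMit _ _ (M.smul_mem _ hv)), ?_⟩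
  rw [iterate_sum, Finset.smul_sum, ← Finset.sum_sub_distrib]
  simp only [hz]
  rw [Finset.sum_range_sub]
  have h1 := h.iterate H.sigma_pi h0 α.den
  simp only [z]
  rw [iterate_smul, mul_comm α.den, h1, ← hy, sub_smul, ← mul_smul, ← mul_smul, zpow_add₀ h0]
  simp [N, mul_comm, mul_assoc]

/-- The Dieudonné–Manin theorem: `D` is spanned by slope vectors. -/
theorem span_isSlopeVector_eq_top [IsAlgClosed k] [FiniteDimensional L D]
    (H : FrobRing O res π σ q) (hφ : Function.Injective φ) :
    Submodule.span L {v | ∃ α, IsSlopeVector φ π α v} = ⊤ := by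
  have h0 := H.pi_ne_zero
  set M := Submodule.span L {v | ∃ α, IsSlopeVector φ π α v} with hMdef
  have hM : ∀ m ∈ M, φ m ∈ M := by
    intro m hm
    refine Submodule.span_induction (fun v hv => ?_) ?_ (fun x y _ _ hx hy => ?_)
      (fun c x _ hx => ?_) hm
    · obtain ⟨α, hα⟩ := hv
      exact Submodule.subset_span ⟨α, hα.map H.sigma_pi⟩
    · rw [map_zero]; exact zero_mem _
    · rw [map_add]; exact add_mem hx hy
    · rw [map_smulₛₗ]; exact M.smul_mem _ hx
  -- Surjectivity of `φ` on `M` is what makes the induced map on `D ⧸ M` injective.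
  have hMs : ∀ m ∈ M, ∃ m' ∈ M, φ m' = m := by
    intro m hm
    refine Submodule.span_induction (fun v hv => ?_) ?_ (fun x y _ _ hx hy => ?_)
      (fun c x _ hx => ?_) hm
    · obtain ⟨α, hα⟩ := hv
      refine ⟨π ^ (-α.num) • φ^[α.den - 1] v, M.smul_mem _ ?_, ?_⟩
      · clear hm
        induction α.den - 1 with
        | zero => exact Submodule.subset_span ⟨α, hα⟩
        | succ n ih => rw [Function.iterate_succ_apply']; exact hM _ ih
      · rw [map_smulₛₗ, ← Function.iterate_succ_apply' φ, H.sigma_zpow, Nat.succ_eq_add_one,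
          Nat.sub_add_cancel α.den_pos, hα, ← mul_smul, ← zpow_add₀ h0]
        simp
    · exact ⟨0, zero_mem _, map_zero _⟩
    · obtain ⟨a, ha, rfl⟩ := hx
      obtain ⟨b, hb, rfl⟩ := hy
      exact ⟨a + b, add_mem ha hb, map_add _ _ _⟩
    · obtain ⟨a, ha, rfl⟩ := hx
      obtain ⟨c', rfl⟩ := H.sigma_bij.2 c
      exact ⟨c' • a, M.smul_mem _ ha, map_smulₛₗ _ _ _⟩
  by_contra hne
  have : Nontrivial (D ⧸ M) := Submodule.Quotient.nontrivial_iff.2 hne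
  let φq : (D ⧸ M) →ₛₗ[σ] (D ⧸ M) := M.mapQ M φ hM
  have hφq : ∀ x, φq (M.mkQ x) = M.mkQ (φ x) := fun x => rfl
  have hφqi : Function.Injective φq := by
    rw [injective_iff_map_eq_zero]
    intro x hx
    obtain ⟨x, rfl⟩ := M.mkQ_surjective x
    rw [hφq, Submodule.mkQ_apply, Submodule.Quotient.mk_eq_zero] at hx
    obtain ⟨m, hm, hmx⟩ := hMs _ hx
    rw [← hφ hmx]
    simpa using hm
  -- A nonzero slope vector of the quotient is lifted and corrected by an element of `M` to a slope
  -- vector of `D`; it then lies in `M`, a contradiction.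
  obtain ⟨α, w, hw0, hw⟩ := H.exists_isSlopeVector hφqi
  obtain ⟨w, rfl⟩ := M.mkQ_surjective w
  have hit : ∀ n x, φq^[n] (M.mkQ x) = M.mkQ (φ^[n] x) := fun n x => by
    induction n with
    | zero => rfl
    | succ n ih => rw [Function.iterate_succ_apply', ih, Function.iterate_succ_apply', hφq]
  have hm0 : π ^ (-α.num) • φ^[α.den] w - w ∈ M := by
    rw [IsSlopeVector, hit] at hw
    rw [← Submodule.Quotient.mk_eq_zero, ← Submodule.mkQ_apply, map_sub, map_smul, hw, ← mul_smul,
      ← zpow_add₀ h0]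
    simp
  have hsurj : ∀ z ∈ M, ∀ x : L, ∃ m ∈ M, π ^ (-α.num) • φ^[α.den] m - m = x • z := by
    intro z hz
    refine Submodule.span_induction (fun v hv x => ?_) (fun x => ⟨0, zero_mem _, ?_⟩)
      (fun z₁ z₂ _ _ h₁ h₂ x => ?_) (fun c z _ hz x => ?_) hz
    · obtain ⟨β, hβ⟩ := hv
      exact H.exists_sub_eq_smul M hM (Submodule.subset_span ⟨β, hβ⟩) hβ x
    · rw [iterate_map_zero]; simp
    · obtain ⟨m₁, hm₁, e₁⟩ := h₁ x
      obtain ⟨m₂, hm₂, e₂⟩ := h₂ x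
      refine ⟨m₁ + m₂, add_mem hm₁ hm₂, ?_⟩
      rw [iterate_map_add, smul_add, smul_add, ← e₁, ← e₂]; abel
    · rw [smul_smul]; exact hz (x * c)
  obtain ⟨m, hm, hmw⟩ := hsurj _ hm0 1
  have hwm : IsSlopeVector φ π α (w - m) := by
    have h1 : π ^ (-α.num) • φ^[α.den] (w - m) = w - m := by
      rw [iterate_map_sub, smul_sub, ← sub_eq_zero]
      rw [one_smul, ← sub_eq_zero] at hmw
      rw [← neg_eq_zero, ← hmw]; abel
    rw [IsSlopeVector]
    conv_rhs => rw [← h1]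
    rw [← mul_smul, ← zpow_add₀ h0]
    simp
  have hwM : w - m ∈ M := Submodule.subset_span ⟨α, hwm⟩
  exact hw0 (by simpa using (Submodule.sub_mem_iff_left M hm).1 hwM)

/-- Coordinates of a slope vector in a basis of slope vectors. -/
theorem repr_of_isSlopeVector (H : FrobRing O res π σ q) {ι : Type*} [Fintype ι]
    (b : Module.Basis ι L D) {β : ι → ℚ} (hb : ∀ i, IsSlopeVector φ π (β i) (b i)) {N : ℕ}
    (hN : N ≠ 0) (hβ : ∀ i, (β i).den ∣ N) {α : ℚ} (hα : α.den ∣ N) {v : D}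
    (hv : IsSlopeVector φ π α v) {i : ι} (hi : b.repr v i ≠ 0) :
    β i = α ∧ σ^[N] (b.repr v i) = b.repr v i := by
  have h0 := H.pi_ne_zero
  have h1 := hv.iterate_of_dvd H.sigma_pi h0 hα
  conv_lhs at h1 => rw [← b.sum_repr v, iterate_sum]
  simp only [iterate_smul, (hb _).iterate_of_dvd H.sigma_pi h0 (hβ _), smul_smul] at h1
  have h2 := congrArg (fun w => b.repr w i) h1
  simp only [b.repr_sum_self, map_smul, Finsupp.smul_apply, smul_eq_mul] at h2
  rw [mul_comm] at h2
  -- `σ^N` preserves the valuation of the coordinate, so the two powers of `π` agree; cancelling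
  -- them leaves a fixed coordinate.
  have h3 := H.zpow_eq_of_sigma_iterate hi h2
  refine ⟨eq_of_num_mul_eq hN (hβ i) hα h3, ?_⟩
  rw [h3] at h2
  exact mul_left_cancel₀ (zpow_ne_zero _ h0) h2

end FrobRing

/-! ### Rational subspaces and flags in general position -/

namespace FrobRing
variable {L k D : Type*} [Field L] [Field k] {O : Subring L} {res : O →+* k}
    {π : L} {σ : L →+* L} {q : ℕ} [AddCommGroup D] [Module L D] {φ : D →ₛₗ[σ] D}

/-- There are arbitrarily many elements of some fixed field `L ^ (σ ^ M)` that are linearly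
independent over `L ^ (σ ^ N)`. -/
theorem exists_independent_fixed [IsAlgClosed k] (H : FrobRing O res π σ q) {N : ℕ} (hN : 0 < N)
    (d : ℕ) : ∃ (M : ℕ) (x : Fin d → L), 0 < M ∧ N ∣ M ∧ (∀ i, σ^[M] (x i) = x i) ∧
      ∀ c : Fin d → L, (∀ i, σ^[N] (c i) = c i) → ∑ i, c i * x i = 0 → c = 0 := by
  set Q := q ^ N with hQ
  have hQ1 : 1 < Q := Nat.one_lt_pow hN.ne' H.one_lt
  have hQd : 1 < Q ^ (d + 1) := Nat.one_lt_pow (by omega) hQ1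
  have hq0 : (Q : k) = 0 := by rw [hQ, Nat.cast_pow, H.cast_eq_zero, zero_pow hN.ne']
  have hne : ((Q ^ (d + 1) - 1 : ℕ) : k) ≠ 0 := by
    rw [Nat.cast_sub hQd.le, Nat.cast_pow, hq0]; simp
  have : NeZero ((Q ^ (d + 1) - 1 : ℕ) : k) := ⟨hne⟩
  -- Such a root exists because `q = 0` in `k` makes the order invertible. The conjugates `ζ^(Q^l)`,
  -- `l < d`, are distinct, and the independent elements are the powers of a lift `t` fixed by `σ^(N
  -- (d + 1))`.
  obtain ⟨ζ, hζ⟩ := HasEnoughRootsOfUnity.exists_primitiveRoot k (Q ^ (d + 1) - 1)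
  have hζ1 : ζ ^ q ^ (N * (d + 1)) = ζ := by
    rw [pow_mul, ← hQ, show Q ^ (d + 1) = Q ^ (d + 1) - 1 + 1 by omega, pow_succ, hζ.pow_eq_one,
      one_mul]
  have hM : 0 < N * (d + 1) := by positivity
  obtain ⟨t, ht, rfl⟩ := H.exists_fixed hM ζ hζ1
  refine ⟨N * (d + 1), fun i => (t : L) ^ (i : ℕ), hM, dvd_mul_right _ _,
    fun i => by rw [iterate_map_pow, ht], fun c hc h => ?_⟩
  have hfix : ∀ (l : ℕ) i, σ^[N * l] (c i) = c i := fun l i => by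
    rw [Function.iterate_mul]; exact Function.iterate_fixed (hc i) l
  -- Applying `σ^(N l)` to a relation with fixed coefficients gives `d` relations whose matrix is
  -- the Vandermonde matrix of the conjugates of `t`.
  let V : Matrix (Fin d) (Fin d) L := Matrix.vandermonde fun l => σ^[N * l] t
  have hV : V.det ≠ 0 := by
    rw [Matrix.det_vandermonde_ne_zero_iff]
    intro l m hlm
    have hlt : ∀ l : Fin d, Q ^ (l : ℕ) < Q ^ (d + 1) - 1 := fun l => by
      have h1 : Q ^ (l : ℕ) < Q ^ d := Nat.pow_lt_pow_right hQ1 l.2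
      have h2 : Q ^ (d + 1) = Q ^ d * Q := pow_succ _ _
      nlinarith [Nat.sub_add_cancel hQd.le]
    have h1 : res ⟨σ^[N * l] t, H.sigma_iterate_mem _ t.2⟩ =
        res ⟨σ^[N * m] t, H.sigma_iterate_mem _ t.2⟩ := congrArg res (Subtype.ext hlm)
    rw [H.res_sigma_iterate, H.res_sigma_iterate, pow_mul, pow_mul, ← hQ] at h1
    exact Fin.ext (Nat.pow_right_injective hQ1 (hζ.pow_inj (hlt l) (hlt m) h1))
  refine Matrix.eq_zero_of_mulVec_eq_zero hV (funext fun l => ?_)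
  have h1 := congrArg σ^[N * l] h
  rw [iterate_map_zero] at h1
  rw [Pi.zero_apply, ← h1, Matrix.mulVec, dotProduct]
  have hs : ∀ (n : ℕ) (f : Fin d → L), σ^[n] (∑ i, f i) = ∑ i, σ^[n] (f i) := fun n f => by
    rw [← RingHom.coe_pow, map_sum]
  rw [hs]
  refine Finset.sum_congr rfl fun i _ => ?_
  rw [iterate_map_mul, hfix, iterate_map_pow, mul_comm]
  rfl

/-- A subspace that is spanned by vectors whose coordinates are fixed by `σ ^ N`. -/
def IsRational {ι : Type*} (b : Module.Basis ι L D) (σ : L →+* L) (N : ℕ)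
    (W : Submodule L D) : Prop :=
  ∃ G : Set D, (∀ g ∈ G, ∀ i, σ^[N] (b.repr g i) = b.repr g i) ∧ W = Submodule.span L G

/-- Let `K` be the field fixed by `σ^N`. The coordinate vectors of generators of a proper rational
subspace span a proper `K`-subspace, so a nonzero `K`-linear form `c` kills them, and hence kills
`W`. The hypothesis forbids `c` from killing `v`. Since it does not mention `W`, one vector avoids
all proper rational subspaces simultaneously. -/
theorem not_mem_of_isRational {ι : Type*} [Fintype ι] (b : Module.Basis ι L D) {N : ℕ}
    {W : Submodule L D} (hW : IsRational b σ N W) (htop : W ≠ ⊤) {v : D}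
    (hv : ∀ c : ι → L, (∀ i, σ^[N] (c i) = c i) → ∑ i, c i * b.repr v i = 0 → c = 0) :
    v ∉ W := by
  classical
  obtain ⟨G, hG, rfl⟩ := hW
  let K : Subfield L := RingHom.eqLocusField (σ ^ N) (RingHom.id L)
  have hK : ∀ x : L, x ∈ K ↔ σ^[N] x = x := fun x => by
    rw [← RingHom.coe_pow]; rfl
  let GK : Submodule K (ι → K) := Submodule.span K {c | ∃ g ∈ G, ∀ i, (c i : L) = b.repr g i}
  have hGK : GK < ⊤ := by
    refine lt_top_iff_ne_top.2 fun h => htop (eq_top_iff.2 ?_)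
    have key : ∀ c ∈ GK, ∑ i, (c i : L) • b i ∈ Submodule.span L G := by
      intro c hc
      refine Submodule.span_induction (fun c hc => ?_) (by simp) (fun x y _ _ hx hy => ?_)
        (fun a x _ hx => ?_) hc
      · obtain ⟨g, hg, h⟩ := hc
        simp only [h, b.sum_repr]
        exact Submodule.subset_span hg
      · simpa [add_smul, Finset.sum_add_distrib] using add_mem hx hy
      · have := Submodule.smul_mem _ (a : L) hx
        simpa [Finset.smul_sum, mul_smul] using this
    rw [← b.span_eq, Submodule.span_le]
    rintro _ ⟨i, rfl⟩
    have := key (Pi.single i 1) (h ▸ Submodule.mem_top)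
    rw [Finset.sum_eq_single i (fun j _ hj => by simp [hj]) (by simp)] at this
    simpa using this
  obtain ⟨f, hf0, hf⟩ := Submodule.exists_le_ker_of_lt_top GK hGK
  let c : ι → K := fun i => f (Pi.single i 1)
  have hfc : ∀ x : ι → K, f x = ∑ i, x i * c i := fun x => by
    conv_lhs => rw [← Finset.univ_sum_single x]
    rw [map_sum]
    refine Finset.sum_congr rfl fun i _ => ?_
    have : Pi.single i (x i) = x i • (Pi.single i 1 : ι → K) := by
      rw [← Pi.single_smul, smul_eq_mul, mul_one]
    rw [this, map_smul, smul_eq_mul]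
  intro hvG
  have hz : ∑ i, (c i : L) * b.repr v i = 0 := by
    refine Submodule.span_induction (fun g hg => ?_) (by simp) (fun x y _ _ hx hy => ?_)
      (fun a x _ hx => ?_) hvG
    · have h1 := hf (Submodule.subset_span ⟨g, hg, fun i => rfl⟩ :
        (fun i => (⟨b.repr g i, (hK _).2 (hG g hg i)⟩ : K)) ∈ GK)
      rw [LinearMap.mem_ker, hfc] at h1
      have h2 := congrArg (Subtype.val) h1
      push_cast at h2
      rw [← h2]
      exact Finset.sum_congr rfl fun i _ => mul_comm _ _
    · simp [mul_add, Finset.sum_add_distrib, hx, hy]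
    · simp only [map_smul, Finsupp.smul_apply, smul_eq_mul, mul_left_comm _ a, ← Finset.mul_sum,
        hx, mul_zero]
  have hc0 := hv (fun i => c i) (fun i => (hK _).1 (c i).2) hz
  refine hf0 (LinearMap.ext fun x => ?_)
  have : ∀ i, c i = 0 := fun i => Subtype.ext (congrFun hc0 i)
  simp [hfc, this]

/-- A flag in general position with respect to all rational subspaces. -/
theorem exists_generic_sequence [IsAlgClosed k] [FiniteDimensional L D]
    (H : FrobRing O res π σ q) {ι : Type*} [Fintype ι] (b : Module.Basis ι L D) {N : ℕ}
    (hN : 0 < N) (n : ℕ) : ∃ v : ℕ → D, ∀ W : Submodule L D, IsRational b σ N W → ∀ r ≤ n,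
      Module.finrank L ↥(W ⊔ Submodule.span L (v '' Set.Iio r)) =
        min (Module.finrank L D) (Module.finrank L W + r) := by
  classical
  -- The induction also keeps an `M` such that `σ^M` fixes the coordinates of all vectors chosen so
  -- far. Adding these vectors to an `N`-rational subspace gives an `M`-rational one, to which
  -- `not_mem_of_isRational` applies.
  suffices h : ∃ (M : ℕ) (v : ℕ → D), 0 < M ∧ N ∣ M ∧
      (∀ j < n, ∀ i, σ^[M] (b.repr (v j) i) = b.repr (v j) i) ∧
      ∀ W : Submodule L D, IsRational b σ N W → ∀ r ≤ n,
      Module.finrank L ↥(W ⊔ Submodule.span L (v '' Set.Iio r)) =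
        min (Module.finrank L D) (Module.finrank L W + r) by
    obtain ⟨_, v, _, _, _, h⟩ := h
    exact ⟨v, h⟩
  induction n with
  | zero =>
    refine ⟨N, fun _ => 0, hN, dvd_rfl, by simp, fun W _ r hr => ?_⟩
    obtain rfl : r = 0 := by omega
    have : W ⊔ Submodule.span L ((fun _ => 0 : ℕ → D) '' Set.Iio 0) = W := by simp
    rw [this, add_zero]
    exact (min_eq_right (Submodule.finrank_le W)).symm
  | succ n ih =>
    obtain ⟨M, v, hM, hNM, hv, hW⟩ := ih
    let e := Fintype.equivFin ι
    -- The new vector has coordinates independent over the field fixed by `σ^M`, and they are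
    -- themselves fixed by a further power `σ^M'`, so the induction can go on.
    obtain ⟨M', x, hM', hMM', hx, hind⟩ := H.exists_independent_fixed hM (Fintype.card ι)
    let v₀ : D := b.equivFun.symm (fun i => x (e i))
    have hv₀ : ∀ i, b.repr v₀ i = x (e i) := fun i => by
      rw [← b.equivFun_apply, LinearEquiv.apply_symm_apply]
    have hfix : ∀ {a c : ℕ} {y : L}, a ∣ c → σ^[a] y = y → σ^[c] y = y := by
      rintro a _ y ⟨c, rfl⟩ h
      rw [Function.iterate_mul]
      exact Function.iterate_fixed h c
    have hne : ∀ j < n, Function.update v n v₀ j = v j := fun j hj =>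
      Function.update_of_ne (by omega) _ _
    have himg : ∀ r ≤ n, Function.update v n v₀ '' Set.Iio r = v '' Set.Iio r := fun r hr =>
      Set.image_congr fun j hj => hne j (lt_of_lt_of_le hj hr)
    refine ⟨M', Function.update v n v₀, hM', hNM.trans hMM', fun j hj i => ?_, fun W hWr r hr => ?_⟩
    · rcases Nat.lt_succ_iff_lt_or_eq.1 hj with h | rfl
      · rw [hne j h]; exact hfix hMM' (hv j h i)
      · rw [Function.update_self, hv₀]; exact hx _
    · rcases Nat.lt_succ_iff_lt_or_eq.1 (Nat.lt_succ_of_le hr) with h | rfl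
      · rw [himg r (by omega)]
        exact hW W hWr r (by omega)
      have h1 := hW W hWr n le_rfl
      have h2 : Function.update v n v₀ '' Set.Iio (n + 1) = insert v₀ (v '' Set.Iio n) := by
        have : Set.Iio (n + 1) = insert n (Set.Iio n) := by ext; simp
        rw [this, Set.image_insert_eq, Function.update_self, himg n le_rfl]
      rw [h2, Submodule.span_insert, sup_comm (Submodule.span L {v₀}), ← sup_assoc]
      set U := W ⊔ Submodule.span L (v '' Set.Iio n) with hU
      by_cases htop : U = ⊤
      · rw [htop] at h1 ⊢
        rw [top_sup_eq]
        rw [finrank_top] at h1 ⊢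
        omega
      · have hUr : IsRational b σ M U := by
          obtain ⟨G, hG, rfl⟩ := hWr
          refine ⟨G ∪ v '' Set.Iio n, ?_, by rw [hU, Submodule.span_union]⟩
          rintro g (hg | ⟨j, hj, rfl⟩) i
          · exact hfix hNM (hG g hg i)
          · exact hv j hj i
        have hnot : v₀ ∉ U := not_mem_of_isRational b hUr htop fun c hc h0 => by
          have := hind (fun j => c (e.symm j)) (fun j => hc _) (by
            rw [← h0, ← e.sum_comp]
            simp [hv₀])
          funext i
          have := congrFun this (e i)
          simpa using this
        have h3 : Module.finrank L U < Module.finrank L D := Submodule.finrank_lt htop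
        rw [Submodule.finrank_sup_span_singleton hnot]
        omega

end FrobRing

/-! ### Stable subspaces in terms of slope bases -/

section
variable {L k D : Type*} [Field L] [Field k] {O : Subring L} {res : O →+* k}
    {π : L} {σ : L →+* L} {q : ℕ} [AddCommGroup D] [Module L D] {φ : D →ₛₗ[σ] D}

/-- The restriction of a semilinear map to a stable subspace. -/
def restrictₛₗ (φ : D →ₛₗ[σ] D) (W : Submodule L D) (hW : ∀ w ∈ W, φ w ∈ W) : W →ₛₗ[σ] W where
  toFun x := ⟨φ x, hW x x.2⟩
  map_add' x y := Subtype.ext (map_add φ (x : D) y)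
  map_smul' c x := Subtype.ext (map_smulₛₗ φ c (x : D))

theorem coe_iterate_restrict {W : Submodule L D} (ψ : W →ₛₗ[σ] W) (h : ∀ x, (ψ x : D) = φ x)
    (n : ℕ) (x : W) : (ψ^[n] x : D) = φ^[n] x := by
  induction n with
  | zero => rfl
  | succ n ih => rw [Function.iterate_succ_apply', Function.iterate_succ_apply', h, ih]

theorem isSlopeVector_restrict_iff {W : Submodule L D} (ψ : W →ₛₗ[σ] W) (h : ∀ x, (ψ x : D) = φ x)
    {α : ℚ} {x : W} : IsSlopeVector ψ π α x ↔ IsSlopeVector φ π α (x : D) := by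
  unfold IsSlopeVector
  rw [Subtype.ext_iff, coe_iterate_restrict ψ h, Submodule.coe_smul]

theorem finrank_eq_sub_of_eq_span {ι : Type*} [Fintype ι] (b : Module.Basis ι L D) (S : Finset ι) :
    Module.finrank L (Submodule.span L (b '' S)) = S.card := by
  classical
  have : b '' S = Set.range fun i : S => b i := by
    ext; simp
  rw [this]
  change Module.finrank L (Submodule.span L (Set.range (b ∘ Subtype.val))) = _
  rw [finrank_span_eq_card (b.linearIndependent.comp _ Subtype.val_injective)]
  simp

end

namespace FrobRing
variable {L k D : Type*} [Field L] [Field k] {O : Subring L} {res : O →+* k}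
    {π : L} {σ : L →+* L} {q : ℕ} [AddCommGroup D] [Module L D] {φ : D →ₛₗ[σ] D}

/-- For every stable subspace `W` there is a basis of slope vectors, part of which spans `W`. -/
theorem exists_adapted_basis [IsAlgClosed k] [FiniteDimensional L D] (H : FrobRing O res π σ q)
    (hφ : Function.Injective φ) (W : Submodule L D) (hW : ∀ w ∈ W, φ w ∈ W) :
    ∃ (T : Set D) (_ : Fintype T) (b : Module.Basis T L D) (β : T → ℚ) (S : Finset T),
      (∀ i, IsSlopeVector φ π (β i) (b i)) ∧ W = Submodule.span L (b '' S) := by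
  classical
  have hd := H.span_isSlopeVector_eq_top hφ
  -- Dieudonné–Manin applied to `W` itself: a basis of slope vectors of `W` exists and extends to
  -- one of `D` inside the set of all slope vectors.
  have hdW := H.span_isSlopeVector_eq_top (φ := restrictₛₗ φ W hW)
    (fun x y h => Subtype.ext (hφ (congrArg Subtype.val h)))
  have hWs : W = Submodule.span L {v | v ∈ W ∧ ∃ α, IsSlopeVector φ π α v} := by
    have := congrArg (Submodule.map W.subtype) hdW
    rw [Submodule.map_span, Submodule.map_top, Submodule.range_subtype] at this
    refine this.symm.trans (congrArg (Submodule.span L) ?_)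
    ext v
    constructor
    · rintro ⟨x, ⟨α, hx⟩, rfl⟩
      exact ⟨x.2, α, (isSlopeVector_restrict_iff _ fun _ => rfl).1 hx⟩
    · rintro ⟨hv, α, hα⟩
      exact ⟨⟨v, hv⟩, ⟨α, (isSlopeVector_restrict_iff _ fun _ => rfl).2 hα⟩, rfl⟩
  obtain ⟨S, hS1, hS2, hS3⟩ := exists_linearIndependent L {v | v ∈ W ∧ ∃ α, IsSlopeVector φ π α v}
  obtain ⟨T, hT1, hST, hT2, hT3⟩ := exists_linearIndepOn_id_extension hS3
    (t := {v | ∃ α, IsSlopeVector φ π α v}) fun v hv => (hS1 hv).2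
  have htop : ⊤ ≤ Submodule.span L (Set.range ((↑) : T → D)) := by
    rw [Subtype.range_coe, ← hd, Submodule.span_le]
    exact hT2
  let b : Module.Basis T L D := Module.Basis.mk hT3 htop
  have hb : ∀ i, b i = i := fun i => Module.Basis.mk_apply _ _ i
  have : Finite T := Module.Finite.finite_basis b
  let inst : Fintype T := Fintype.ofFinite T
  choose β hβ using fun i : T => hT1 i.2
  refine ⟨T, inst, b, β, Finset.univ.filter fun i : T => (i : D) ∈ S,
    fun i => by rw [hb]; exact hβ i, ?_⟩
  rw [hWs, ← hS2]
  congr 1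
  ext v
  simp only [Set.mem_image, Finset.coe_filter, Finset.mem_univ, true_and, Set.mem_ofPred_eq, hb]
  exact ⟨fun hv => ⟨⟨v, hST hv⟩, hv, rfl⟩, by rintro ⟨i, hi, rfl⟩; exact hi⟩

theorem mem_span_image_iff {ι : Type*} [Fintype ι] (b : Module.Basis ι L D) (S : Finset ι) (v : D) :
    v ∈ Submodule.span L (b '' S) ↔ ∀ i ∉ S, b.repr v i = 0 := by
  rw [b.mem_span_image]
  constructor
  · intro h i hi
    by_contra hne
    exact hi (h (Finsupp.mem_support_iff.2 hne))
  · intro h i hi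
    by_contra hne
    exact Finsupp.mem_support_iff.1 hi (h i hne)

theorem repr_of_isSlopeVector' (H : FrobRing O res π σ q) {ι : Type*} [Fintype ι]
    (b : Module.Basis ι L D) {β : ι → ℚ} (hb : ∀ i, IsSlopeVector φ π (β i) (b i)) {α : ℚ} {v : D}
    (hv : IsSlopeVector φ π α v) {i : ι} (hi : b.repr v i ≠ 0) : β i = α := by
  have hN : α.den * ∏ i, (β i).den ≠ 0 :=
    mul_ne_zero α.den_nz (Finset.prod_ne_zero_iff.2 fun i _ => (β i).den_nz)
  exact (H.repr_of_isSlopeVector b hb hN (fun i => (Finset.dvd_prod_of_mem (fun i => (β i).den)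
    (Finset.mem_univ i)).trans (dvd_mul_left _ _)) (dvd_mul_right _ _) hv hi).1

/-- The span of the slope vectors in a span of basis vectors. -/
theorem span_isSlopeVector_inter (H : FrobRing O res π σ q) {ι : Type*} [Fintype ι]
    (b : Module.Basis ι L D) {β : ι → ℚ} (hb : ∀ i, IsSlopeVector φ π (β i) (b i)) (S : Finset ι)
    (α : ℚ) : Submodule.span L {v | v ∈ Submodule.span L (b '' S) ∧ IsSlopeVector φ π α v} =
      Submodule.span L (b '' ↑(S.filter fun i => β i = α)) := by
  apply le_antisymm <;> rw [Submodule.span_le]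
  · rintro v ⟨hvS, hv⟩
    rw [mem_span_image_iff] at hvS
    rw [SetLike.mem_coe, mem_span_image_iff]
    intro i hi
    by_contra hne
    exact hi (Finset.mem_filter.2 ⟨by_contra fun h => hne (hvS i h),
      H.repr_of_isSlopeVector' b hb hv hne⟩)
  · rintro _ ⟨i, hi, rfl⟩
    obtain ⟨hiS, rfl⟩ := Finset.mem_filter.1 hi
    exact Submodule.subset_span ⟨Submodule.subset_span ⟨i, hiS, rfl⟩, hb i⟩

/-- The span of the basis vectors with slope in a given set is stable, and `φ` is bijective on it. -/
theorem bijOn_span_image (H : FrobRing O res π σ q) (hφ : Function.Injective φ) {ι : Type*}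
    [Fintype ι] (b : Module.Basis ι L D) {β : ι → ℚ} (hb : ∀ i, IsSlopeVector φ π (β i) (b i))
    (P : ℚ → Prop) [DecidablePred P] :
    Set.BijOn φ (Submodule.span L (b '' ↑(Finset.univ.filter fun i => P (β i))))
      (Submodule.span L (b '' ↑(Finset.univ.filter fun i => P (β i)))) := by
  have h0 := H.pi_ne_zero
  set M := Submodule.span L (b '' ↑(Finset.univ.filter fun i => P (β i)))
  have hslope : ∀ i, P (β i) → ∀ v, IsSlopeVector φ π (β i) v → v ∈ M := by
    intro i hi v hv
    rw [mem_span_image_iff]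
    intro j hj
    by_contra hne
    refine hj (Finset.mem_filter.2 ⟨Finset.mem_univ _, ?_⟩)
    rwa [H.repr_of_isSlopeVector' b hb hv hne]
  refine ⟨fun m hm => ?_, hφ.injOn, fun m hm => ?_⟩
  · refine Submodule.span_induction (fun v hv => ?_) ?_ (fun x y _ _ hx hy => ?_)
      (fun c x _ hx => ?_) hm
    · obtain ⟨i, hi, rfl⟩ := hv
      exact hslope i (Finset.mem_filter.1 hi).2 _ ((hb i).map H.sigma_pi)
    · rw [map_zero]; exact zero_mem _
    · rw [map_add]; exact add_mem hx hy
    · rw [map_smulₛₗ]; exact M.smul_mem _ hx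
  · refine Submodule.span_induction (fun v hv => ?_) ?_ (fun x y _ _ hx hy => ?_)
      (fun c x _ hx => ?_) hm
    · obtain ⟨i, hi, rfl⟩ := hv
      refine ⟨π ^ (-(β i).num) • φ^[(β i).den - 1] (b i), M.smul_mem _ ?_, ?_⟩
      · refine hslope i (Finset.mem_filter.1 hi).2 _ ?_
        induction (β i).den - 1 with
        | zero => exact hb i
        | succ n ih => rw [Function.iterate_succ_apply']; exact ih.map H.sigma_pi
      · rw [map_smulₛₗ, ← Function.iterate_succ_apply' φ, H.sigma_zpow, Nat.succ_eq_add_one,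
          Nat.sub_add_cancel (β i).den_pos, hb i, ← mul_smul, ← zpow_add₀ h0]
        simp
    · exact ⟨0, zero_mem _, map_zero _⟩
    · obtain ⟨a, ha, rfl⟩ := hx
      obtain ⟨b, hb, rfl⟩ := hy
      exact ⟨a + b, add_mem ha hb, map_add _ _ _⟩
    · obtain ⟨a, ha, rfl⟩ := hx
      obtain ⟨c', rfl⟩ := H.sigma_bij.2 c
      exact ⟨c' • a, M.smul_mem _ ha, map_smulₛₗ _ _ _⟩

/-- Stable subspaces are rational with respect to a basis of slope vectors. -/
theorem exists_isRational [IsAlgClosed k] [FiniteDimensional L D] (H : FrobRing O res π σ q)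
    (hφ : Function.Injective φ) {ι : Type*} [Fintype ι] (b : Module.Basis ι L D) {β : ι → ℚ}
    (hb : ∀ i, IsSlopeVector φ π (β i) (b i)) :
    ∃ N > 0, ∀ W : Submodule L D, (∀ w ∈ W, φ w ∈ W) → IsRational b σ N W := by
  classical
  have hN : ∏ i, (β i).den ≠ 0 := Finset.prod_ne_zero_iff.2 fun i _ => (β i).den_nz
  -- One `N` suffices for all `W`: a slope vector with a nonzero coordinate at `i` has slope `β i`,
  -- so its denominator divides this product.
  refine ⟨∏ i, (β i).den, Nat.pos_of_ne_zero hN, fun W hW => ?_⟩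
  obtain ⟨T, inst, bT, γ, S, hbT, hWS⟩ := H.exists_adapted_basis hφ W hW
  refine ⟨_, ?_, hWS⟩
  rintro _ ⟨j, hj, rfl⟩ i
  by_cases h : b.repr (bT j) i = 0
  · rw [h, iterate_map_zero]
  have hd : ∀ i, (β i).den ∣ ∏ i, (β i).den := fun i =>
    Finset.dvd_prod_of_mem (fun i => (β i).den) (Finset.mem_univ i)
  have h1 := H.repr_of_isSlopeVector' b hb (hbT j) h
  exact (H.repr_of_isSlopeVector b hb hN hd (h1 ▸ hd i) (hbT j) h).2

end FrobRing

/-! ### Completeness with respect to `p` -/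

/-- The abelian group `V` is `p`-adically separated and complete. -/
structure PComplete (p : ℕ) (V : Type*) [AddCommGroup V] : Prop where
  haus : ∀ x : V, (∀ n : ℕ, ∃ y : V, x = p ^ n • y) → x = 0
  complete : ∀ f : ℕ → V, ∃ x, ∀ n : ℕ, ∃ y : V,
    x = ∑ m ∈ Finset.range n, p ^ m • f m + p ^ n • y

theorem PComplete.of_isAdicComplete (p : ℕ) (A : Type*) [CommRing A]
    [IsAdicComplete (Ideal.span {(p : A)}) A] : PComplete p A where
  haus x hx := IsHausdorff.haus (I := Ideal.span {(p : A)}) inferInstance x fun n => by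
    obtain ⟨y, rfl⟩ := hx n
    rw [SModEq.zero, smul_eq_mul, Ideal.mul_top, Ideal.span_singleton_pow,
      Ideal.mem_span_singleton, nsmul_eq_mul]
    push_cast
    exact dvd_mul_right _ _
  complete f := by
    obtain ⟨x, hx⟩ := IsPrecomplete.prec (I := Ideal.span {(p : A)}) inferInstance
      (f := fun n => ∑ m ∈ Finset.range n, p ^ m • f m) (fun {m n} hmn => by
        rw [SModEq.sub_mem, smul_eq_mul, Ideal.mul_top, Ideal.span_singleton_pow,
          Ideal.mem_span_singleton, ← Finset.sum_range_add_sum_Ico _ hmn, sub_add_cancel_left,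
          dvd_neg]
        refine Finset.dvd_sum fun i hi => ?_
        rw [nsmul_eq_mul]
        push_cast
        exact (pow_dvd_pow _ (Finset.mem_Ico.1 hi).1).mul_right _)
    refine ⟨x, fun n => ?_⟩
    have := (hx n).symm
    rw [SModEq.sub_mem, smul_eq_mul, Ideal.mul_top, Ideal.span_singleton_pow,
      Ideal.mem_span_singleton] at this
    obtain ⟨y, hy⟩ := this
    refine ⟨y, ?_⟩
    rw [nsmul_eq_mul (p ^ n) y]
    push_cast
    rw [← hy]; ring

theorem PComplete.pi {p : ℕ} {V : Type*} [AddCommGroup V] (h : PComplete p V) (ι : Type*) :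
    PComplete p (ι → V) where
  haus x hx := funext fun i => h.haus _ fun n => by
    obtain ⟨y, rfl⟩ := hx n
    exact ⟨y i, rfl⟩
  complete f := by
    choose x hx using fun i => h.complete fun m => f m i
    refine ⟨x, fun n => ?_⟩
    choose y hy using fun i => hx i n
    exact ⟨y, funext fun i => by simp [← hy]⟩

theorem PComplete.of_equiv {p : ℕ} {V W : Type*} [AddCommGroup V] [AddCommGroup W]
    (h : PComplete p V) (e : W ≃+ V) : PComplete p W where
  haus x hx := e.injective (by
    rw [map_zero]
    refine h.haus _ fun n => ?_
    obtain ⟨y, rfl⟩ := hx n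
    exact ⟨e y, map_nsmul e _ _⟩)
  complete f := by
    obtain ⟨x, hx⟩ := h.complete fun m => e (f m)
    refine ⟨e.symm x, fun n => ?_⟩
    obtain ⟨y, hy⟩ := hx n
    exact ⟨e.symm y, by rw [hy]; simp [map_sum, map_nsmul]⟩

/-- A homomorphism from a `p`-complete group to a `p`-separated one that is surjective modulo `p` is
surjective. -/
theorem PComplete.surjective {p : ℕ} {V W : Type*} [AddCommGroup V] [AddCommGroup W]
    (hV : PComplete p V) (hW : PComplete p W) (f : V →+ W) (h : ∀ y, ∃ a b, y = f a + p • b) :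
    Function.Surjective f := by
  intro y
  choose a b hab using h
  have hs : ∀ n, y = f (∑ m ∈ Finset.range n, p ^ m • a (b^[m] y)) + p ^ n • b^[n] y := by
    intro n
    induction n with
    | zero => simp
    | succ n ih =>
      rw [Finset.sum_range_succ, map_add, map_nsmul, Function.iterate_succ_apply']
      conv_lhs => rw [ih, hab (b^[n] y)]
      rw [smul_add, smul_smul, pow_succ]
      abel
  obtain ⟨x, hx⟩ := hV.complete fun m => a (b^[m] y)
  refine ⟨x, sub_eq_zero.1 (hW.haus _ fun n => ?_)⟩
  obtain ⟨z, hz⟩ := hx n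
  refine ⟨f z - b^[n] y, ?_⟩
  conv_lhs => rw [hs n, hz]
  rw [map_add, map_nsmul, smul_sub]
  abel

/-- In a `p`-complete ring, completeness with respect to an element `t` that divides `p` and has a
power divisible by `p`. -/
theorem PComplete.exists_sum_pow {p : ℕ} {A : Type*} [CommRing A] (h : PComplete p A) {t : A}
    {M : ℕ} (hM : 0 < M) (h1 : t ∣ p) (h2 : (p : A) ∣ t ^ M) :
    (∀ x : A, (∀ n : ℕ, ∃ y, x = t ^ n * y) → x = 0) ∧
    ∀ f : ℕ → A, ∃ x, ∀ n, ∃ y, x = ∑ m ∈ Finset.range n, t ^ m * f m + t ^ n * y := by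
  have hpM : ∀ n : ℕ, (p : A) ^ n ∣ t ^ (M * n) := fun n => by
    rw [pow_mul]; exact pow_dvd_pow_of_dvd h2 n
  refine ⟨fun x hx => h.haus x fun n => ?_, fun f => ?_⟩
  · obtain ⟨y, rfl⟩ := hx (M * n)
    obtain ⟨c, hc⟩ := hpM n
    exact ⟨c * y, by rw [hc, nsmul_eq_mul]; push_cast; ring⟩
  -- The terms are grouped in blocks of length `M`; the `n`-th block is divisible by `t^(M n)`,
  -- hence by `p^n`, and the series becomes `p`-adic.
  · have hg : ∀ n, ∃ g : A, p ^ n • g = ∑ m ∈ Finset.Ico (M * n) (M * (n + 1)), t ^ m * f m := by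
      intro n
      have : (p : A) ^ n ∣ ∑ m ∈ Finset.Ico (M * n) (M * (n + 1)), t ^ m * f m :=
        Finset.dvd_sum fun m hm => ((hpM n).trans (pow_dvd_pow _ (Finset.mem_Ico.1 hm).1)).mul_right _
      obtain ⟨g, hg⟩ := this
      exact ⟨g, by rw [hg, nsmul_eq_mul]; push_cast; ring⟩
    choose g hg using hg
    have hsum : ∀ n, ∑ m ∈ Finset.range n, p ^ m • g m =
        ∑ m ∈ Finset.range (M * n), t ^ m * f m := by
      intro n
      induction n with
      | zero => simp
      | succ n ih =>
        rw [Finset.sum_range_succ, ih, hg, Finset.sum_range_add_sum_Ico]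
        exact Nat.mul_le_mul_left _ n.le_succ
    obtain ⟨x, hx⟩ := h.complete g
    refine ⟨x, fun n => ?_⟩
    obtain ⟨y, hy⟩ := hx n
    have hd1 : t ^ n ∣ p ^ n • y := by
      rw [nsmul_eq_mul]; push_cast
      exact (pow_dvd_pow_of_dvd h1 n).mul_right _
    have hle : n ≤ M * n := Nat.le_mul_of_pos_left n hM
    have hd2 : t ^ n ∣ ∑ m ∈ Finset.Ico n (M * n), t ^ m * f m :=
      Finset.dvd_sum fun m hm => (pow_dvd_pow _ (Finset.mem_Ico.1 hm).1).mul_right _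
    obtain ⟨z, hz⟩ := dvd_add hd2 hd1
    exact ⟨z, by rw [hy, hsum, ← Finset.sum_range_add_sum_Ico _ hle, add_assoc, hz]⟩

/-! ### The ring `L = F ⊗ W(k)` satisfies the axioms -/

section Field
variable (p : ℕ) [Fact p.Prime] (F : Type*) [Field F] [Algebra ℚ_[p] F] [FiniteDimensional ℚ_[p] F]

/-- `O_F` as a `W(k_F)`-algebra. -/
instance algebraWittInteger : Algebra (WittVector p (ResField p F)) (integerRing p F) :=
  (wittToInteger p F).toAlgebra

instance : IsScalarTower (WittVector p (ResField p F)) (integerRing p F) F :=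
  IsScalarTower.of_algebraMap_eq fun _ => rfl

/-- Representatives of the finite ring `O_F / p` generate modulo `p`, and `p`-adic completeness of
both sides lifts this to generation. -/
instance finite_wittInteger : Module.Finite (WittVector p (ResField p F)) (integerRing p F) := by
  have := (inferInstance : Finite (integerRing p F ⧸ Ideal.span {(p : integerRing p F)}))
  let := Fintype.ofFinite (integerRing p F ⧸ Ideal.span {(p : integerRing p F)})
  let Q := integerRing p F ⧸ Ideal.span {(p : integerRing p F)}
  let f : (Q → WittVector p (ResField p F)) →ₗ[WittVector p (ResField p F)] integerRing p F :=
    Fintype.linearCombination _ fun x : Q => (Quotient.out x : integerRing p F)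
  refine Module.Finite.of_surjective f
    (PComplete.surjective (p := p) ((PComplete.of_isAdicComplete p _).pi _)
      (PComplete.of_isAdicComplete p _) f.toAddMonoidHom fun y => ?_)
  classical
  let x : Q := Ideal.Quotient.mk _ y
  have hx : Ideal.Quotient.mk (Ideal.span {(p : integerRing p F)}) (Quotient.out x) = x :=
    Quotient.out_eq x
  have hy : y - Quotient.out x ∈ Ideal.span {(p : integerRing p F)} := by
    rw [← Ideal.Quotient.eq, hx]
  obtain ⟨b, hb⟩ := Ideal.mem_span_singleton.1 hy
  refine ⟨Pi.single x 1, b, ?_⟩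
  have : f (Pi.single x 1) = Quotient.out x := by
    simp [f]
  change y = f (Pi.single x 1) + p • b
  rw [this, nsmul_eq_mul, ← hb]; ring

end Field

theorem charP_of_algebra (p : ℕ) [Fact p.Prime] (F : Type*) [Field F] [Algebra ℚ_[p] F]
    [FiniteDimensional ℚ_[p] F] (k : Type*) [Field k] [Algebra (ResField p F) k] : CharP k p :=
  charP_of_injective_algebraMap (algebraMap (ResField p F) k).injective p

section Field
variable (p : ℕ) [Fact p.Prime] (F : Type*) [Field F] [Algebra ℚ_[p] F] [FiniteDimensional ℚ_[p] F]

theorem integerRing_natCast_p_ne_zero : (p : integerRing p F) ≠ 0 := fun h =>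
  p_ne_zero p F (by simpa using congrArg Subtype.val h)

/-- A nonzero Witt vector over a perfect field is a power of `p` times a unit, and `p` is nonzero in
the domain `O_F`. -/
theorem wittToInteger_injective : Function.Injective (wittToInteger p F) := by
  rw [injective_iff_map_eq_zero]
  intro w hw
  by_contra hne
  obtain ⟨m, b, rfl⟩ := WittVector.exists_eq_pow_p_mul' w hne
  rw [map_mul, map_pow, map_natCast] at hw
  exact mul_ne_zero (pow_ne_zero m (integerRing_natCast_p_ne_zero p F))
    (b.isUnit.map (wittToInteger p F)).ne_zero hw

instance : FaithfulSMul (WittVector p (ResField p F)) (integerRing p F) :=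
  (faithfulSMul_iff_algebraMap_injective _ _).2 (wittToInteger_injective p F)

variable {p F} in
-- Only the valuation ring property is used: if `x` divides the irreducible `π` and is not a unit,
-- it is an associate of `π`.
theorem dvd_of_residue_eq_zero {π x : integerRing p F} (hπ : Irreducible π)
    (hx : IsLocalRing.residue _ x = 0) : π ∣ x := by
  rcases ValuationRing.dvd_total π x with h | ⟨y, rfl⟩
  · exact h
  · rw [IsLocalRing.residue_eq_zero_iff] at hx
    rcases hπ.isUnit_or_isUnit rfl with h | ⟨u, rfl⟩
    · exact absurd h hx
    · exact ⟨(u⁻¹ : (integerRing p F)ˣ), by simp [mul_assoc]⟩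

variable {p F} in
theorem residue_uniformizer {π : integerRing p F} (hπ : Irreducible π) :
    IsLocalRing.residue _ π = 0 := by
  rw [IsLocalRing.residue_eq_zero_iff]
  exact hπ.not_isUnit

variable (k : Type*) [Field k] [Algebra (ResField p F) k]

/-- The residue field `k` as a `W(k_F)`-algebra. -/
abbrev algebraWittResidue : Algebra (WittVector p (ResField p F)) k :=
  ((algebraMap (ResField p F) k).comp WittVector.constantCoeff).toAlgebra

/-- The ring `O_F ⊗ W(k)`. -/
abbrev IntL : Type _ := integerRing p F ⊗[WittVector p (ResField p F)] WittVector p k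

/-- The inclusion of `O_F ⊗ W(k)` in `F ⊗ W(k)`. -/
def intLToL : IntL p F k →ₐ[WittVector p (ResField p F)] L p F k :=
  Algebra.TensorProduct.map (IsScalarTower.toAlgHom (WittVector p (ResField p F)) _ F)
    (AlgHom.id _ _)

/-- The reduction map `O_F ⊗ W(k) → k`. -/
def intLRes : IntL p F k →+* k :=
  letI := algebraWittResidue p F k
  (Algebra.TensorProduct.productMap (R := WittVector p (ResField p F))
    { (algebraMap (ResField p F) k).comp (IsLocalRing.residue (integerRing p F)) with
      commutes' := fun w => congrArg (algebraMap (ResField p F) k) (residue_wittToInteger p F w) }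
    { (WittVector.constantCoeff : WittVector p k →+* k) with
      commutes' := fun _ => rfl }).toRingHom

theorem intLRes_tmul (x : integerRing p F) (w : WittVector p k) :
    intLRes p F k (x ⊗ₜ w) = algebraMap (ResField p F) k (IsLocalRing.residue _ x) * w.coeff 0 :=
  rfl

/-- The endomorphism `id ⊗ σ₀` of `O_F ⊗ W(k)`. -/
def intLSigma : IntL p F k →+* IntL p F k :=
  (Algebra.TensorProduct.map (AlgHom.id (WittVector p (ResField p F)) (integerRing p F))
    (sigma0 p F k)).toRingHom

theorem intLToL_sigma (z : IntL p F k) :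
    intLToL p F k (intLSigma p F k z) = sigma p F k (intLToL p F k z) := by
  induction z using TensorProduct.induction_on with
  | zero => simp
  | add x y hx hy => simp [hx, hy]
  | tmul x w => rfl

theorem intLRes_sigma (z : IntL p F k) :
    intLRes p F k (intLSigma p F k z) = intLRes p F k z ^ Nat.card (ResField p F) := by
  have := charP_of_algebra p F k
  let : Fintype (ResField p F) := Fintype.ofFinite _
  obtain ⟨f, -, hf⟩ := FiniteField.card (ResField p F) p
  rw [Nat.card_eq_fintype_card, hf]
  induction z using TensorProduct.induction_on with
  | zero => simp [(Fact.out : p.Prime).ne_zero]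
  | add x y hx hy => rw [map_add, map_add, map_add, hx, hy, add_pow_char_pow]
  | tmul x w =>
    change intLRes p F k (x ⊗ₜ sigma0 p F k w) = _
    rw [intLRes_tmul, intLRes_tmul, sigma0_coeff, Nat.card_eq_fintype_card, hf, mul_pow, ← map_pow,
      ← hf, FiniteField.pow_card]

variable {k} in
-- Total ramification: `W(k_F)` surjects onto the residue field of `O_F`, so `O_F = W(k_F) + π O_F`,
-- and the first summand can be moved across the tensor sign.
theorem exists_sub_tmul_mem {π : integerRing p F} (hπ : Irreducible π) (z : IntL p F k) :
    ∃ (w : WittVector p k) (y : IntL p F k), z = 1 ⊗ₜ w + (π ⊗ₜ 1) * y := by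
  induction z using TensorProduct.induction_on with
  | zero => exact ⟨0, 0, by simp⟩
  | add x y hx hy =>
    obtain ⟨w, a, rfl⟩ := hx
    obtain ⟨v, b, rfl⟩ := hy
    exact ⟨w + v, a + b, by rw [TensorProduct.tmul_add]; ring⟩
  | tmul x w =>
    obtain ⟨r, hr⟩ := WittVector.constantCoeff_surjective (R := ResField p F) p
      (IsLocalRing.residue _ x)
    obtain ⟨y, hy⟩ := dvd_of_residue_eq_zero hπ (x := x - wittToInteger p F r) (by
      rw [map_sub, residue_wittToInteger, sub_eq_zero, ← hr]; rfl)
    refine ⟨r • w, y ⊗ₜ w, ?_⟩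
    have h1 : x = r • 1 + π * y := by
      rw [← hy, Algebra.smul_def]
      change x = wittToInteger p F r * 1 + _
      ring
    rw [Algebra.TensorProduct.tmul_mul_tmul, one_mul, ← TensorProduct.smul_tmul,
      ← TensorProduct.add_tmul, ← h1]

variable [IsAlgClosed k]

/-- `W(k)` is torsion-free over the discrete valuation ring `W(k_F)`, hence flat. -/
theorem intLToL_injective : Function.Injective (intLToL p F k) := by
  have := charP_of_algebra p F k
  have : Fact p.Prime := inferInstance
  have : FaithfulSMul (WittVector p (ResField p F)) (WittVector p k) :=
    (faithfulSMul_iff_algebraMap_injective _ _).2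
      (WittVector.map_injective _ (algebraMap (ResField p F) k).injective)
  have : Module.IsTorsionFree (WittVector p (ResField p F)) (WittVector p k) :=
    .trans_faithfulSMul _ (WittVector p k) _
  exact Module.Flat.rTensor_preserves_injective_linearMap (M := WittVector p k)
    (IsScalarTower.toAlgHom (WittVector p (ResField p F)) (integerRing p F) F).toLinearMap
    Subtype.val_injective

/-- `O_F` is finite and torsion-free over `W(k_F)`, hence free, so the tensor product is a finite
power of `W(k)`. -/
theorem pComplete_intL : PComplete p (IntL p F k) := by
  have := charP_of_algebra p F k
  have : Module.IsTorsionFree (WittVector p (ResField p F)) (integerRing p F) :=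
    .trans_faithfulSMul _ (integerRing p F) _
  let b := Module.Free.chooseBasis (WittVector p (ResField p F)) (integerRing p F)
  let e := (TensorProduct.comm (WittVector p (ResField p F)) (integerRing p F) (WittVector p k)) ≪≫ₗ
    (LinearEquiv.lTensor (WittVector p k) b.equivFun) ≪≫ₗ
    (TensorProduct.piScalarRight (WittVector p (ResField p F)) (WittVector p (ResField p F))
      (WittVector p k) _)
  exact ((PComplete.of_isAdicComplete p (WittVector p k)).pi _).of_equiv e.toAddEquiv

variable {k} in
-- Modulo `π` an element comes from a Witt vector `w`. Vanishing residue means that `w` has zeroth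
-- coefficient `0`, so `p` divides `w`; and `π` divides `p`.
theorem intLRes_eq_zero_iff {π : integerRing p F} (hπ : Irreducible π) (z : IntL p F k) :
    intLRes p F k z = 0 ↔ ∃ y, z = (π ⊗ₜ 1) * y := by
  have := charP_of_algebra p F k
  have hπ0 : intLRes p F k (π ⊗ₜ 1) = 0 := by
    rw [intLRes_tmul, residue_uniformizer hπ]; simp
  constructor
  · intro hz
    obtain ⟨w, y, rfl⟩ := exists_sub_tmul_mem p F hπ z
    rw [map_add, map_mul, hπ0, zero_mul, add_zero, intLRes_tmul, map_one, map_one, one_mul] at hz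
    obtain ⟨v, rfl⟩ := Ideal.mem_span_singleton.1
      ((WittVector.mem_span_p_iff_coeff_zero_eq_zero w).2 hz)
    obtain ⟨c, hc⟩ := dvd_of_residue_eq_zero hπ (x := (p : integerRing p F))
      ((IsLocalRing.residue_eq_zero_iff _).2 (fact_not_isUnit_p p F).out)
    refine ⟨c ⊗ₜ v + y, ?_⟩
    have h1 : (1 : integerRing p F) ⊗ₜ[WittVector p (ResField p F)] ((p : WittVector p k) * v) =
        (p : integerRing p F) ⊗ₜ v := by
      rw [← nsmul_eq_mul, TensorProduct.tmul_smul, TensorProduct.smul_tmul', nsmul_eq_mul, mul_one]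
    rw [h1, hc, mul_add, Algebra.TensorProduct.tmul_mul_tmul, one_mul]
  · rintro ⟨y, rfl⟩
    rw [map_mul, hπ0, zero_mul]

theorem sigma0_bijective : Function.Bijective (sigma0 p F k) := by
  have := charP_of_algebra p F k
  let : Fintype (ResField p F) := Fintype.ofFinite _
  have hq : 0 < Nat.card (ResField p F) := Nat.card_pos
  refine ⟨fun x y h => WittVector.ext fun n => ?_, fun w => ?_⟩
  · have h1 := congrArg (fun z => z.coeff n) h
    simp only [sigma0_coeff] at h1
    exact (FiniteField.frobeniusAlgHom (ResField p F) k).injective (by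
      simpa [Nat.card_eq_fintype_card] using h1)
  · choose x hx using fun n => IsAlgClosed.exists_pow_nat_eq (w.coeff n) hq
    exact ⟨WittVector.mk p x, WittVector.ext fun n => by rw [sigma0_coeff, ← hx]; rfl⟩

theorem sigma_bijective : Function.Bijective (sigma p F k) :=
  (Algebra.TensorProduct.congr AlgEquiv.refl
    (AlgEquiv.ofBijective (sigma0 p F k) (sigma0_bijective p F k))).bijective

/-- The integers of `L`. -/
def intSubring : Subring (L p F k) := (intLToL p F k).toRingHom.range

/-- The residue map of `intSubring`. -/
def intSubringRes : intSubring p F k →+* k :=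
  (intLRes p F k).comp (RingEquiv.symm (RingEquiv.ofBijective
    (intLToL p F k).toRingHom.rangeRestrict
    ⟨fun _ _ h => intLToL_injective p F k (congrArg Subtype.val h),
      (intLToL p F k).toRingHom.rangeRestrict_surjective⟩)).toRingHom

theorem intSubringRes_apply (z : IntL p F k) (h : intLToL p F k z ∈ intSubring p F k) :
    intSubringRes p F k ⟨intLToL p F k z, h⟩ = intLRes p F k z := by
  refine congrArg (intLRes p F k) ?_
  exact RingEquiv.symm_apply_apply (RingEquiv.ofBijective
    (intLToL p F k).toRingHom.rangeRestrict
    ⟨fun _ _ h => intLToL_injective p F k (congrArg Subtype.val h),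
      (intLToL p F k).toRingHom.rangeRestrict_surjective⟩) z

theorem frobRing_L {π : integerRing p F} (hπ : Irreducible π) :
    FrobRing (intSubring p F k) (intSubringRes p F k) (algebraMap F (L p F k) (π : F))
      (sigma p F k) (Nat.card (ResField p F)) := by
  have hch := charP_of_algebra p F k
  have hπ0 : (π : F) ≠ 0 := fun h => hπ.ne_zero (Subtype.ext h)
  have hmap : ∀ z, intLToL p F k z ∈ intSubring p F k := fun z => ⟨z, rfl⟩
  have hπL : intLToL p F k (π ⊗ₜ 1) = algebraMap F (L p F k) (π : F) := rfl
  obtain ⟨c, hc⟩ := dvd_of_residue_eq_zero hπ (x := (p : integerRing p F))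
    ((IsLocalRing.residue_eq_zero_iff _).2 (fact_not_isUnit_p p F).out)
  have hpM := (exists_frobenius_exponent p F).choose_spec.1 π
    ((IsLocalRing.residue_eq_zero_iff _).1 (residue_uniformizer hπ))
  set M := p ^ (exists_frobenius_exponent p F).choose
  obtain ⟨c', hc'⟩ := Ideal.mem_span_singleton.1 hpM
  have hMpos : 0 < M := pow_pos (Fact.out : p.Prime).pos _
  have hpt : ((p : integerRing p F) ⊗ₜ 1 : IntL p F k) = (p : IntL p F k) :=
    map_natCast (Algebra.TensorProduct.includeLeftRingHom : integerRing p F →+* IntL p F k) p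
  -- Since `π ∣ p ∣ π^M`, being `p`-adically complete and separated gives the same for `π`.
  obtain ⟨hhaus, hcomp⟩ := (pComplete_intL p F k).exists_sum_pow (t := π ⊗ₜ 1) hMpos
    ⟨c ⊗ₜ 1, by rw [Algebra.TensorProduct.tmul_mul_tmul, one_mul, ← hc, hpt]⟩
    ⟨c' ⊗ₜ 1, by
      rw [← hpt, Algebra.TensorProduct.tmul_mul_tmul, one_mul, ← hc',
        Algebra.TensorProduct.tmul_pow, one_pow]⟩
  have hdenom : ∀ x : L p F k, ∃ n : ℕ, algebraMap F (L p F k) (π : F) ^ n * x ∈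
      intSubring p F k := by
    have hF : ∀ x : F, ∃ n : ℕ, (π : F) ^ n * x ∈ integerRing p F := by
      intro x
      rcases (integerRing p F).mem_or_inv_mem x with h | h
      · exact ⟨0, by simpa using h⟩
      by_cases hx : x = 0
      · exact ⟨0, by simp [hx]⟩
      have hpow := exists_pow_lt_of_lt_one (y := (p : ℝ)⁻¹)
        (show 0 < spectralNorm ℚ_[p] F x⁻¹ from lt_of_le_of_ne (spectralNorm_nonneg _)
          fun h0 => inv_ne_zero hx (eq_zero_of_map_spectralNorm_eq_zero h0.symm
            (Algebra.IsAlgebraic.isAlgebraic _)))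
        (inv_lt_one_of_one_lt₀ (by exact_mod_cast (Fact.out : p.Prime).one_lt))
      obtain ⟨n, hn⟩ := hpow
      -- Here `|p^n| < |x⁻¹|`, so `x⁻¹` divides `p^n`, which divides `π^(M n)`; thus `π^(M n)`
      -- clears the denominator of `x`.
      have hinv : (⟨x⁻¹, h⟩ : integerRing p F) ∣ (p : integerRing p F) ^ n := by
        rcases ValuationRing.dvd_total (⟨x⁻¹, h⟩ : integerRing p F) ((p : integerRing p F) ^ n)
          with h' | h'
        · exact h'
        · exfalso
          have := (mem_span_pow_iff n (⟨x⁻¹, h⟩ : integerRing p F)).1 (by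
            rw [Ideal.span_singleton_pow]; exact Ideal.mem_span_singleton.2 h')
          exact absurd this (not_le.2 hn)
      obtain ⟨y, hy⟩ := hinv.trans (show (p : integerRing p F) ^ n ∣ π ^ (M * n) by
        rw [pow_mul, hc', mul_pow]; exact dvd_mul_right _ _)
      refine ⟨M * n, ?_⟩
      have hy' := congrArg Subtype.val hy
      push_cast at hy'
      rw [hy', mul_comm x⁻¹, mul_assoc, inv_mul_cancel₀ hx, mul_one]
      exact y.2
    intro x
    induction x using TensorProduct.induction_on with
    | zero => exact ⟨0, by simp [zero_mem]⟩
    | add x y hx hy =>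
      obtain ⟨n, hn⟩ := hx
      obtain ⟨m, hm⟩ := hy
      refine ⟨n + m, ?_⟩
      have hπm : ∀ n : ℕ, algebraMap F (L p F k) (π : F) ^ n ∈ intSubring p F k :=
        fun n => pow_mem (hπL ▸ hmap (π ⊗ₜ 1)) n
      have : algebraMap F (L p F k) (π : F) ^ (n + m) * (x + y) =
          algebraMap F (L p F k) (π : F) ^ m * (algebraMap F (L p F k) (π : F) ^ n * x) +
          algebraMap F (L p F k) (π : F) ^ n * (algebraMap F (L p F k) (π : F) ^ m * y) := by ring
      rw [this]
      exact add_mem (mul_mem (hπm m) hn) (mul_mem (hπm n) hm)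
    | tmul x w =>
      obtain ⟨n, hn⟩ := hF x
      refine ⟨n, ⟨⟨_, hn⟩ ⊗ₜ w, ?_⟩⟩
      rw [← map_pow]
      change (((π : F) ^ n * x) ⊗ₜ w : L p F k) = (((π : F) ^ n) ⊗ₜ 1 : L p F k) * (x ⊗ₜ w)
      rw [Algebra.TensorProduct.tmul_mul_tmul, one_mul]
  have hsm : ∀ x ∈ intSubring p F k, sigma p F k x ∈ intSubring p F k := by
    rintro _ ⟨z, rfl⟩
    exact ⟨intLSigma p F k z, intLToL_sigma p F k z⟩
  exact
    { isUnit := (isUnit_iff_ne_zero.2 hπ0).map _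
      pi_mem := hmap (π ⊗ₜ 1)
      denom := hdenom
      res_surj := fun c => by
        refine ⟨⟨_, hmap (1 ⊗ₜ WittVector.teichmuller p c)⟩, ?_⟩
        rw [intSubringRes_apply, intLRes_tmul]
        simp
      res_eq_zero := by
        rintro ⟨_, z, rfl⟩
        refine (Eq.congr_left (intSubringRes_apply p F k z _)).trans ?_
        rw [intLRes_eq_zero_iff p F hπ]
        constructor
        · rintro ⟨y, rfl⟩
          exact ⟨_, hmap y, map_mul (intLToL p F k) _ _⟩
        · rintro ⟨_, ⟨y, rfl⟩, h⟩
          refine ⟨y, intLToL_injective p F k (h.trans ?_)⟩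
          rw [map_mul, hπL]
          rfl
      haus := fun x hx => by
        obtain ⟨_, ⟨z, rfl⟩, hz⟩ := hx 0
        rw [pow_zero, one_mul] at hz
        subst hz
        have : z = 0 := hhaus z fun n => by
          obtain ⟨_, ⟨y, rfl⟩, hy⟩ := hx n
          refine ⟨y, intLToL_injective p F k (hy.trans ?_)⟩
          rw [map_mul, map_pow]; rfl
        rw [this]; exact map_zero _
      complete := fun f hf => by
        choose g hg using hf
        obtain ⟨x, hx⟩ := hcomp g
        refine ⟨_, hmap x, fun n => ?_⟩
        obtain ⟨y, hy⟩ := hx n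
        refine ⟨_, hmap y, ?_⟩
        rw [hy, map_add, map_sum, map_mul, map_pow, hπL]
        simp only [map_mul, map_pow, hπL, ← hg]
        rfl
      sigma_mem := hsm
      sigma_bij := sigma_bijective p F k
      sigma_pi := by
        change sigma p F k ((π : F) ⊗ₜ 1) = _
        rw [sigma_tmul, map_one]; rfl
      res_sigma := by
        rintro ⟨_, z, rfl⟩
        have h1 : (⟨sigma p F k ((intLToL p F k).toRingHom z), hsm _ ⟨z, rfl⟩⟩ :
          intSubring p F k) = ⟨_, hmap (intLSigma p F k z)⟩ :=
          Subtype.ext (intLToL_sigma p F k z).symm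
        rw [h1, intSubringRes_apply, intLRes_sigma]
        exact congrArg (· ^ _) (intSubringRes_apply p F k z _).symm
      one_lt := Finite.one_lt_card
      cast_eq_zero := by
        let : Fintype (ResField p F) := Fintype.ofFinite _
        obtain ⟨f, -, hf⟩ := FiniteField.card (ResField p F) p
        rw [Nat.card_eq_fintype_card, hf, Nat.cast_pow, CharP.cast_eq_zero, zero_pow f.ne_zero] }

end Field

/-! ### Sorted vectors and sums of their entries -/

section Sorted
variable {α : Type*} [LinearOrder α] [Zero α]

theorem finsum_replicate_eq {m : α → ℕ} (s : Finset α) (hs : ∀ a ∉ s, m a = 0) :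
    ∑ᶠ a, Multiset.replicate (m a) a = ∑ a ∈ s, Multiset.replicate (m a) a := by
  refine finsum_eq_sum_of_support_subset _ fun a ha => ?_
  by_contra h
  exact ha (by simp [hs a h])

theorem length_sort_finsum {d : ℕ} {m : α → ℕ} (s : Finset α) (hs : ∀ a ∉ s, m a = 0)
    (hd : ∑ a ∈ s, m a = d) :
    ((∑ᶠ a, Multiset.replicate (m a) a).sort (· ≥ ·)).length = d := by
  rw [Multiset.length_sort, finsum_replicate_eq s hs, Multiset.card_sum]
  simpa using hd

/-- Together with `sortedVector_antitone` this is all that is used about sorted vectors: they enter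
through order and through symmetric sums `∑ g`. -/
theorem sum_sortedVector {d : ℕ} {m : α → ℕ} (s : Finset α) (hs : ∀ a ∉ s, m a = 0)
    (hd : ∑ a ∈ s, m a = d) {M : Type*} [AddCommMonoid M] (g : α → M) :
    ∑ j, g (sortedVector d m j) = ∑ a ∈ s, m a • g a := by
  have hlen := length_sort_finsum s hs hd
  unfold sortedVector
  set l := (∑ᶠ a, Multiset.replicate (m a) a).sort (· ≥ ·) with hl
  clear_value l
  have h1 : (l.map g).sum = ∑ a ∈ s, m a • g a := by
    rw [← Multiset.sum_coe, ← Multiset.map_coe, hl, Multiset.sort_eq, finsum_replicate_eq s hs]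
    refine (map_sum (Multiset.sumAddMonoidHom.comp (Multiset.mapAddMonoidHom g))
      (fun a => Multiset.replicate (m a) a) s).trans (Finset.sum_congr rfl fun a _ => ?_)
    change (Multiset.map g (Multiset.replicate (m a) a)).sum = _
    simp
  rw [← h1]
  clear h1 hl
  subst hlen
  rw [← Fin.sum_univ_getElem]
  simp only [List.getElem_map]
  rw [← Fin.sum_congr' _ (List.length_map (f := g) (as := l))]
  refine Finset.sum_congr rfl fun j _ => ?_
  have hj : (j : ℕ) < l.length := by simpa using j.2
  simp [hj]

theorem sortedVector_antitone {d : ℕ} {m : α → ℕ} (s : Finset α) (hs : ∀ a ∉ s, m a = 0)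
    (hd : ∑ a ∈ s, m a = d) : Antitone (sortedVector d m) := by
  have hlen := length_sort_finsum s hs hd
  have hsort := Multiset.pairwise_sort (∑ᶠ a, Multiset.replicate (m a) a) (· ≥ ·)
  unfold sortedVector
  set l := (∑ᶠ a, Multiset.replicate (m a) a).sort (· ≥ ·) with hl
  intro i j hij
  dsimp only
  rw [List.getD_eq_getElem _ _ (by omega), List.getD_eq_getElem _ _ (by omega)]
  rcases hij.eq_or_lt with rfl | h
  · rfl
  · exact List.pairwise_iff_getElem.1 hsort i j (by omega) (by omega) h

end Sorted

section Comb

/-- Layer-cake summation: each `f j` is `a` plus the number of levels `a + t + 1`, `t < n`, that it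
reaches. -/
theorem sum_eq_of_bounds {ι : Type*} (S : Finset ι) (f : ι → ℤ) (a : ℤ) (n : ℕ)
    (h : ∀ j ∈ S, a ≤ f j ∧ f j ≤ a + n) :
    ∑ j ∈ S, f j = a * S.card +
      ∑ t ∈ Finset.range n, ((S.filter fun j => a + t + 1 ≤ f j).card : ℤ) := by
  simp only [Finset.card_filter, Nat.cast_sum]
  rw [Finset.sum_comm]
  have : a * (S.card : ℤ) = ∑ j ∈ S, a := by simp [mul_comm]
  rw [this, ← Finset.sum_add_distrib]
  refine Finset.sum_congr rfl fun j hj => ?_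
  obtain ⟨h1, h2⟩ := h j hj
  have h3 : ((Finset.range n).filter fun t : ℕ => a + t + 1 ≤ f j) =
      Finset.range (f j - a).toNat := by
    ext t; simp only [Finset.mem_filter, Finset.mem_range]; omega
  have h4 := Finset.card_filter (fun t : ℕ => a + t + 1 ≤ f j) (Finset.range n)
  rw [h3, Finset.card_range] at h4
  rw [← Nat.cast_sum, ← h4]
  omega

theorem mem_iff_lt_card {d : ℕ} (A : Finset (Fin d)) (hA : ∀ i j, i ≤ j → j ∈ A → i ∈ A)
    (j : Fin d) : j ∈ A ↔ (j : ℕ) < A.card := by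
  constructor
  · intro hj
    have : Finset.Iic j ⊆ A := fun i hi => hA i j (Finset.mem_Iic.1 hi) hj
    have := Finset.card_le_card this
    rw [Fin.card_Iic] at this
    omega
  · intro hlt
    by_contra hj
    have : A ⊆ Finset.Iio j := fun i hi => Finset.mem_Iio.2 (lt_of_not_ge fun h => hj (hA j i h hi))
    have := Finset.card_le_card this
    rw [Fin.card_Iio] at this
    omega

theorem mem_iff_sub_card_le {d : ℕ} (A : Finset (Fin d)) (hA : ∀ i j, i ≤ j → i ∈ A → j ∈ A)
    (j : Fin d) : j ∈ A ↔ d - A.card ≤ (j : ℕ) := by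
  have := mem_iff_lt_card Aᶜ (fun i k hik hk => by
    rw [Finset.mem_compl] at hk ⊢
    exact fun h => hk (hA i k hik h)) j
  rw [Finset.mem_compl, Finset.card_compl, Fintype.card_fin] at this
  rw [← not_iff_not, this]
  omega

theorem card_fin_filter_Ico {d a c : ℕ} (hc : c ≤ d) :
    (Finset.univ.filter fun j : Fin d => a ≤ (j : ℕ) ∧ (j : ℕ) < c).card = c - a := by
  rw [← Nat.card_Ico, ← Finset.card_map Fin.valEmbedding]
  congr 1
  ext x
  simp only [Finset.mem_map, Finset.mem_filter, Finset.mem_univ, true_and, Fin.valEmbedding_apply,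
    Finset.mem_Ico]
  exact ⟨by rintro ⟨j, h, rfl⟩; exact h, fun h => ⟨⟨x, by omega⟩, h, rfl⟩⟩

/-- The sum of the last `w` entries of an antitone vector of integers. -/
theorem sum_tail_eq {d : ℕ} {μ : Fin d → ℤ} (hμ : Antitone μ) (a : ℤ) (n : ℕ)
    (h : ∀ j, a ≤ μ j ∧ μ j ≤ a + n) {w : ℕ} (hw : w ≤ d) :
    ∑ j with d - w ≤ j.val, μ j = a * w + ∑ t ∈ Finset.range n,
      (((Finset.univ.filter fun j => a + t + 1 ≤ μ j).card + w - d : ℕ) : ℤ) := by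
  rw [sum_eq_of_bounds _ μ a n fun j _ => h j]
  have hcard : (Finset.univ.filter fun j : Fin d => d - w ≤ j.val).card = w := by
    have := card_fin_filter_Ico (a := d - w) (le_refl d)
    simp only [Fin.is_lt, and_true] at this
    omega
  rw [hcard]
  congr 1
  refine Finset.sum_congr rfl fun t _ => ?_
  set A := Finset.univ.filter fun j => a + t + 1 ≤ μ j with hA
  have hmem := mem_iff_lt_card A fun i j hij hj => by
    rw [hA, Finset.mem_filter] at hj ⊢
    exact ⟨Finset.mem_univ _, hj.2.trans (hμ hij)⟩
  have hAd : A.card ≤ d := by simpa using Finset.card_le_univ A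
  have := card_fin_filter_Ico (a := d - w) hAd
  have h2 : (Finset.univ.filter fun j : Fin d => d - w ≤ j.val).filter (fun j => a + t + 1 ≤ μ j) =
      Finset.univ.filter fun j : Fin d => d - w ≤ (j : ℕ) ∧ (j : ℕ) < A.card := by
    ext j
    rw [Finset.mem_filter, Finset.mem_filter, Finset.mem_filter, ← hmem j, hA, Finset.mem_filter]
    tauto
  rw [h2, this]
  congr 1
  omega

theorem sum_head_add_sum_tail {d : ℕ} (f : Fin d → ℚ) (r : ℕ) :
    ∑ j with j.val < r, f j + ∑ j with r ≤ j.val, f j = ∑ j, f j := by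
  rw [← Finset.sum_filter_add_sum_filter_not Finset.univ (fun j : Fin d => j.val < r)]
  simp only [not_lt]

/-- Dominance need only be tested at the breaks of `ν`. On a run where `ν` is constantly `t`, the
tail sum of `μ - ν` is a convex function of its starting index, because `μ` decreases; so it is
nonpositive if it is so at both ends, which are the sets `ν < t` and `ν ≤ t`. -/
theorem dominatedBy_of_threshold {d : ℕ} {ν μ : Fin d → ℚ} (hν : Antitone ν) (hμ : Antitone μ)
    (htot : ∑ j, ν j = ∑ j, μ j) (hlt : ∀ t, ∑ j with ν j < t, μ j ≤ ∑ j with ν j < t, ν j)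
    (hle : ∀ t, ∑ j with ν j ≤ t, μ j ≤ ∑ j with ν j ≤ t, ν j) : DominatedBy ν μ := by
  refine ⟨fun r hr => ?_, htot⟩
  have h1 := sum_head_add_sum_tail ν r
  have h2 := sum_head_add_sum_tail μ r
  suffices h : ∑ j with r ≤ j.val, (μ j - ν j) ≤ 0 by
    rw [Finset.sum_sub_distrib] at h
    linarith
  set t := ν ⟨r, hr⟩ with ht
  have hsub1 : (Finset.univ.filter fun j => ν j < t) ⊆ Finset.univ.filter fun j => r ≤ j.val := by
    intro j hj
    rw [Finset.mem_filter] at hj ⊢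
    refine ⟨hj.1, not_lt.1 fun h => not_le.2 hj.2 (hν (show j ≤ ⟨r, hr⟩ from h.le))⟩
  have hsub2 : (Finset.univ.filter fun j : Fin d => r ≤ j.val) ⊆
      Finset.univ.filter fun j => ν j ≤ t := by
    intro j hj
    rw [Finset.mem_filter] at hj ⊢
    exact ⟨hj.1, hν (show ⟨r, hr⟩ ≤ j from hj.2)⟩
  have hA := hlt t
  have hA' := hle t
  rw [← sub_nonpos, ← Finset.sum_sub_distrib] at hA hA'
  rcases le_or_gt (μ ⟨r, hr⟩) t with h | h
  · rw [← Finset.sum_sdiff hsub1]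
    refine add_nonpos (Finset.sum_nonpos fun j hj => ?_) hA
    simp only [Finset.mem_sdiff, Finset.mem_filter, Finset.mem_univ, true_and, not_lt] at hj
    have := hμ (show ⟨r, hr⟩ ≤ j from hj.1)
    linarith [hj.2]
  · rw [← Finset.sum_sdiff hsub2] at hA'
    have : 0 ≤ ∑ j ∈ (Finset.univ.filter fun j => ν j ≤ t) \
        Finset.univ.filter fun j : Fin d => r ≤ j.val, (μ j - ν j) := by
      refine Finset.sum_nonneg fun j hj => ?_
      simp only [Finset.mem_sdiff, Finset.mem_filter, Finset.mem_univ, true_and, not_le] at hj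
      have := hμ (show j ≤ ⟨r, hr⟩ from hj.2.le)
      linarith [hj.1]
    linarith

/-- Among sums of `w` entries, the sum of the last `w` entries of a decreasing vector is minimal. -/
theorem sum_tail_le_sum {d : ℕ} {ν : Fin d → ℚ} (hν : Antitone ν) {ι : Type*} [Fintype ι]
    {β : ι → ℚ} (h : ∀ g : ℚ → ℚ, ∑ j, g (ν j) = ∑ i, g (β i)) (S : Finset ι) (hS : S.card ≤ d) :
    ∑ j with d - S.card ≤ j.val, ν j ≤ ∑ i ∈ S, β i := by
  have hcard : (Finset.univ.filter fun j : Fin d => d - S.card ≤ j.val).card = S.card := by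
    have := card_fin_filter_Ico (a := d - S.card) (le_refl d)
    simp only [Fin.is_lt, and_true] at this
    omega
  rcases Nat.eq_zero_or_pos S.card with h0 | hpos
  · rw [Finset.card_eq_zero.1 (hcard.trans h0), Finset.card_eq_zero.1 h0]
    simp
  have hr : d - S.card < d := by omega
  set t := ν ⟨d - S.card, hr⟩
  -- The entries in the tail are at most `t` and the earlier ones at least `t`, so the tail sum is
  -- exactly expressed by the symmetric function `∑ max (t - ν j) 0`. For `S` the same expression is
  -- only a lower bound.
  have h1 : ∑ j with d - S.card ≤ j.val, ν j = S.card * t - ∑ j, max (t - ν j) 0 := by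
    have h2 : ∑ j, max (t - ν j) 0 = ∑ j with d - S.card ≤ j.val, (t - ν j) := by
      rw [Finset.sum_filter]
      refine Finset.sum_congr rfl fun j _ => ?_
      split_ifs with hj
      · exact max_eq_left (sub_nonneg.2 (hν (show ⟨d - S.card, hr⟩ ≤ j from hj)))
      · exact max_eq_right (sub_nonpos.2
          (hν (show j ≤ ⟨d - S.card, hr⟩ from (not_le.1 hj).le)))
    rw [h2, Finset.sum_sub_distrib, Finset.sum_const, hcard, nsmul_eq_mul]
    ring
  have h3 : ∑ i ∈ S, β i = S.card * t - ∑ i ∈ S, (t - β i) := by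
    rw [Finset.sum_sub_distrib, Finset.sum_const, nsmul_eq_mul]
    ring
  have h4 : ∑ i ∈ S, (t - β i) ≤ ∑ i ∈ S, max (t - β i) 0 :=
    Finset.sum_le_sum fun i _ => le_max_left _ _
  have h5 : ∑ i ∈ S, max (t - β i) 0 ≤ ∑ i, max (t - β i) 0 :=
    Finset.sum_le_univ_sum_of_nonneg fun i => le_max_right _ _
  have h6 := h fun x => max (t - x) 0
  rw [h1, h3]
  linarith

theorem DominatedBy.sum_tail_le {d : ℕ} {ν μ : Fin d → ℚ} (h : DominatedBy ν μ) (w : ℕ) :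
    ∑ j with d - w ≤ j.val, μ j ≤ ∑ j with d - w ≤ j.val, ν j := by
  have h1 := sum_head_add_sum_tail ν (d - w)
  have h2 := sum_head_add_sum_tail μ (d - w)
  rcases Nat.lt_or_ge (d - w) d with hr | hr
  · linarith [h.1 _ hr, h.2]
  · have : (Finset.univ.filter fun j : Fin d => d - w ≤ j.val) = ∅ :=
      Finset.filter_eq_empty_iff.2 fun j _ => by have := j.2; omega
    rw [this, Finset.sum_empty, Finset.sum_empty]

end Comb

/-- The field structure on a commutative ring that is a field, with the given ring structure. -/
abbrev fieldOfIsField {R : Type*} [CommRing R] (h : IsField R) : Field R :=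
  letI := Classical.decEq R
  { (inferInstance : CommRing R) with
    inv := fun a => if ha : a = 0 then 0 else Classical.choose (h.mul_inv_cancel ha)
    exists_pair_ne := h.exists_pair_ne
    mul_inv_cancel := fun a ha => by
      change a * (if ha : a = 0 then 0 else Classical.choose (h.mul_inv_cancel ha)) = 1
      rw [dif_neg ha]
      exact Classical.choose_spec (h.mul_inv_cancel ha)
    inv_zero := dif_pos rfl
    nnqsmul := _
    nnqsmul_def := fun _ _ => rfl
    qsmul := _
    qsmul_def := fun _ _ => rfl }

section
variable {K V : Type*} [Field K] [AddCommGroup V] [Module K V] [FiniteDimensional K V]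

theorem finrank_submoduleOf (U W : Submodule K V) :
    Module.finrank K (U.submoduleOf W) = Module.finrank K ↥(U ⊓ W) := by
  rw [← Submodule.finrank_map_subtype_eq W (U.submoduleOf W), Submodule.submoduleOf,
    Submodule.map_comap_subtype, inf_comm]

theorem finrank_quotient_submoduleOf {U W : Submodule K V} (h : U ≤ W) :
    Module.finrank K (W ⧸ U.submoduleOf W) + Module.finrank K U = Module.finrank K W := by
  have := (U.submoduleOf W).finrank_quotient_add_finrank
  rwa [finrank_submoduleOf, inf_eq_left.2 h] at this
end

/-! ### Filtrations and their types -/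

section Iso
variable {p : ℕ} [Fact p.Prime] {F : Type*} [Field F] [Algebra ℚ_[p] F] [FiniteDimensional ℚ_[p] F]
  {k : Type*} [Field k] [Algebra (ResField p F) k] {D : Type*} [AddCommGroup D] [Module (L p F k) D]

namespace Filtration

/-- The dimension of `Fil^i`. -/
def dim (Fil : Filtration p F k D) (i : ℤ) : ℕ := Module.finrank (L p F k) (Fil.fil i)

theorem dim_of_eq_top (hL : IsField (L p F k)) [Module.Finite (L p F k) D]
    {Fil : Filtration p F k D} {i : ℤ} (h : Fil.fil i = ⊤) :
    Fil.dim i = Module.finrank (L p F k) D := by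
  let := fieldOfIsField hL
  rw [dim, h, finrank_top]

theorem dim_of_eq_bot (hL : IsField (L p F k)) {Fil : Filtration p F k D} {i : ℤ}
    (h : Fil.fil i = ⊥) : Fil.dim i = 0 := by
  let := fieldOfIsField hL
  rw [dim, h, finrank_bot]

theorem grDim_add (hL : IsField (L p F k)) [Module.Finite (L p F k) D] (Fil : Filtration p F k D)
    (i : ℤ) : Fil.grDim i + Fil.dim (i + 1) =
      Fil.dim i := by
  let := fieldOfIsField hL
  exact finrank_quotient_submoduleOf (Fil.antitone (by omega))

/-- A step of least dimension lies in all others, hence is `0` by separatedness; a step of greatest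
dimension contains all others, hence is everything by exhaustiveness. -/
theorem exists_bounds (hL : IsField (L p F k)) [Module.Finite (L p F k) D]
    (Fil : Filtration p F k D) : ∃ (a : ℤ) (n : ℕ), Fil.fil a = ⊤ ∧ Fil.fil (a + n) = ⊥ := by
  let := fieldOfIsField hL
  obtain ⟨b, hb⟩ : ∃ b, ∀ i, Module.finrank (L p F k) (Fil.fil b) ≤
      Module.finrank (L p F k) (Fil.fil i) :=
    ⟨Function.argmin fun i => Module.finrank (L p F k) (Fil.fil i),
      fun i => Function.argmin_le (fun i => Module.finrank (L p F k) (Fil.fil i)) i⟩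
  have hbot : Fil.fil b = ⊥ := by
    rw [eq_bot_iff]
    intro x hx
    have : x ∈ ⋂ i, (Fil.fil i : Set D) := Set.mem_iInter.2 fun i => by
      rcases le_total i b with h | h
      · exact Fil.antitone h hx
      · rw [Submodule.eq_of_le_of_finrank_le (Fil.antitone h) (hb i)]
        exact hx
    rw [Fil.separated] at this
    exact this
  obtain ⟨a, ha⟩ : ∃ a, ∀ i, Module.finrank (L p F k) (Fil.fil i) ≤
      Module.finrank (L p F k) (Fil.fil a) := by
    refine ⟨Function.argmin fun i => Module.finrank (L p F k) D -
      Module.finrank (L p F k) (Fil.fil i), fun i => ?_⟩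
    have h1 := Function.argmin_le (fun i => Module.finrank (L p F k) D -
      Module.finrank (L p F k) (Fil.fil i)) i
    have h2 := Submodule.finrank_le (Fil.fil i)
    omega
  have htop : Fil.fil a = ⊤ := by
    rw [eq_top_iff]
    intro x _
    obtain ⟨i, hi⟩ := Set.mem_iUnion.1 (Fil.exhaustive.ge (Set.mem_univ x))
    rcases le_total a i with h | h
    · exact Fil.antitone h hi
    · rw [Submodule.eq_of_le_of_finrank_le (Fil.antitone h) (ha i)]
      exact hi
  refine ⟨a, (b - a).toNat, htop, ?_⟩
  rw [eq_bot_iff, ← hbot]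
  exact Fil.antitone (by omega)

/-- Abel summation, with `grDim i = dim i - dim (i + 1)`. -/
theorem sum_grDim_mul (hL : IsField (L p F k)) [Module.Finite (L p F k) D]
    (Fil : Filtration p F k D) (a : ℤ) (n : ℕ) :
    ∑ t ∈ Finset.range n, (Fil.grDim (a + t) : ℤ) * (a + t) =
      a * Fil.dim a +
      ∑ t ∈ Finset.range n, (Fil.dim (a + t + 1) : ℤ) -
      (a + n) * Fil.dim (a + n) := by
  induction n with
  | zero => simp
  | succ n ih =>
    have h := Fil.grDim_add hL (a + n)
    rw [Finset.sum_range_succ, Finset.sum_range_succ, ih]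
    push_cast
    simp only [← add_assoc]
    rw [← h]
    push_cast
    ring

theorem sum_grDim (hL : IsField (L p F k)) [Module.Finite (L p F k) D]
    (Fil : Filtration p F k D) (a : ℤ) (n : ℕ) :
    ∑ t ∈ Finset.range n, Fil.grDim (a + t) + Fil.dim (a + n) =
      Fil.dim a := by
  induction n with
  | zero => simp
  | succ n ih =>
    have h := Fil.grDim_add hL (a + n)
    rw [Finset.sum_range_succ, ← ih, ← h]
    push_cast
    rw [← add_assoc, ← add_assoc]

theorem grDim_eq_zero (hL : IsField (L p F k)) [Module.Finite (L p F k) D]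
    (Fil : Filtration p F k D) {a : ℤ} {n : ℕ} (ha : Fil.fil a = ⊤) (hn : Fil.fil (a + n) = ⊥)
    {i : ℤ} (hi : i < a ∨ a + n ≤ i) : Fil.grDim i = 0 := by
  have h := Fil.grDim_add hL i
  rcases hi with hi | hi
  · have h1 : Fil.fil i = ⊤ := eq_top_iff.2 (ha ▸ Fil.antitone hi.le)
    have h2 : Fil.fil (i + 1) = ⊤ := eq_top_iff.2 (ha ▸ Fil.antitone (by omega))
    rw [dim_of_eq_top hL h1, dim_of_eq_top hL h2] at h
    omega
  · have h1 : Fil.fil i = ⊥ := eq_bot_iff.2 (hn ▸ Fil.antitone hi)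
    rw [dim_of_eq_bot hL h1] at h
    omega

/-- The total of the type in terms of the dimensions of the steps of the filtration. -/
theorem sum_typeVector (hL : IsField (L p F k)) [Module.Finite (L p F k) D]
    (Fil : Filtration p F k D) {a : ℤ} {n : ℕ} (ha : Fil.fil a = ⊤) (hn : Fil.fil (a + n) = ⊥) :
    ∑ j, Fil.typeVector j = a * Module.finrank (L p F k) D +
      ∑ t ∈ Finset.range n, (Fil.dim (a + t + 1) : ℤ) := by
  have hinj : Function.Injective fun t : ℕ => a + t := fun x y h => by
    simpa using h
  have hd := Fil.sum_grDim hL a n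
  have hm := Fil.sum_grDim_mul hL a n
  rw [dim_of_eq_top hL ha, dim_of_eq_bot hL hn] at hd hm
  have := sum_sortedVector (d := Module.finrank (L p F k) D) (m := Fil.grDim)
    ((Finset.range n).map ⟨fun t : ℕ => a + t, hinj⟩) (fun i hi => by
      refine Fil.grDim_eq_zero hL ha hn ?_
      by_contra! h
      exact hi (Finset.mem_map.2 ⟨(i - a).toNat, Finset.mem_range.2 (by omega), by simp; omega⟩))
    (by simpa using hd) (id : ℤ → ℤ)
  simp only [Finset.sum_map, Function.Embedding.coeFn_mk, id, nsmul_eq_mul] at this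
  unfold typeVector
  rw [this, hm]
  simp

theorem IsOfType.bounds (hL : IsField (L p F k)) [Module.Finite (L p F k) D]
    {Fil : Filtration p F k D} {d : ℕ} {μ : Fin d → ℤ} (h : Fil.IsOfType μ) {a : ℤ} {n : ℕ}
    (ha : Fil.fil a = ⊤) (hn : Fil.fil (a + n) = ⊥) (j : Fin d) : a ≤ μ j ∧ μ j < a + n := by
  by_contra hc
  have h0 := Fil.grDim_eq_zero hL ha hn (i := μ j) (by omega)
  rw [h (μ j)] at h0
  have : Nonempty {i : Fin d // μ i = μ j} := ⟨⟨j, rfl⟩⟩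
  exact Nat.card_pos.ne' h0

theorem card_eq_add {d : ℕ} (μ : Fin d → ℤ) (i : ℤ) :
    (Finset.univ.filter fun j => i ≤ μ j).card =
      Nat.card {j : Fin d // μ j = i} + (Finset.univ.filter fun j => i + 1 ≤ μ j).card := by
  rw [Nat.card_eq_fintype_card, Fintype.card_subtype, ← Finset.card_union_of_disjoint]
  · congr 1
    ext j
    simp only [Finset.mem_filter, Finset.mem_univ, true_and, Finset.mem_union]
    omega
  · rw [Finset.disjoint_left]
    intro j
    simp only [Finset.mem_filter, Finset.mem_univ, true_and]
    omega

/-- Downward induction from a step where the filtration is zero, hence the indexing by `a + n - t`.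
-/
theorem IsOfType.dim_eq (hL : IsField (L p F k)) [Module.Finite (L p F k) D]
    {Fil : Filtration p F k D} {d : ℕ} {μ : Fin d → ℤ} (h : Fil.IsOfType μ) {a : ℤ} {n : ℕ}
    (ha : Fil.fil a = ⊤) (hn : Fil.fil (a + n) = ⊥) (t : ℕ) :
    Fil.dim (a + n - t) =
      (Finset.univ.filter fun j => a + n - t ≤ μ j).card := by
  induction t with
  | zero =>
    rw [Nat.cast_zero, sub_zero, dim_of_eq_bot hL hn, eq_comm, Finset.card_eq_zero,
      Finset.filter_eq_empty_iff]
    intro j _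
    have := (h.bounds hL ha hn j).2
    omega
  | succ t ih =>
    have h1 := Fil.grDim_add hL (a + n - (t + 1 : ℕ))
    rw [card_eq_add, ← h, ← h1]
    push_cast at ih ⊢
    rw [show a + n - (t + 1) + 1 = a + n - (t : ℤ) by ring, ih]

end Filtration

/-! ### Newton vectors and induced types of sub-isocrystals -/

theorem isSlopeVector_iff (hL : IsField (L p F k)) (E : Isocrystal p F k D) (π : integerRing p F)
    (α : ℚ) (v : D) : letI := fieldOfIsField hL
    E.φ^[α.den] v = algebraMap F (L p F k) ((π : F) ^ α.num) • v ↔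
      IsSlopeVector E.φ (algebraMap F (L p F k) (π : F)) α v := by
  let := fieldOfIsField hL
  rw [IsSlopeVector, map_zpow₀]

variable [IsAlgClosed k] [Module.Finite (L p F k) D]

theorem isField_L {π : integerRing p F} (hπ : Irreducible π) : IsField (L p F k) :=
  (frobRing_L p F k hπ).isField

/-- The slopes may be read off any indexed family with the right multiplicities; the test function
`g` expresses equality of multisets in the form used by the combinatorial lemmas. -/
theorem newtonVector_spec {π : integerRing p F} (E : Isocrystal p F k D)
    {ι : Type*} [Fintype ι] {β : ι → ℚ} (S : Finset ι)
    (hS : S.card = Module.finrank (L p F k) D)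
    (h : ∀ α, Module.finrank (L p F k) (E.slopePart π α) = (S.filter fun i => β i = α).card) :
    Antitone (E.newtonVector π) ∧
      ∀ g : ℚ → ℚ, ∑ j, g (E.newtonVector π j) = ∑ i ∈ S, g (β i) := by
  have h1 : ∀ a ∉ S.image β, Module.finrank (L p F k) (E.slopePart π a) = 0 := by
    intro a ha
    rw [h, Finset.card_eq_zero, Finset.filter_eq_empty_iff]
    rintro i hi rfl
    exact ha (Finset.mem_image_of_mem β hi)
  have h2 : ∑ a ∈ S.image β, Module.finrank (L p F k) (E.slopePart π a) =
      Module.finrank (L p F k) D := by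
    simp only [h]
    rw [← Finset.card_eq_sum_card_image, hS]
  refine ⟨sortedVector_antitone _ h1 h2, fun g => (sum_sortedVector _ h1 h2 g).trans ?_⟩
  simp only [h]
  rw [Finset.sum_comp]

/-- A vector `v` with `φ ^ s v = π ^ r v`, where `α = r / s` in lowest terms. -/
def Isocrystal.HasSlope (E : Isocrystal p F k D) (π : integerRing p F) (α : ℚ) (v : D) : Prop :=
  E.φ^[α.den] v = algebraMap F (L p F k) ((π : F) ^ α.num) • v

theorem Isocrystal.hasSlope_iff (hL : IsField (L p F k)) (E : Isocrystal p F k D)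
    (π : integerRing p F) (α : ℚ) (v : D) : letI := fieldOfIsField hL
    E.HasSlope π α v ↔ IsSlopeVector E.φ (algebraMap F (L p F k) (π : F)) α v :=
  isSlopeVector_iff hL E π α v

theorem Isocrystal.exists_adapted_basis {π : integerRing p F} (hπ : Irreducible π)
    (E : Isocrystal p F k D) (W : Submodule (L p F k) D) (hW : ∀ w ∈ W, E.φ w ∈ W) :
    ∃ (T : Set D) (_ : Fintype T) (b : Module.Basis T (L p F k) D) (β : T → ℚ) (S : Finset T),
      (∀ i, E.HasSlope π (β i) (b i)) ∧ W = Submodule.span (L p F k) (b '' S) := by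
  have hL : IsField (L p F k) := isField_L hπ
  let := fieldOfIsField hL
  have H := frobRing_L p F k hπ
  obtain ⟨T, inst, b, β, S, hb, hS⟩ := FrobRing.exists_adapted_basis H E.bijective.1 W hW
  exact ⟨T, inst, b, β, S, fun i => (E.hasSlope_iff hL π _ _).2 (hb i), hS⟩

/-- The slope part of `D'`, pushed into `D`, is the span of the slope vectors of `D` lying in `D'`,
hence of the basis vectors indexed by `S` with that slope. -/
theorem SubIsocrystal.finrank_slopePart {π : integerRing p F} (hπ : Irreducible π)
    {E : Isocrystal p F k D} (E' : SubIsocrystal E) {ι : Type*} [Fintype ι]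
    (b : Module.Basis ι (L p F k) D) {β : ι → ℚ} (hb : ∀ i, E.HasSlope π (β i) (b i))
    (S : Finset ι) (hS : E'.carrier = Submodule.span (L p F k) (b '' S)) :
    S.card = Module.finrank (L p F k) E'.carrier ∧
    ∀ α, Module.finrank (L p F k) (E'.toIsocrystal.slopePart π α) =
      (S.filter fun i => β i = α).card := by
  have hL : IsField (L p F k) := isField_L hπ
  let := fieldOfIsField hL
  have H := frobRing_L p F k hπ
  have hb' := fun i => (E.hasSlope_iff hL π _ _).1 (hb i)
  refine ⟨by rw [hS, finrank_eq_sub_of_eq_span], fun α => ?_⟩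
  rw [← finrank_eq_sub_of_eq_span b, ← H.span_isSlopeVector_inter b hb' S α,
    ← Submodule.finrank_map_subtype_eq, Isocrystal.slopePart, Submodule.map_span]
  refine congrArg (fun M : Submodule (L p F k) D => Module.finrank (L p F k) M)
    (congrArg (Submodule.span (L p F k)) (Set.ext fun v => ?_))
  constructor
  · rintro ⟨x, hx, rfl⟩
    exact ⟨hS ▸ x.2, (isSlopeVector_restrict_iff E'.toIsocrystal.φ fun _ => rfl).1
      ((E'.toIsocrystal.hasSlope_iff hL π α x).1 hx)⟩
  · rintro ⟨hv, hx⟩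
    exact ⟨⟨v, hS ▸ hv⟩, (E'.toIsocrystal.hasSlope_iff hL π α _).2
      ((isSlopeVector_restrict_iff E'.toIsocrystal.φ fun _ => rfl).2 hx), rfl⟩

theorem Isocrystal.finrank_slopePart {π : integerRing p F} (hπ : Irreducible π)
    (E : Isocrystal p F k D) {ι : Type*} [Fintype ι]
    (b : Module.Basis ι (L p F k) D) {β : ι → ℚ} (hb : ∀ i, E.HasSlope π (β i) (b i)) (α : ℚ) :
    Module.finrank (L p F k) (E.slopePart π α) =
      (Finset.univ.filter fun i => β i = α).card := by
  have hL : IsField (L p F k) := isField_L hπ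
  let := fieldOfIsField hL
  have H := frobRing_L p F k hπ
  have hb' := fun i => (E.hasSlope_iff hL π _ _).1 (hb i)
  have h1 := H.span_isSlopeVector_inter b hb' Finset.univ α
  rw [← finrank_eq_sub_of_eq_span b, ← h1, Isocrystal.slopePart]
  refine congrArg (fun M : Submodule (L p F k) D => Module.finrank (L p F k) M)
    (congrArg (Submodule.span (L p F k)) (Set.ext fun v => ?_))
  have : v ∈ Submodule.span (L p F k) (b '' ↑(Finset.univ : Finset ι)) := by
    rw [Finset.coe_univ, Set.image_univ, b.span_eq]; trivial
  exact ⟨fun h => ⟨this, (E.hasSlope_iff hL π α v).1 h⟩, fun h => (E.hasSlope_iff hL π α v).2 h.2⟩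

theorem Isocrystal.newtonVector_spec {π : integerRing p F} (hπ : Irreducible π)
    (E : Isocrystal p F k D) {ι : Type*} [Fintype ι] (b : Module.Basis ι (L p F k) D) {β : ι → ℚ}
    (hb : ∀ i, E.HasSlope π (β i) (b i)) : Antitone (E.newtonVector π) ∧
      ∀ g : ℚ → ℚ, ∑ j, g (E.newtonVector π j) = ∑ i, g (β i) := by
  have hL : IsField (L p F k) := isField_L hπ
  let := fieldOfIsField hL
  exact FIsoc.newtonVector_spec E Finset.univ
    (by rw [Finset.card_univ, Module.finrank_eq_card_basis b]) (E.finrank_slopePart hπ b hb)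

theorem SubIsocrystal.sum_newtonVector {π : integerRing p F} (hπ : Irreducible π)
    {E : Isocrystal p F k D} (E' : SubIsocrystal E) {ι : Type*} [Fintype ι]
    (b : Module.Basis ι (L p F k) D) {β : ι → ℚ} (hb : ∀ i, E.HasSlope π (β i) (b i))
    (S : Finset ι) (hS : E'.carrier = Submodule.span (L p F k) (b '' S)) :
    ∑ j, E'.toIsocrystal.newtonVector π j = ∑ i ∈ S, β i := by
  have hL : IsField (L p F k) := isField_L hπ
  let := fieldOfIsField hL
  have h := E'.finrank_slopePart hπ b hb S hS
  exact (FIsoc.newtonVector_spec E'.toIsocrystal S h.1 h.2).2 id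

namespace Filtration
variable {Fil : Filtration p F k D}

theorem sum_typeVector_induced (hL : IsField (L p F k)) {a : ℤ} {n : ℕ}
    (ha : Fil.fil a = ⊤) (hn : Fil.fil (a + n) = ⊥) (W : Submodule (L p F k) D) :
    ∑ j, (Fil.induced W).typeVector j = a * Module.finrank (L p F k) W +
      ∑ t ∈ Finset.range n,
        (Module.finrank (L p F k) ↥(Fil.fil (a + t + 1) ⊓ W) : ℤ) := by
  let := fieldOfIsField hL
  have h1 : (Fil.induced W).fil a = ⊤ := by
    change (Fil.fil a).submoduleOf W = ⊤
    rw [ha]; exact Submodule.comap_top _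
  have h2 : (Fil.induced W).fil (a + n) = ⊥ := by
    change (Fil.fil (a + n)).submoduleOf W = ⊥
    rw [hn, Submodule.submoduleOf, Submodule.comap_bot, Submodule.ker_subtype]
  rw [(Fil.induced W).sum_typeVector hL h1 h2]
  congr 1
  refine Finset.sum_congr rfl fun t _ => ?_
  rw [← finrank_submoduleOf]
  rfl

theorem IsOfType.dim_eq' (hL : IsField (L p F k)) {d : ℕ} {μ : Fin d → ℤ} (h : Fil.IsOfType μ)
    {a : ℤ} {n : ℕ} (ha : Fil.fil a = ⊤) (hn : Fil.fil (a + n) = ⊥) {t : ℕ} (ht : t < n) :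
    Fil.dim (a + t + 1) = (Finset.univ.filter fun j => a + t + 1 ≤ μ j).card := by
  have := h.dim_eq hL ha hn (n - t - 1)
  rwa [show a + n - (n - t - 1 : ℕ) = a + t + 1 by omega] at this

theorem IsOfType.sum_typeVector_eq (hL : IsField (L p F k))
    {μ : Fin (Module.finrank (L p F k) D) → ℤ} (h : Fil.IsOfType μ) :
    ∑ j, Fil.typeVector j = ∑ j, μ j := by
  obtain ⟨a, n, ha, hn⟩ := Fil.exists_bounds hL
  rw [Fil.sum_typeVector hL ha hn, sum_eq_of_bounds _ μ a n fun j _ =>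
    ⟨(h.bounds hL ha hn j).1, (h.bounds hL ha hn j).2.le⟩, Finset.card_univ, Fintype.card_fin]
  congr 1
  exact Finset.sum_congr rfl fun t ht => by
    rw [← h.dim_eq' hL ha hn (Finset.mem_range.1 ht)]

/-- Both sides are sums over levels: the left one of the truncated difference `dim Fil^i + w - d`,
the right one of `dim (Fil^i ∩ W)`, which is at least as large. -/
theorem IsOfType.sum_tail_le (hL : IsField (L p F k))
    {μ : Fin (Module.finrank (L p F k) D) → ℤ} (hμ : Antitone μ) (h : Fil.IsOfType μ)
    (W : Submodule (L p F k) D) {w : ℕ} (hw : Module.finrank (L p F k) W = w) :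
    ∑ j with Module.finrank (L p F k) D - w ≤ j.val, μ j ≤
      ∑ j, (Fil.induced W).typeVector j := by
  subst hw
  let := fieldOfIsField hL
  obtain ⟨a, n, ha, hn⟩ := Fil.exists_bounds hL
  rw [sum_typeVector_induced hL ha hn, sum_tail_eq hμ a n (fun j =>
    ⟨(h.bounds hL ha hn j).1, (h.bounds hL ha hn j).2.le⟩) (Submodule.finrank_le W)]
  gcongr with t ht
  rw [← h.dim_eq' hL ha hn (Finset.mem_range.1 ht), dim]
  have h1 := Submodule.finrank_sup_add_finrank_inf_eq (Fil.fil (a + t + 1)) W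
  have h2 := Submodule.finrank_le (Fil.fil (a + t + 1) ⊔ W)
  omega

/-- General position `hW` turns the dimension bound at each level into an equality. -/
theorem IsOfType.sum_tail_eq (hL : IsField (L p F k))
    {μ : Fin (Module.finrank (L p F k) D) → ℤ} (hμ : Antitone μ) (h : Fil.IsOfType μ)
    (W : Submodule (L p F k) D) {w : ℕ} (hw : Module.finrank (L p F k) W = w)
    (hW : ∀ i, Module.finrank (L p F k) ↥(Fil.fil i ⊔ W) =
      min (Module.finrank (L p F k) D) (Module.finrank (L p F k) W + Fil.dim i)) :
    ∑ j with Module.finrank (L p F k) D - w ≤ j.val, μ j =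
      ∑ j, (Fil.induced W).typeVector j := by
  subst hw
  let := fieldOfIsField hL
  obtain ⟨a, n, ha, hn⟩ := Fil.exists_bounds hL
  rw [sum_typeVector_induced hL ha hn, FIsoc.sum_tail_eq hμ a n (fun j =>
    ⟨(h.bounds hL ha hn j).1, (h.bounds hL ha hn j).2.le⟩) (Submodule.finrank_le W)]
  congr 1
  refine Finset.sum_congr rfl fun t ht => ?_
  rw [← h.dim_eq' hL ha hn (Finset.mem_range.1 ht)]
  have h1 := Submodule.finrank_sup_add_finrank_inf_eq (Fil.fil (a + t + 1)) W
  have h2 := hW (a + t + 1)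
  rw [dim] at h2 ⊢
  omega

end Filtration

/-! ### The two implications -/

theorem IsAdmissible.dominatedBy {π : integerRing p F} (hπ : Irreducible π)
    {E : Isocrystal p F k D} {μ : Fin (Module.finrank (L p F k) D) → ℤ} (hμ : Antitone μ)
    {Fil : Filtration p F k D} (hFil : Fil.IsOfType μ) (h : IsAdmissible E π Fil) :
    DominatedBy (E.newtonVector π) (fun j => (μ j : ℚ)) := by
  classical
  have hL : IsField (L p F k) := isField_L hπ
  let := fieldOfIsField hL
  have H := frobRing_L p F k hπ
  obtain ⟨T, inst, b, β, -, hb, -⟩ := E.exists_adapted_basis hπ ⊤ fun _ _ => trivial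
  have hb' := fun i => (E.hasSlope_iff hL π _ _).1 (hb i)
  obtain ⟨hν, hg⟩ := E.newtonVector_spec hπ b hb
  set ν := E.newtonVector π
  -- For a downward closed set `P` of slopes, the basis vectors with slope in `P` span a
  -- sub-isocrystal, and the indices `j` with `P (ν j)` form a tail of matching length.
  -- Admissibility on it is compared with the dimension bound.
  have key : ∀ (P : ℚ → Prop) [DecidablePred P], (∀ x y, x ≤ y → P y → P x) →
      ∑ j with P (ν j), (μ j : ℚ) ≤ ∑ j with P (ν j), ν j := by
    intro P _ hP
    let S : Finset T := Finset.univ.filter fun i => P (β i)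
    let E' : SubIsocrystal E := ⟨Submodule.span (L p F k) (b '' S),
      H.bijOn_span_image E.bijective.1 b hb' P⟩
    have h1 := h.sub E'
    rw [E'.sum_newtonVector hπ b hb S rfl] at h1
    have h2 : ∑ i ∈ S, β i = ∑ j with P (ν j), ν j := by
      rw [Finset.sum_filter, Finset.sum_filter]
      exact (hg fun x => if P x then x else 0).symm
    have h3 : S.card = (Finset.univ.filter fun j => P (ν j)).card := by
      have := hg fun x => if P x then 1 else 0
      rw [← Finset.sum_filter, ← Finset.sum_filter] at this
      simp only [Finset.sum_const, nsmul_eq_mul, mul_one] at this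
      exact_mod_cast this.symm
    have h4 : Module.finrank (L p F k) E'.carrier = S.card :=
      (E'.finrank_slopePart hπ b hb S rfl).1.symm
    have h5 := hFil.sum_tail_le hL hμ E'.carrier (h4.trans h3)
    have h6 : (Finset.univ.filter fun j => P (ν j)) = Finset.univ.filter fun j =>
        Module.finrank (L p F k) D - (Finset.univ.filter fun j => P (ν j)).card ≤ j.val := by
      ext j
      rw [mem_iff_sub_card_le _ (fun i j hij hi => by
        rw [Finset.mem_filter] at hi ⊢
        exact ⟨Finset.mem_univ _, hP _ _ (hν hij) hi.2⟩) j]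
      simp
    rw [← h6] at h5
    rw [← h2]
    refine le_trans ?_ h1
    exact_mod_cast h5
  refine dominatedBy_of_threshold hν (fun i j hij => by exact_mod_cast hμ hij) ?_
    (fun t => key (fun x => x < t) fun x y hxy hy => hxy.trans_lt hy)
    (fun t => key (fun x => x ≤ t) fun x y hxy hy => hxy.trans hy)
  rw [← h.total]
  exact_mod_cast hFil.sum_typeVector_eq hL

theorem exists_isAdmissible {π : integerRing p F} (hπ : Irreducible π)
    (E : Isocrystal p F k D) {μ : Fin (Module.finrank (L p F k) D) → ℤ} (hμ : Antitone μ)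
    (h : DominatedBy (E.newtonVector π) (fun j => (μ j : ℚ))) :
    ∃ Fil : Filtration p F k D, Fil.IsOfType μ ∧ IsAdmissible E π Fil := by
  classical
  have hL : IsField (L p F k) := isField_L hπ
  let := fieldOfIsField hL
  have H := frobRing_L p F k hπ
  obtain ⟨T, inst, b, β, -, hb, -⟩ := E.exists_adapted_basis hπ ⊤ fun _ _ => trivial
  have hb' := fun i => (E.hasSlope_iff hL π _ _).1 (hb i)
  obtain ⟨N, hN, hrat⟩ := H.exists_isRational E.bijective.1 b hb'
  obtain ⟨v, hv⟩ := H.exists_generic_sequence b hN (Module.finrank (L p F k) D)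
  -- `c i` is the dimension that type `μ` forces on `Fil^i`, so `Fil^i` is the span of the first `c
  -- i` vectors of the generic sequence.
  let c : ℤ → ℕ := fun i => (Finset.univ.filter fun j => i ≤ μ j).card
  have hcd : ∀ i, c i ≤ Module.finrank (L p F k) D := fun i => by
    simpa using Finset.card_le_univ (Finset.univ.filter fun j => i ≤ μ j)
  have hcanti : Antitone c := fun i j hij => Finset.card_le_card fun x hx => by
    rw [Finset.mem_filter] at hx ⊢
    exact ⟨hx.1, hij.trans hx.2⟩
  let fil : ℤ → Submodule (L p F k) D := fun i => Submodule.span (L p F k) (v '' Set.Iio (c i))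
  have hdim : ∀ i, Module.finrank (L p F k) (fil i) = c i := by
    intro i
    -- Genericity with respect to the zero subspace says that the sequence is independent as far as
    -- dimensions allow.
    have := hv ⊥ ⟨∅, by simp, by simp⟩ (c i) (hcd i)
    rw [bot_sup_eq, finrank_bot, zero_add, min_eq_right (hcd i)] at this
    exact this
  obtain ⟨a, ha⟩ : ∃ a, ∀ j, a ≤ μ j := by
    obtain ⟨a, ha⟩ := (Set.finite_range μ).bddBelow
    exact ⟨a, fun j => ha ⟨j, rfl⟩⟩
  obtain ⟨a', ha'⟩ : ∃ a, ∀ j, μ j ≤ a := by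
    obtain ⟨a, ha⟩ := (Set.finite_range μ).bddAbove
    exact ⟨a, fun j => ha ⟨j, rfl⟩⟩
  have htop : fil a = ⊤ := by
    refine Submodule.eq_top_of_finrank_eq ((hdim a).trans ?_)
    simp [c, ha]
  have hbot : fil (a' + 1) = ⊥ := by
    rw [← Submodule.finrank_eq_zero (R := L p F k), hdim]
    refine Finset.card_eq_zero.2 (Finset.filter_eq_empty_iff.2 fun j _ => ?_)
    have := ha' j
    omega
  let Fil : Filtration p F k D :=
    { fil := fil
      antitone := fun i j hij => Submodule.span_mono (Set.image_mono
        (Set.Iio_subset_Iio (hcanti hij)))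
      exhaustive := Set.eq_univ_of_forall fun x => Set.mem_iUnion.2 ⟨a, by
        rw [htop]; trivial⟩
      separated := by
        refine Set.Subset.antisymm (fun x hx => ?_) ?_
        · have := Set.mem_iInter.1 hx (a' + 1)
          rw [hbot] at this
          exact this
        · rintro _ rfl
          exact Set.mem_iInter.2 fun i => zero_mem _ }
  have hType : Fil.IsOfType μ := by
    intro i
    have h1 := Fil.grDim_add hL i
    have h2 : ∀ i, Fil.dim i = c i := hdim
    rw [h2, h2] at h1
    have h3 := Filtration.card_eq_add μ i
    change c i = _ + c (i + 1) at h3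
    omega
  refine ⟨Fil, hType, ?_, fun E' => ?_⟩
  · refine Eq.trans ?_ h.2.symm
    dsimp only
    exact_mod_cast hType.sum_typeVector_eq hL
  · obtain ⟨T', inst', b', β', S', hb', hS'⟩ := E.exists_adapted_basis hπ E'.carrier
      fun w hw => E'.bijOn.mapsTo hw
    obtain ⟨hν, hg⟩ := E.newtonVector_spec hπ b' hb'
    have hcard := (E'.finrank_slopePart hπ b' hb' S' hS').1
    rw [E'.sum_newtonVector hπ b' hb' S' hS']
    have h1 := hType.sum_tail_eq hL hμ E'.carrier hcard.symm fun i => by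
      have := hv E'.carrier (hrat _ fun w hw => E'.bijOn.mapsTo hw) (c i) (hcd i)
      rw [sup_comm] at this
      rw [show Fil.dim i = c i from hdim i]
      exact this
    -- Dominance compares the tails of `μ` and `ν`; the tail of `ν` is then the least sum of
    -- `S'.card` slopes.
    have h2 := h.sum_tail_le S'.card
    have h3 := sum_tail_le_sum hν hg S' (hcard ▸ Submodule.finrank_le _)
    have h4 : ∑ j, ((Fil.induced E'.carrier).typeVector j : ℚ) =
        ∑ j with Module.finrank (L p F k) D - S'.card ≤ j.val, (μ j : ℚ) := by
      exact_mod_cast h1.symm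
    rw [h4]
    exact h2.trans h3

end Iso

end FIsoc

end

theorem mainTheorem1 (p : ℕ) [Fact p.Prime]
    {F : Type*} [Field F] [Algebra ℚ_[p] F] [FiniteDimensional ℚ_[p] F]
    {k : Type*} [Field k] [IsAlgClosed k] [Algebra (FIsoc.ResField p F) k]
    {D : Type*} [AddCommGroup D] [Module (FIsoc.L p F k) D] [Module.Finite (FIsoc.L p F k) D]
    (E : FIsoc.Isocrystal p F k D)
    (π : FIsoc.integerRing p F) (hπ : Irreducible π)
    (μ : Fin (Module.finrank (FIsoc.L p F k) D) → ℤ) (hμ : Antitone μ) :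
    (∃ Fil : FIsoc.Filtration p F k D, Fil.IsOfType μ ∧ FIsoc.IsAdmissible E π Fil) ↔
      FIsoc.DominatedBy (E.newtonVector π) (fun j => (μ j : ℚ)) :=
  ⟨fun ⟨_, hFil, h⟩ => h.dominatedBy hπ hμ hFil, FIsoc.exists_isAdmissible hπ E hμ⟩
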